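/- **Setting.** Consider the Wilson case (W), with $\gamma=1$, $\eta(x)=x^2$, $\varphi(x)=2x$, $a_k=\lambda_k$, and the Askey–Wilson case (AW), with $0<q<1$, $\gamma=\log q$, $\eta(x)=\cos x$, $\varphi(x)=2\sin x$, $a_k=q^{\lambda_k}$ $(k=1,\dots,4)$, where $\boldsymbol\lambda\in\mathbb C^4$. Let $P_n(\eta;\boldsymbol\lambda)$ be the Wilson polynomial $$(a_1+a_2,a_1+a_3,a_1+a_4)_n\;{}_4F_3\!\left({-n,\;n+a_1+a_2+a_3+a_4-1,\;a_1+ix,\;a_1-ix\atop a_1+a_2,\;a_1+a_3,\;a_1+a_4}\Big|1\right)$$ respectively the Askey–Wilson polynomial $$a_1^{-n}(a_1a_2,a_1a_3,a_1a_4;q)_n\;{}_4\phi_3\!\left({q^{-n},\;a_1a_2a_3a_4q^{n-1},\;a_1e^{ix},\;a_1e^{-ix}\atop a_1a_2,\;a_1a_3,\;a_1a_4}\Big|q;q\right),\qquad \eta=\eta(x),$$ the prefactor being multiplied into the sum, so that $P_n$ is a polynomial in $\eta$ for all parameters. Put $\check P_n(x;\boldsymbol\lambda)=P_n(\eta(x);\boldsymbol\lambda)$,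 $\mathfrak t(\boldsymbol\lambda)=(1-\lambda_k)_k$, $\check\xi_{\rm v}(x;\boldsymbol\lambda)=\check P_{\rm v}(x;\mathfrak t(\boldsymbol\lambda))$, $\boldsymbol\delta=(\frac12,\frac12,\frac12,\frac12)$, $x^{(n)}_j=x+i(\frac{n+1}2-j)\gamma$, $$\mathrm W_\gamma[f_1,\dots,f_n](x)=i^{n(n-1)/2}\det\bigl(f_k(x_j^{(n)})\bigr)_{1\le j,k\le n},\qquad \varphi_M(x)=\varphi(x)^{[M/2]}\prod_{k=1}^{M-2}\bigl(\varphi(x-\tfrac{ik\gamma}2)\varphi(x+\tfrac{ik\gamma}2)\bigr)^{[(M-k)/2]}.$$ For a finite sequence $L=(l_1,\dots,l_m)$ of distinct non-negative integers let $\bar\Xi_L$, $\Xi_L$ be the polynomials in $\eta$ with $$\bar\Xi_L(\eta(x);\boldsymbol\lambda)=\varphi_m(x)^{-1}\mathrm W_\gamma[\check P_{l_1},\dots,\check P_{l_m}](x;\boldsymbol\lambda),\qquad \Xi_L(\eta(x);\boldsymbol\lambda)=\varphi_m(x)^{-1}\mathrm W_\gamma[\check\xi_{l_1},\dots,\check\xi_{l_m}](x;\boldsymbol\lambda).$$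 For $\mathcal D=(d_1,\dots,d_M)$ let $P_{\mathcal D,n}$ be the polynomial in $\eta$ with $$P_{\mathcal D,n}(\eta(x);\boldsymbol\lambda)=\varphi_{M+1}(x)^{-1}\,i^{M(M+1)/2}\det\Bigl(\check\xi_{d_1}(x_j^{(M+1)};\boldsymbol\lambda),\dots,\check\xi_{d_M}(x_j^{(M+1)};\boldsymbol\lambda),\;r_j(x)\,\check P_n(x_j^{(M+1)};\boldsymbol\lambda)\Bigr)_{1\le j\le M+1},$$ where $$r_j(x)=\begin{cases}\prod_{k=1}^4(a_k-\frac M2+ix)_{j-1}(a_k-\frac M2-ix)_{M+1-j}&(\mathrm W)\\[2pt] q^{2(j-1)(M+1-j)}e^{2ix(M+2-2j)}\prod_{k=1}^4(a_kq^{-M/2}e^{ix};q)_{j-1}(a_kq^{-M/2}e^{-ix};q)_{M+1-j}&(\mathrm{AW}).\end{cases}$$ (Up to a factor independent of $j$ and $x$, $r_j(x)=\nu(x^{(M+1)}_j;\boldsymbol\lambda)/\nu(x;\boldsymbol\lambda-M\boldsymbol\delta)$ with $\nu(x;\boldsymbol\lambda)=\phi_0(x;\boldsymbol\lambda)/\phi_0(x;\mathfrak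 t(\boldsymbol\lambda))$, $\phi_0$ the ground state wave function.) **Statement.** Let $\boldsymbol\lambda\in\mathbb C^4$, let $d_1,\dots,d_M$ be distinct non-negative integers, and let $N\ge\max_j d_j$ be an integer, $N\ge0$. Put $\bar d_j=N-d_j$, $\bar{\mathcal D}=\{0,1,\dots,N\}\setminus\{\bar d_1,\dots,\bar d_M\}$ (in increasing order), $\bar{\boldsymbol\lambda}=\boldsymbol\lambda-(N+1)\boldsymbol\delta$. Then all the polynomials below exist, and $$P_{\mathcal D,n}(\eta;\boldsymbol\lambda)\propto\bar\Xi_{\bar{\mathcal D},\,N+1+n}(\eta;\bar{\boldsymbol\lambda})\quad(n=0,1,2,\dots),\tag{1}$$ $$\Xi_{d_1\dots d_{j-1}d_{j+1}\dots d_M}(\eta;\boldsymbol\lambda)\propto\bar\Xi_{\bar{\mathcal D},\,\bar d_j}(\eta;\bar{\boldsymbol\lambda})\quad(j=1,\dots,M).\tag{2}$$ Here $\propto$ has the following meaning. For every $\boldsymbol\lambda$ the two polynomials in $\eta$ are linearly dependent over $\mathbb C$. If moreover $\boldsymbol\lambda$ is generic in the sense that $a_1+a_2+a_3+a_4\ne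 m$ (W), respectively $a_1a_2a_3a_4\ne q^m$ (AW), for all integers $m$ with $2-2n\le m\le 2N+2$ in (1), respectively $4\le m\le 2N+2$ in (2), then the left-hand side is $c$ times the right-hand side with a constant $c\ne0$ independent of $\eta$. -/

import Mathlib

namespace CasoratianDuality

/-- The two families: Wilson, and Askey-Wilson with base `0 < q < 1`. -/
inductive Family where
  | wilson : Family
  | askeyWilson (q : ℝ) (q_pos : 0 < q) (q_lt_one : q < 1) : Family

/-- Shifted factorial `(a)_n`. -/
noncomputable def poch (a : ℂ) (n : ℕ) : ℂ := ∏ i ∈ Finset.range n, (a + i)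

/-- `q`-shifted factorial `(a;q)_n`. -/
noncomputable def qpoch (a q : ℂ) (n : ℕ) : ℂ := ∏ i ∈ Finset.range n, (1 - a * q ^ i)

/-- `(a;q)_∞`. -/
noncomputable def qpochInf (a q : ℂ) : ℂ := ∏' i : ℕ, (1 - a * q ^ i)

/-- The step `γ`. -/
noncomputable def gam : Family → ℝ
  | .wilson => 1
  | .askeyWilson q _ _ => Real.log q

/-- The sinusoidal coordinate `η(x)`. -/
noncomputable def eta : Family → ℂ → ℂ
  | .wilson, x => x ^ 2
  | .askeyWilson _ _ _, x => Complex.cos x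

/-- The auxiliary function `φ(x)`. -/
noncomputable def phi : Family → ℂ → ℂ
  | .wilson, x => 2 * x
  | .askeyWilson _ _ _, x => 2 * Complex.sin x

/-- The parameters `a_k`: `a = λ` for Wilson, `a = q ^ λ` for Askey-Wilson. -/
noncomputable def param : Family → (Fin 4 → ℂ) → Fin 4 → ℂ
  | .wilson, lam, k => lam k
  | .askeyWilson q _ _, lam, k => (q : ℂ) ^ lam k

/-- `λ - s δ` with `δ = (1/2, 1/2, 1/2, 1/2)`. -/
noncomputable def shift (lam : Fin 4 → ℂ) (s : ℕ) : Fin 4 → ℂ := fun k => lam k - s / 2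

/-- The twist `𝔱(λ) = (1 - λ₁, 1 - λ₂, 1 - λ₃, 1 - λ₄)`. -/
noncomputable def twist (lam : Fin 4 → ℂ) : Fin 4 → ℂ := fun k => 1 - lam k

/-- The Wilson polynomial `W_n(η; a)` as a polynomial in `η`. The prefactor
`(a₁+a₂, a₁+a₃, a₁+a₄)_n` is multiplied into the terminating `₄F₃` series through
`(c)_n / (c)_k = (c + k)_{n-k}`, and `(a₁+ix)_k (a₁-ix)_k = ∏_{i<k} ((a₁+i)² + η)`. -/
noncomputable def wilsonPoly (n : ℕ) (a : Fin 4 → ℂ) : Polynomial ℂ :=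
  ∑ k ∈ Finset.range (n + 1),
    Polynomial.C (poch (-n) k * poch (n + (∑ i, a i) - 1) k / (k.factorial : ℂ)
        * (poch (a 0 + a 1 + k) (n - k) * poch (a 0 + a 2 + k) (n - k)
          * poch (a 0 + a 3 + k) (n - k)))
      * ∏ i ∈ Finset.range k, (Polynomial.C ((a 0 + i) ^ 2) + Polynomial.X)

/-- The Askey-Wilson polynomial `p_n(η; a | q)` as a polynomial in `η`. The prefactor
`(a₁a₂, a₁a₃, a₁a₄; q)_n` is multiplied into the terminating `₄φ₃` series through
`(c;q)_n / (c;q)_k = (c q^k; q)_{n-k}`, and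
`(a₁e^{ix}, a₁e^{-ix}; q)_k = ∏_{i<k} (1 - 2 a₁ q^i η + a₁² q^{2i})`. -/
noncomputable def askeyWilsonPoly (q : ℂ) (n : ℕ) (a : Fin 4 → ℂ) : Polynomial ℂ :=
  ∑ k ∈ Finset.range (n + 1),
    Polynomial.C ((a 0 ^ n)⁻¹ * (qpoch (q ^ n)⁻¹ q k * qpoch ((∏ i, a i) * q ^ n / q) q k
        / qpoch q q k * q ^ k)
        * (qpoch (a 0 * a 1 * q ^ k) q (n - k) * qpoch (a 0 * a 2 * q ^ k) q (n - k)
          * qpoch (a 0 * a 3 * q ^ k) q (n - k)))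
      * ∏ i ∈ Finset.range k,
          (1 - Polynomial.C (2 * a 0 * q ^ i) * Polynomial.X + Polynomial.C ((a 0 * q ^ i) ^ 2))

/-- The eigenpolynomial `P_n(η; λ)`. -/
noncomputable def eigenPoly : Family → ℕ → (Fin 4 → ℂ) → Polynomial ℂ
  | .wilson, n, lam => wilsonPoly n (param .wilson lam)
  | .askeyWilson q h₀ h₁, n, lam => askeyWilsonPoly q n (param (.askeyWilson q h₀ h₁) lam)

/-- `P̌_n(x; λ) = P_n(η(x); λ)`. -/
noncomputable def PCheck (F : Family) (n : ℕ) (lam : Fin 4 → ℂ) (x : ℂ) : ℂ :=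
  (eigenPoly F n lam).eval (eta F x)

/-- `ξ̌_v(x; λ) = P̌_v(x; 𝔱(λ))`. -/
noncomputable def xiCheck (F : Family) (v : ℕ) (lam : Fin 4 → ℂ) (x : ℂ) : ℂ :=
  PCheck F v (twist lam) x

/-- The node `x_j^{(n)} = x + i ((n+1)/2 - j) γ`, with the index `j - 1 = s` counted from zero. -/
noncomputable def node (F : Family) (n s : ℕ) (x : ℂ) : ℂ :=
  x + Complex.I * (((n : ℂ) - 1) / 2 - s) * gam F

/-- The Casorati determinant `W_γ[f₁, …, f_n](x)`. -/
noncomputable def casoratian (F : Family) {n : ℕ} (f : Fin n → ℂ → ℂ) (x : ℂ) : ℂ :=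
  Complex.I ^ (n * (n - 1) / 2) * Matrix.det (Matrix.of fun j k : Fin n => f k (node F n j x))

/-- The auxiliary function `φ_M(x)`. -/
noncomputable def phiM (F : Family) (M : ℕ) (x : ℂ) : ℂ :=
  phi F x ^ (M / 2) * ∏ k ∈ Finset.Icc 1 (M - 2),
    (phi F (x - Complex.I * (k / 2) * gam F) * phi F (x + Complex.I * (k / 2) * gam F))
      ^ ((M - k) / 2)

/-- `p` is the polynomial with `p(η(x)) = φ_M(x)⁻¹ g(x)`. -/
def IsPolyPart (F : Family) (M : ℕ) (g : ℂ → ℂ) (p : Polynomial ℂ) : Prop :=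
  ∀ x : ℂ, phiM F M x * p.eval (eta F x) = g x

/-- `p` is the polynomial `Ξ̄_L(η; λ)`, for a list of indices `L`. -/
def IsXiBar (F : Family) (L : List ℕ) (lam : Fin 4 → ℂ) (p : Polynomial ℂ) : Prop :=
  IsPolyPart F L.length (casoratian F fun k : Fin L.length => PCheck F (L.get k) lam) p

/-- `p` is the polynomial `Ξ_L(η; λ)`, for a list of indices `L`. -/
def IsXi (F : Family) (L : List ℕ) (lam : Fin 4 → ℂ) (p : Polynomial ℂ) : Prop :=
  IsPolyPart F L.length (casoratian F fun k : Fin L.length => xiCheck F (L.get k) lam) p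

/-- The factor `r_j(x_j^{(M+1)}; λ, M+1)`, with `j - 1 = s` counted from zero, in its explicit
form, without the multiplicative constant that depends on `M` and `λ` only. It is the quotient
`ν(x_j^{(M+1)}; λ) / ν(x; λ - M δ)`, `ν(x; λ) = φ₀(x; λ) / φ₀(x; 𝔱(λ))`;
see `rFactor_sq` below. -/
noncomputable def rFactor (F : Family) (M s : ℕ) (lam : Fin 4 → ℂ) (x : ℂ) : ℂ :=
  match F with
  | .wilson => ∏ k, (poch (param .wilson (shift lam M) k + Complex.I * x) s
      * poch (param .wilson (shift lam M) k - Complex.I * x) (M - s))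
  | .askeyWilson q h₀ h₁ =>
      Complex.exp (2 * Complex.I * x * ((M : ℂ) - 2 * s)) * (q : ℂ) ^ (2 * s * (M - s))
      * ∏ k, (qpoch (param (.askeyWilson q h₀ h₁) (shift lam M) k * Complex.exp (Complex.I * x)) q s
        * qpoch (param (.askeyWilson q h₀ h₁) (shift lam M) k * Complex.exp (-(Complex.I * x))) q
            (M - s))

/-- `p` is the multi-indexed polynomial `P_{D,n}(η; λ)`: the determinant has the columns
`ξ̌_d(x_j^{(M+1)}; λ)`, `d ∈ D`, and the last column `r_j P̌_n(x_j^{(M+1)}; λ)`. -/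
def IsMultiIndexed (F : Family) (D : List ℕ) (n : ℕ) (lam : Fin 4 → ℂ)
    (p : Polynomial ℂ) : Prop :=
  IsPolyPart F (D.length + 1)
    (fun x => Complex.I ^ (D.length * (D.length + 1) / 2)
      * Matrix.det (Matrix.of fun j k : Fin (D.length + 1) =>
          Fin.snoc (α := fun _ => ℂ)
            (fun k : Fin D.length => xiCheck F (D.get k) lam (node F (D.length + 1) j x))
            (rFactor F D.length j lam x * PCheck F n lam (node F (D.length + 1) j x)) k))
    p

/-- `D̄ = {0, 1, …, N} \ {N - d | d ∈ D}`, in increasing order. -/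
def dualIndex (D : List ℕ) (N : ℕ) : List ℕ :=
  (List.range (N + 1)).filter fun e => e ∉ D.map fun d => N - d

/-- Proportionality in the sense that is meaningful for all parameter values:
linear dependence. -/
def LinearlyDependent (p r : Polynomial ℂ) : Prop :=
  ∃ a b : ℂ, (a ≠ 0 ∨ b ≠ 0) ∧ Polynomial.C a * p = Polynomial.C b * r

/-- Genericity: `a₁+a₂+a₃+a₄ ≠ m` (Wilson), `a₁a₂a₃a₄ ≠ q^m` (Askey-Wilson) for the integers
`lo ≤ m ≤ hi`. -/
def Generic (F : Family) (lam : Fin 4 → ℂ) (lo hi : ℤ) : Prop :=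
  ∀ m : ℤ, lo ≤ m → m ≤ hi →
    match F with
    | .wilson => ∑ k, param .wilson lam k ≠ (m : ℂ)
    | .askeyWilson q h₀ h₁ => ∏ k, param (.askeyWilson q h₀ h₁) lam k ≠ (q : ℂ) ^ m

/-- The square of the ground state `φ₀(x; λ)`. -/
noncomputable def phi0Sq (F : Family) (lam : Fin 4 → ℂ) (x : ℂ) : ℂ :=
  match F with
  | .wilson => (Complex.Gamma (2 * Complex.I * x) * Complex.Gamma (-(2 * Complex.I * x)))⁻¹
      * ∏ k, (Complex.Gamma (param .wilson lam k + Complex.I * x)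
        * Complex.Gamma (param .wilson lam k - Complex.I * x))
  | .askeyWilson q h₀ h₁ =>
      qpochInf (Complex.exp (2 * Complex.I * x)) q * qpochInf (Complex.exp (-(2 * Complex.I * x))) q
      * ∏ k, (qpochInf (param (.askeyWilson q h₀ h₁) lam k * Complex.exp (Complex.I * x)) q
        * qpochInf (param (.askeyWilson q h₀ h₁) lam k * Complex.exp (-(Complex.I * x))) q)⁻¹

/-- `ν(x; λ)²`. -/
noncomputable def nuSq (F : Family) (lam : Fin 4 → ℂ) (x : ℂ) : ℂ :=
  phi0Sq F lam x / phi0Sq F (twist lam) x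

/-- No zero or pole of a factor of `ν(x; λ)²` or of its shifts by `iγ` at `x`. -/
def Regular (F : Family) (lam : Fin 4 → ℂ) (x : ℂ) : Prop :=
  ∀ m : ℤ,
    match F with
    | .wilson => 2 * Complex.I * x ≠ m
        ∧ ∀ k, param .wilson lam k + Complex.I * x ≠ m ∧ param .wilson lam k - Complex.I * x ≠ m
    | .askeyWilson q h₀ h₁ => Complex.exp (2 * Complex.I * x) ≠ (q : ℂ) ^ m
        ∧ ∀ k, param (.askeyWilson q h₀ h₁) lam k * Complex.exp (Complex.I * x) ≠ (q : ℂ) ^ m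
          ∧ param (.askeyWilson q h₀ h₁) lam k * Complex.exp (-(Complex.I * x)) ≠ (q : ℂ) ^ m

theorem isPolyPart_unique (F : Family) (M : ℕ) (g : ℂ → ℂ) (p r : Polynomial ℂ)
    (hp : IsPolyPart F M g p) (hr : IsPolyPart F M g r) : p = r := by
  have key : ∀ t : ℝ, t ∈ Set.Ioo (0 : ℝ) 1 → ∀ y : ℝ, phi F (t + Complex.I * y) ≠ 0 := by
    intro t ht y h
    cases F with
    | wilson =>
      have := congrArg Complex.re h
      simp [phi] at this
      exact ht.1.ne' this
    | askeyWilson q h₀ h₁ =>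
      simp only [phi, mul_eq_zero, OfNat.ofNat_ne_zero, false_or] at h
      obtain ⟨k, hk⟩ := Complex.sin_eq_zero_iff.1 h
      have h1 := congrArg Complex.re hk
      simp at h1
      have hpi := Real.pi_gt_three
      rcases lt_trichotomy k 0 with hk0 | hk0 | hk0
      · have : (k : ℝ) < 0 := by exact_mod_cast hk0
        nlinarith [ht.1]
      · subst hk0; simp at h1; linarith [ht.1]
      · have : (1 : ℝ) ≤ k := by exact_mod_cast hk0
        nlinarith [ht.2]
  have hphi : ∀ t : ℝ, t ∈ Set.Ioo (0 : ℝ) 1 → phiM F M t ≠ 0 := by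
    intro t ht
    unfold phiM
    refine mul_ne_zero (pow_ne_zero _ ?_) (Finset.prod_ne_zero_iff.2 fun k _ =>
      pow_ne_zero _ (mul_ne_zero ?_ ?_))
    · simpa using key t ht 0
    · have := key t ht (-(k / 2 * gam F))
      convert this using 2
      push_cast; ring
    · have := key t ht (k / 2 * gam F)
      convert this using 2
      push_cast; ring
  have hinj : Set.InjOn (fun t : ℝ => eta F t) (Set.Ioo (0 : ℝ) 1) := by
    intro s hs t ht h
    cases F with
    | wilson =>
      simp only [eta] at h
      have h' : s ^ 2 = t ^ 2 := by exact_mod_cast h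
      exact (pow_left_inj₀ hs.1.le ht.1.le two_ne_zero).1 h'
    | askeyWilson q h₀ h₁ =>
      simp only [eta] at h
      have h' : Real.cos s = Real.cos t := by exact_mod_cast h
      have hpi := Real.pi_gt_three
      exact Real.injOn_cos ⟨hs.1.le, by linarith [hs.2]⟩ ⟨ht.1.le, by linarith [ht.2]⟩ h'
  refine Polynomial.eq_of_infinite_eval_eq p r
    (((Set.Ioo_infinite (zero_lt_one : (0 : ℝ) < 1)).image hinj).mono ?_)
  rintro _ ⟨t, ht, rfl⟩
  exact mul_left_cancel₀ (hphi t ht) ((hp t).trans (hr t).symm)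

theorem gamma_quotient_shift (z : ℂ) (hz : ∀ m : ℤ, z ≠ m) (s : ℕ) :
    Complex.Gamma (z + s) / Complex.Gamma (1 - (z + s))
      = (-1) ^ s * poch z s ^ 2 * (Complex.Gamma z / Complex.Gamma (1 - z)) := by
  induction s with
  | zero => simp [poch]
  | succ s ih =>
    have hw : z + s ≠ 0 := fun h => hz (-(s : ℤ)) (by push_cast; linear_combination h)
    have h1 : Complex.Gamma (z + (s + 1 : ℕ)) = (z + s) * Complex.Gamma (z + s) := by
      rw [← Complex.Gamma_add_one _ hw]; congr 1; push_cast; ring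
    have h2 : Complex.Gamma (1 - (z + s)) = -(z + s) * Complex.Gamma (1 - (z + (s + 1 : ℕ))) := by
      have := Complex.Gamma_add_one (-(z + s)) (neg_ne_zero.2 hw)
      rw [show -(z + s : ℂ) + 1 = 1 - (z + s) by ring] at this
      rw [this]; congr 2; push_cast; ring
    have h3 : Complex.Gamma (1 - (z + (s + 1 : ℕ))) ≠ 0 := by
      refine Complex.Gamma_ne_zero fun m h => hz ((m : ℤ) - s) ?_
      push_cast at h ⊢; linear_combination -h
    have h4 : poch z (s + 1) = poch z s * (z + s) := by simp [poch, Finset.prod_range_succ]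
    rw [h2] at ih
    rw [h1, h4, pow_succ, div_eq_iff h3]
    rw [div_eq_iff (mul_ne_zero (neg_ne_zero.2 hw) h3)] at ih
    rw [ih]; ring

theorem qpochInf_step (a q : ℂ) (hq : ‖q‖ < 1) :
    qpochInf a q = (1 - a) * qpochInf (a * q) q := by
  have hs : ∀ b : ℂ, Multipliable fun i : ℕ => 1 - b * q ^ i := by
    intro b
    have : Summable fun i : ℕ => ‖-(b * q ^ i)‖ := by
      simpa [norm_mul] using (summable_geometric_of_lt_one (norm_nonneg q) hq).mul_left ‖b‖
    simpa [sub_eq_add_neg] using multipliable_one_add_of_summable this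
  unfold qpochInf
  rw [tprod_eq_zero_mul']
  · simp [pow_succ', mul_assoc]
  · simpa [pow_succ', mul_assoc] using hs (a * q)

theorem qpochInf_ne_zero (a q : ℂ) (hq : ‖q‖ < 1) (h : ∀ i : ℕ, 1 - a * q ^ i ≠ 0) :
    qpochInf a q ≠ 0 := by
  have hs : Summable fun i : ℕ => ‖-(a * q ^ i)‖ := by
    simpa [norm_mul] using (summable_geometric_of_lt_one (norm_nonneg q) hq).mul_left ‖a‖
  unfold qpochInf
  simpa [sub_eq_add_neg] using tprod_one_add_ne_zero_of_summable
    (f := fun i : ℕ => -(a * q ^ i)) (by simpa [sub_eq_add_neg] using h) hs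

theorem qpoch_quotient_shift (q u : ℂ) (hq : ‖q‖ < 1) (hq0 : q ≠ 0) (hu0 : u ≠ 0)
    (hu : ∀ m : ℤ, u ≠ q ^ m) (s : ℕ) :
    qpochInf (q / (u * q ^ s)) q / qpochInf (u * q ^ s) q * ((-1) ^ s * u ^ s * q ^ (s * (s - 1) / 2))
      = qpoch u q s ^ 2 * (qpochInf (q / u) q / qpochInf u q) := by
  induction s with
  | zero => simp [qpoch]
  | succ s ih =>
    have hus : u * q ^ s ≠ 0 := mul_ne_zero hu0 (pow_ne_zero _ hq0)
    have hne : ∀ t : ℕ, qpochInf (u * q ^ t) q ≠ 0 := by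
      intro t
      refine qpochInf_ne_zero _ _ hq fun i h => hu (-((t + i : ℕ) : ℤ)) ?_
      rw [zpow_neg, zpow_natCast]
      refine eq_inv_of_mul_eq_one_left ?_
      rw [pow_add]
      linear_combination -h
    have h1 := qpochInf_step (u * q ^ s) q hq
    have h2 := qpochInf_step (q / (u * q ^ (s + 1))) q hq
    rw [show q / (u * q ^ (s + 1)) * q = q / (u * q ^ s) by
      rw [pow_succ]; field_simp] at h2
    rw [show u * q ^ s * q = u * q ^ (s + 1) by ring] at h1
    have h4 : qpoch u q (s + 1) = qpoch u q s * (1 - u * q ^ s) := by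
      simp [qpoch, Finset.prod_range_succ]
    have h5 : q ^ ((s + 1) * (s + 1 - 1) / 2) = q ^ (s * (s - 1) / 2) * q ^ s := by
      rw [← pow_add]; congr 1
      have := Finset.sum_range_id_mul_two s
      have h6 := Finset.sum_range_id_mul_two (s + 1)
      rw [Finset.sum_range_succ] at h6
      omega
    have h7 : 1 - u * q ^ s ≠ 0 := by
      intro h; apply hne s; rw [h1, h, zero_mul]
    rw [h4, h5, h2]
    rw [mul_pow, mul_right_comm (qpoch u q s ^ 2), ← ih, h1]
    have h8 := hne (s + 1)
    rw [pow_succ q s] at h8 ⊢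
    field_simp
    ring

theorem nuSq_wilson (lam : Fin 4 → ℂ) (x : ℂ) (hx : ∀ m : ℤ, 2 * Complex.I * x ≠ m) :
    nuSq .wilson lam x = ∏ k,
      (Complex.Gamma (lam k + Complex.I * x) / Complex.Gamma (1 - (lam k + Complex.I * x))
        * (Complex.Gamma (lam k - Complex.I * x) / Complex.Gamma (1 - (lam k - Complex.I * x)))) := by
  have h1 : Complex.Gamma (2 * Complex.I * x) ≠ 0 :=
    Complex.Gamma_ne_zero fun m h => hx (-(m : ℤ)) (by push_cast; exact h)
  have h2 : Complex.Gamma (-(2 * Complex.I * x)) ≠ 0 :=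
    Complex.Gamma_ne_zero fun m h => hx (m : ℤ) (by push_cast; linear_combination -h)
  unfold nuSq phi0Sq
  simp only [param, twist]
  rw [mul_div_mul_left _ _ (inv_ne_zero (mul_ne_zero h1 h2)), ← Finset.prod_div_distrib]
  refine Finset.prod_congr rfl fun k _ => ?_
  rw [show 1 - lam k + Complex.I * x = 1 - (lam k - Complex.I * x) by ring,
    show 1 - lam k - Complex.I * x = 1 - (lam k + Complex.I * x) by ring]
  rw [div_mul_div_comm, mul_comm (Complex.Gamma (1 - (lam k - Complex.I * x)))]

theorem nuSq_askeyWilson (q : ℝ) (h₀ : 0 < q) (h₁ : q < 1) (lam : Fin 4 → ℂ) (x : ℂ)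
    (hx : ∀ m : ℤ, Complex.exp (2 * Complex.I * x) ≠ (q : ℂ) ^ m) :
    nuSq (.askeyWilson q h₀ h₁) lam x = ∏ k,
      (qpochInf (q / ((q : ℂ) ^ lam k * Complex.exp (Complex.I * x))) q
          / qpochInf ((q : ℂ) ^ lam k * Complex.exp (Complex.I * x)) q
        * (qpochInf (q / ((q : ℂ) ^ lam k * Complex.exp (-(Complex.I * x)))) q
          / qpochInf ((q : ℂ) ^ lam k * Complex.exp (-(Complex.I * x))) q)) := by
  have hq : ‖(q : ℂ)‖ < 1 := by
    rw [Complex.norm_real, Real.norm_of_nonneg h₀.le]; exact h₁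
  have hq0 : (q : ℂ) ≠ 0 := by exact_mod_cast h₀.ne'
  have h1 : qpochInf (Complex.exp (2 * Complex.I * x)) q ≠ 0 := by
    refine qpochInf_ne_zero _ _ hq fun i h => hx (-(i : ℤ)) ?_
    rw [zpow_neg, zpow_natCast]
    exact eq_inv_of_mul_eq_one_left (by linear_combination -h)
  have h2 : qpochInf (Complex.exp (-(2 * Complex.I * x))) q ≠ 0 := by
    refine qpochInf_ne_zero _ _ hq fun i h => hx (i : ℤ) ?_
    rw [Complex.exp_neg, sub_eq_zero, eq_comm, inv_mul_eq_one₀ (Complex.exp_ne_zero _)] at h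
    rw [zpow_natCast]; exact h
  unfold nuSq phi0Sq
  simp only [param, twist]
  rw [mul_div_mul_left _ _ (mul_ne_zero h1 h2), ← Finset.prod_div_distrib]
  refine Finset.prod_congr rfl fun k _ => ?_
  have e1 : (q : ℂ) ^ (1 - lam k) * Complex.exp (Complex.I * x)
      = q / ((q : ℂ) ^ lam k * Complex.exp (-(Complex.I * x))) := by
    rw [Complex.cpow_sub _ _ hq0, Complex.cpow_one, Complex.exp_neg]
    field_simp
  have e2 : (q : ℂ) ^ (1 - lam k) * Complex.exp (-(Complex.I * x))
      = q / ((q : ℂ) ^ lam k * Complex.exp (Complex.I * x)) := by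
    rw [Complex.cpow_sub _ _ hq0, Complex.cpow_one, Complex.exp_neg]
    field_simp
  rw [e1, e2, inv_div_inv, div_mul_div_comm, mul_comm (qpochInf (q / _) q)]

/-- The explicit `rFactor` is, up to a constant that does not depend on `x` and `s`, a square root
of the square of `ν(x_j^{(M+1)}; λ) / ν(x; λ - M δ)`. -/
theorem rFactor_sq (F : Family) (M : ℕ) (lam : Fin 4 → ℂ) :
    ∃ C : ℂ, C ≠ 0 ∧ ∀ x : ℂ, Regular F (shift lam M) x → ∀ s ≤ M,
      rFactor F M s lam x ^ 2 * nuSq F (shift lam M) x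
        = C * nuSq F lam (node F (M + 1) s x) := by
  cases F with
  | wilson =>
    refine ⟨1, one_ne_zero, fun x hx s hs => ?_⟩
    obtain ⟨t, rfl⟩ := Nat.exists_eq_add_of_le hs
    have hI := Complex.I_mul_I
    have hnode : Complex.I * node .wilson (s + t + 1) s x = Complex.I * x + (s - t) / 2 := by
      simp only [node, gam]; push_cast
      linear_combination ((s + t + 1 - 1) / 2 - s : ℂ) * hI
    rw [nuSq_wilson _ x fun m => (hx m).1, nuSq_wilson]
    · simp only [rFactor, param, one_mul, Nat.add_sub_cancel_left]
      rw [← Finset.prod_pow, ← Finset.prod_mul_distrib]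
      have hk : ∀ k, Complex.Gamma (lam k + Complex.I * node .wilson (s + t + 1) s x)
            / Complex.Gamma (1 - (lam k + Complex.I * node .wilson (s + t + 1) s x))
          * (Complex.Gamma (lam k - Complex.I * node .wilson (s + t + 1) s x)
            / Complex.Gamma (1 - (lam k - Complex.I * node .wilson (s + t + 1) s x)))
          = (-1) ^ (s + t) * ((poch (shift lam (s + t) k + Complex.I * x) s
              * poch (shift lam (s + t) k - Complex.I * x) t) ^ 2
            * (Complex.Gamma (shift lam (s + t) k + Complex.I * x)
              / Complex.Gamma (1 - (shift lam (s + t) k + Complex.I * x))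
            * (Complex.Gamma (shift lam (s + t) k - Complex.I * x)
              / Complex.Gamma (1 - (shift lam (s + t) k - Complex.I * x))))) := by
        intro k
        have g1 := gamma_quotient_shift (shift lam (s + t) k + Complex.I * x)
          (fun m => ((hx m).2 k).1) s
        have g2 := gamma_quotient_shift (shift lam (s + t) k - Complex.I * x)
          (fun m => ((hx m).2 k).2) t
        rw [show lam k + Complex.I * node .wilson (s + t + 1) s x
            = shift lam (s + t) k + Complex.I * x + s by
              rw [hnode]; simp only [shift]; push_cast; ring,
          show lam k - Complex.I * node .wilson (s + t + 1) s x
            = shift lam (s + t) k - Complex.I * x + t by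
              rw [hnode]; simp only [shift]; push_cast; ring, g1, g2]
        ring
      rw [Finset.prod_congr rfl fun k _ => hk k]
      conv_rhs => rw [Finset.prod_mul_distrib]
      rw [Finset.prod_const, Finset.card_univ, Fintype.card_fin, ← pow_mul,
        show (s + t) * 4 = 2 * (2 * (s + t)) by ring, pow_mul, neg_one_sq, one_pow, one_mul]
    · intro m h
      refine (hx (m - s + t)).1 ?_
      rw [mul_assoc, hnode] at h
      push_cast; linear_combination h
  | askeyWilson q h₀ h₁ =>
    have hq : ‖(q : ℂ)‖ < 1 := by
      rw [Complex.norm_real, Real.norm_of_nonneg h₀.le]; exact h₁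
    have hq0 : (q : ℂ) ≠ 0 := by exact_mod_cast h₀.ne'
    have ha : ∀ k, (q : ℂ) ^ shift lam M k ≠ 0 := fun k => by
      rw [Complex.cpow_def_of_ne_zero hq0]; exact Complex.exp_ne_zero _
    refine ⟨(∏ k, (q : ℂ) ^ shift lam M k) ^ M * (q : ℂ) ^ (2 * (M * (M - 1))),
      mul_ne_zero (pow_ne_zero _ (Finset.prod_ne_zero_iff.2 fun k _ => ha k))
        (pow_ne_zero _ hq0), fun x hx s hs => ?_⟩
    obtain ⟨t, rfl⟩ := Nat.exists_eq_add_of_le hs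
    have hlog : (q : ℂ) = Complex.exp (Real.log q) := by
      rw [← Complex.ofReal_exp, Real.exp_log h₀]
    have hI := Complex.I_mul_I
    set y := node (.askeyWilson q h₀ h₁) (s + t + 1) s x with hy
    have hnode : Complex.I * y = Complex.I * x + ((s - t) / 2) * Real.log q := by
      simp only [hy, node, gam]; push_cast
      linear_combination ((s + t + 1 - 1) / 2 - s : ℂ) * Real.log q * hI
    have hpow : ∀ c : ℂ, (q : ℂ) ^ c = Complex.exp (c * Real.log q) := fun c => by
      rw [Complex.cpow_def_of_ne_zero hq0, ← Complex.ofReal_log h₀.le, mul_comm]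
    have hnpow : ∀ n : ℕ, (q : ℂ) ^ n = Complex.exp (n * Real.log q) := fun n => by
      rw [Complex.exp_nat_mul, ← hlog]
    have hzpow : ∀ n : ℤ, (q : ℂ) ^ n = Complex.exp (n * Real.log q) := fun n => by
      rw [Complex.exp_int_mul, ← hlog]
    have hyreg : ∀ m : ℤ, Complex.exp (2 * Complex.I * y) ≠ (q : ℂ) ^ m := by
      intro m h
      refine (hx (m - s + t)).1 ?_
      rw [mul_assoc, hnode, hzpow] at h
      rw [hzpow]
      have h' := congrArg (· * Complex.exp (((t : ℂ) - s) * Real.log q)) h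
      simp only [← Complex.exp_add] at h'
      convert h' using 2
      · ring
      · push_cast; ring
    rw [nuSq_askeyWilson q h₀ h₁ _ x fun m => (hx m).1, nuSq_askeyWilson q h₀ h₁ _ y hyreg]
    simp only [rFactor, param, Nat.add_sub_cancel_left]
    set E := Complex.exp (Complex.I * x) with hE
    have hE0 : E ≠ 0 := Complex.exp_ne_zero _
    have hEi : Complex.exp (-(Complex.I * x)) = E⁻¹ := Complex.exp_neg _
    have hk : ∀ k, (qpochInf (q / ((q : ℂ) ^ lam k * Complex.exp (Complex.I * y))) q
          / qpochInf ((q : ℂ) ^ lam k * Complex.exp (Complex.I * y)) q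
        * (qpochInf (q / ((q : ℂ) ^ lam k * Complex.exp (-(Complex.I * y)))) q
          / qpochInf ((q : ℂ) ^ lam k * Complex.exp (-(Complex.I * y))) q))
        * ((-1) ^ (s + t) * ((q : ℂ) ^ shift lam (s + t) k) ^ (s + t) * (E ^ s * E⁻¹ ^ t)
          * (q : ℂ) ^ (s * (s - 1) / 2 + t * (t - 1) / 2))
        = (qpoch ((q : ℂ) ^ shift lam (s + t) k * E) q s
            * qpoch ((q : ℂ) ^ shift lam (s + t) k * E⁻¹) q t) ^ 2
          * (qpochInf (q / ((q : ℂ) ^ shift lam (s + t) k * E)) q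
              / qpochInf ((q : ℂ) ^ shift lam (s + t) k * E) q
            * (qpochInf (q / ((q : ℂ) ^ shift lam (s + t) k * E⁻¹)) q
              / qpochInf ((q : ℂ) ^ shift lam (s + t) k * E⁻¹) q)) := by
      intro k
      have g1 := qpoch_quotient_shift q ((q : ℂ) ^ shift lam (s + t) k * E) hq hq0
        (mul_ne_zero (ha k) hE0) (fun m => ((hx m).2 k).1) s
      have g2 := qpoch_quotient_shift q ((q : ℂ) ^ shift lam (s + t) k * E⁻¹) hq hq0
        (mul_ne_zero (ha k) (inv_ne_zero hE0)) (fun m => hEi ▸ ((hx m).2 k).2) t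
      have e1 : (q : ℂ) ^ lam k * Complex.exp (Complex.I * y)
          = (q : ℂ) ^ shift lam (s + t) k * E * (q : ℂ) ^ s := by
        rw [hnode, hpow, hpow, hnpow, hE, ← Complex.exp_add, ← Complex.exp_add, ← Complex.exp_add]
        congr 1; simp only [shift]; push_cast; ring
      have e2 : (q : ℂ) ^ lam k * Complex.exp (-(Complex.I * y))
          = (q : ℂ) ^ shift lam (s + t) k * E⁻¹ * (q : ℂ) ^ t := by
        rw [hnode, hpow, hpow, hnpow, ← hEi, ← Complex.exp_add, ← Complex.exp_add,
          ← Complex.exp_add]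
        congr 1; simp only [shift]; push_cast; ring
      rw [e1, e2]
      calc _ = _ := by rw [pow_add, pow_add, pow_add]; ring
        _ = _ := congrArg₂ (· * ·) g1 g2
        _ = _ := by ring
    simp only [hEi]
    rw [mul_pow, mul_assoc, ← Finset.prod_pow, ← Finset.prod_mul_distrib,
      ← Finset.prod_congr rfl fun k _ => hk k, Finset.prod_mul_distrib]
    generalize (∏ k, (qpochInf (q / ((q : ℂ) ^ lam k * Complex.exp (Complex.I * y))) q
          / qpochInf ((q : ℂ) ^ lam k * Complex.exp (Complex.I * y)) q
        * (qpochInf (q / ((q : ℂ) ^ lam k * Complex.exp (-(Complex.I * y)))) q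
          / qpochInf ((q : ℂ) ^ lam k * Complex.exp (-(Complex.I * y))) q))) = G
    have hsgn : ((-1 : ℂ) ^ (s + t)) ^ 4 = 1 := by
      rw [← pow_mul, show (s + t) * 4 = 2 * (2 * (s + t)) by ring, pow_mul]; simp
    have hexp : Complex.exp (2 * Complex.I * x * (((s + t : ℕ) : ℂ) - 2 * s)) ^ 2
        * (E ^ s * E⁻¹ ^ t) ^ 4 = 1 := by
      rw [← hEi, hE, ← Complex.exp_nat_mul, ← Complex.exp_nat_mul, ← Complex.exp_nat_mul,
        ← Complex.exp_add, ← Complex.exp_nat_mul, ← Complex.exp_add, ← Complex.exp_zero]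
      congr 1; push_cast; ring
    have htri : ∀ n : ℕ, 2 * (n * (n - 1) / 2) = n * (n - 1) := fun n =>
      Nat.two_mul_div_two_of_even (Nat.even_mul_pred_self n)
    have hqe : ((q : ℂ) ^ (2 * s * t)) ^ 2
        * ((q : ℂ) ^ (s * (s - 1) / 2 + t * (t - 1) / 2)) ^ 4
        = (q : ℂ) ^ (2 * ((s + t) * (s + t - 1))) := by
      rw [← pow_mul, ← pow_mul, ← pow_add]
      congr 1
      have h1 := htri s
      have h2 := htri t
      have h3 : s * (s - 1) + t * (t - 1) + 2 * (s * t) = (s + t) * (s + t - 1) := by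
        rcases s with _ | s <;> rcases t with _ | t <;> simp <;> ring
      rw [← h3]
      nlinarith
    rw [Finset.prod_mul_distrib, Finset.prod_mul_distrib, Finset.prod_mul_distrib,
      Finset.prod_const, Finset.prod_const, Finset.prod_const, Finset.prod_pow, Finset.card_univ,
      Fintype.card_fin, hsgn, ← hqe]
    linear_combination (((q : ℂ) ^ (2 * s * t)) ^ 2
      * ((q : ℂ) ^ (s * (s - 1) / 2 + t * (t - 1) / 2)) ^ 4
      * (∏ k, (q : ℂ) ^ shift lam (s + t) k) ^ (s + t) * G) * hexp

end CasoratianDuality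

/-! Both statements come from one kernel. Let K_N(x, y) be the product of η(x) - η(y_j) over N
equidistant nodes y_j centred at y. For generic λ it has a dual Cauchy expansion K_N(x, y) = Σ c_k
P_k(x; λ̄) P_{N-k}(y; 𝔱(λ)) with all c_k ≠ 0 (`kern_expansion`). The proof is an induction on N: by
`kern_identity` the backward shift in x plus the backward shift in y lead from K_n to a multiple of
K_{n+1}, and the forward shifts, which lead from K_{n+1} back to K_n, show that no coefficient
vanishes.

Statement (2). Take m nodes x_j and r nodes y_l around a common centre, with m + r = N + 1. Then
K_N(x_j, y_l) = 0 for every pair, so the expansion reads A B = 0 with an m × (N+1) matrix A and an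
(N+1) × r matrix B. Complementary minors of A and B are proportional (`complementary_minors`). These
minors are, up to the constants c_k, the Casorati determinants of the P_k over an index set S and of
the ξ_{N-k} over the complement of S. The ratio is read off from the initial segment S = {0, …,
m-1}, where forward shifts reduce both determinants to constants times φ_m and φ_r. This is
`casP_complement`; (2) is the case S = D̄ ∪ {d̄_j}.

Statement (1). This is an induction on M that moves one index from D to the complementary side
(`multiDet_duality`). For empty D, the determinant of P_0, …, P_N, P_{N+1+n} is reduced to P_n by N
+ 1 forward shifts (`casP_stairIndex`). For the step two identities of the same shape are compared.
One is the Desnanot-Jacobi identity for the matrix defining P_{D,n} (`multiDet_desnanot`); the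
factors r_j enter through first-order recursions with the weight function (`rFactor_succ`). The
other is a bilinear identity for Casorati determinants of eigenpolynomials (`casP_bilinear`); it
comes from the difference equation, read as a three-term recurrence with spectral parameter, and
carries the difference of two eigenvalues. The induction hypothesis and `casP_complement` identify
the terms, and a common factor is cancelled. That factor is not identically zero because
`casP_bilinear` also propagates nonvanishing from shorter determinants to longer ones
(`entireNonzero_casP`).

Arbitrary λ. A real perturbation of λ₁ meets each resonance at most once, so generic
proportionality, written as a cross-multiplied equation, passes to the limit. The polynomials Ξ and
Ξ̄ exist by divisibility by the Vandermonde determinant and a parity argument (`exists_polyPart`).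
For P_{D,n} the factors r_j prevent a direct use of that argument; instead, generic determinants lie
in a fixed finite-dimensional space of functions φ_{M+1} · (polynomial in η), which is closed under
pointwise limits. -/

namespace CasoratianDuality

/-! ### Determinant identities over a commutative ring. -/

section LinearAlgebra

variable {R : Type*}

/-- The matrix with first row `z` and remaining rows those of `σ`. -/
def consRow {n k : ℕ} (z : Fin k → R) (σ : Matrix (Fin n) (Fin k) R) :
    Matrix (Fin (n + 1)) (Fin k) R :=
  fun i l => Fin.cases (motive := fun _ => R) (z l) (fun j => σ j l) i

/-- The matrix with last row `z` and the other rows those of `σ`. -/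
def snocRow {n k : ℕ} (z : Fin k → R) (σ : Matrix (Fin n) (Fin k) R) :
    Matrix (Fin (n + 1)) (Fin k) R :=
  fun i l => Fin.lastCases (motive := fun _ => R) (z l) (fun j => σ j l) i

@[simp] theorem consRow_zero {n k : ℕ} (z : Fin k → R) (σ : Matrix (Fin n) (Fin k) R) (l : Fin k) :
    consRow z σ 0 l = z l := rfl

@[simp] theorem consRow_succ {n k : ℕ} (z : Fin k → R) (σ : Matrix (Fin n) (Fin k) R) (j : Fin n)
    (l : Fin k) : consRow z σ j.succ l = σ j l := rfl

@[simp] theorem snocRow_last {n k : ℕ} (z : Fin k → R) (σ : Matrix (Fin n) (Fin k) R) (l : Fin k) :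
    snocRow z σ (Fin.last n) l = z l := by
  simp [snocRow]

@[simp] theorem snocRow_castSucc {n k : ℕ} (z : Fin k → R) (σ : Matrix (Fin n) (Fin k) R)
    (j : Fin n) (l : Fin k) : snocRow z σ j.castSucc l = σ j l := by
  simp [snocRow]

variable [CommRing R]

theorem det_cons_row {n : ℕ} (z : Fin (n + 1) → R) (σ : Matrix (Fin n) (Fin (n + 1)) R) :
    (consRow z σ).det
      = ∑ k : Fin (n + 1), (-1) ^ (k : ℕ) * z k * (σ.submatrix id k.succAbove).det := by
  rw [Matrix.det_succ_row_zero]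
  rfl

theorem det_snoc_row {n : ℕ} (z : Fin (n + 1) → R) (σ : Matrix (Fin n) (Fin (n + 1)) R) :
    (snocRow z σ).det
      = (-1) ^ n * (consRow z σ).det := by
  rw [det_cons_row, Matrix.det_succ_row _ (Fin.last n), Finset.mul_sum]
  refine Finset.sum_congr rfl fun k _ => ?_
  have h : (snocRow z σ).submatrix
      (Fin.last n).succAbove k.succAbove = σ.submatrix id k.succAbove := by
    ext i j
    simp
  rw [h]
  simp only [snocRow_last, Fin.val_last, pow_add]
  ring

/-- The Laplace sums of a matrix with one column more than rows against the minors on the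
interior columns. -/
theorem interior_laplace {n : ℕ} (ρ : Matrix (Fin (n + 1)) (Fin (n + 2)) R) (k : Fin (n + 2)) :
    ∑ j : Fin (n + 1), (-1) ^ (j : ℕ) * ρ j k
        * (ρ.submatrix j.succAbove fun i : Fin n => i.castSucc.succ).det
      = if k = 0 then (ρ.submatrix id Fin.castSucc).det
        else if k = Fin.last (n + 1) then (-1) ^ n * (ρ.submatrix id Fin.succ).det else 0 := by
  split_ifs with h0 h1
  · subst h0
    rw [Matrix.det_succ_column_zero]
    refine Finset.sum_congr rfl fun j _ => ?_
    rfl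
  · subst h1
    rw [Matrix.det_succ_column _ (Fin.last n), Finset.mul_sum]
    refine Finset.sum_congr rfl fun j _ => ?_
    have h : (ρ.submatrix id Fin.succ).submatrix j.succAbove (Fin.last n).succAbove
        = ρ.submatrix j.succAbove fun i : Fin n => i.castSucc.succ := by
      ext i j
      simp
    rw [h]
    simp only [Matrix.submatrix_apply, id, Fin.val_last, pow_add, Fin.succ_last]
    have h2 : ((-1 : R) ^ n) * (-1) ^ n = 1 := by rw [← mul_pow]; simp
    linear_combination -((-1) ^ (j : ℕ) * ρ j (Fin.last (n + 1))
      * (ρ.submatrix j.succAbove fun i : Fin n => i.castSucc.succ).det) * h2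
  -- The sum is the expansion of a determinant in which this interior column occurs twice.
  · obtain ⟨k', rfl⟩ := Fin.exists_succ_eq.2 h0
    obtain ⟨i, rfl⟩ := Fin.exists_castSucc_eq.2 (fun h : k' = Fin.last n => h1 (by rw [h]; rfl))
    have hz : (Matrix.of fun (j : Fin (n + 1)) => (Fin.cons (ρ j i.castSucc.succ)
        (fun l : Fin n => ρ j l.castSucc.succ) : Fin (n + 1) → R)).det = 0 := by
      refine Matrix.det_zero_of_column_eq (i := 0) (j := i.succ) (Fin.succ_ne_zero i).symm ?_
      intro j
      simp
    rw [Matrix.det_succ_column_zero] at hz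
    exact hz

/-- Expanding the prepended row and exchanging the sums leaves the Laplace sums of
`interior_laplace`, which select the first and the last column. This is the common source of
Desnanot-Jacobi (`e = 1`, with `ρ` and `σ` the matrix without its last and first row) and of
`recurrence_bilinear` (`ρ = σ`, with `e` the spectral parameter). -/
theorem sum_det_cons_mul_interior {n : ℕ} (ρ σ : Matrix (Fin (n + 1)) (Fin (n + 2)) R)
    (e : Fin (n + 2) → R) :
    ∑ j : Fin (n + 1), (-1) ^ (j : ℕ)
        * (consRow (fun k => e k * ρ j k) σ).det
        * (ρ.submatrix j.succAbove fun i : Fin n => i.castSucc.succ).det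
      = e 0 * (ρ.submatrix id Fin.castSucc).det * (σ.submatrix id Fin.succ).det
        - e (Fin.last (n + 1)) * (ρ.submatrix id Fin.succ).det
          * (σ.submatrix id Fin.castSucc).det := by
  have h1 : ∀ j : Fin (n + 1), (-1) ^ (j : ℕ)
        * (consRow (fun k => e k * ρ j k) σ).det
        * (ρ.submatrix j.succAbove fun i : Fin n => i.castSucc.succ).det
      = ∑ k : Fin (n + 2), (-1) ^ (k : ℕ) * e k * (σ.submatrix id k.succAbove).det
        * ((-1) ^ (j : ℕ) * ρ j k
          * (ρ.submatrix j.succAbove fun i : Fin n => i.castSucc.succ).det) := by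
    intro j
    rw [det_cons_row, Finset.mul_sum, Finset.sum_mul]
    refine Finset.sum_congr rfl fun k _ => ?_
    ring
  rw [Finset.sum_congr rfl fun j _ => h1 j, Finset.sum_comm]
  simp_rw [← Finset.mul_sum, interior_laplace]
  rw [Fin.sum_univ_succ, Fin.sum_univ_castSucc]
  have h2 : ∀ i : Fin n, (i.castSucc.succ : Fin (n + 2)) ≠ Fin.last (n + 1) := by
    intro i h
    have := congrArg Fin.val h
    simp at this
    omega
  have h3 : (Fin.last n).succ = Fin.last (n + 1) := rfl
  have h4 : (0 : Fin (n + 2)).succAbove = Fin.succ := rfl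
  have h5 : (Fin.last (n + 1)).succAbove = Fin.castSucc := by
    ext i; simp
  have h6 : ((-1 : R) ^ n) * (-1) ^ n = 1 := by rw [← mul_pow]; simp
  simp only [Fin.succ_ne_zero, h2, h3, h4, h5, if_true, if_false, mul_zero, Finset.sum_const_zero,
    Fin.val_zero, pow_zero, Fin.val_last, zero_add]
  rw [if_neg (Fin.last_pos.ne' : Fin.last (n + 1) ≠ 0)]
  linear_combination -(e (Fin.last (n + 1)) * (ρ.submatrix id Fin.succ).det
          * (σ.submatrix id Fin.castSucc).det) * h6

/-- The Desnanot-Jacobi identity. -/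
theorem desnanot_jacobi {n : ℕ} (A : Matrix (Fin (n + 2)) (Fin (n + 2)) R) :
    A.det * (A.submatrix (fun i : Fin n => i.castSucc.succ) fun i : Fin n => i.castSucc.succ).det
      = (A.submatrix Fin.castSucc Fin.castSucc).det * (A.submatrix Fin.succ Fin.succ).det
        - (A.submatrix Fin.castSucc Fin.succ).det * (A.submatrix Fin.succ Fin.castSucc).det := by
  have h := sum_det_cons_mul_interior (A.submatrix Fin.castSucc id) (A.submatrix Fin.succ id)
    (fun _ => 1)
  simp only [one_mul, Matrix.submatrix_submatrix, Function.id_comp, Function.comp_id] at h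
  rw [← h, Fin.sum_univ_succ, Finset.sum_eq_zero, add_zero]
  · have h1 : (consRow (fun k => A.submatrix Fin.castSucc id 0 k) (A.submatrix Fin.succ id)) = A := by
      ext i j
      refine Fin.cases ?_ (fun i => ?_) i <;> simp
    rw [h1]
    simp only [Fin.val_zero, pow_zero, one_mul]
    congr 2
  · intro j _
    rw [Matrix.det_zero_of_row_eq (i := 0) (j := j.castSucc.succ) (Fin.succ_ne_zero _).symm]
    · simp
    · ext k
      simp

/-- The bilinear identity for solutions of a three-term recurrence with spectral parameter. -/
theorem recurrence_bilinear {n : ℕ} (g : ℕ → Fin (n + 2) → R) (e : Fin (n + 2) → R)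
    (V W c : ℕ → R)
    (hrec : ∀ j < n + 1, ∀ k, e k * g (j + 1) k
      = V j * g j k + W j * g (j + 2) k + c j * g (j + 1) k) :
    V 0 * Matrix.det (Matrix.of fun j k : Fin (n + 2) => g j k)
        * Matrix.det (Matrix.of fun j k : Fin n => g (j + 2) k.castSucc.succ)
      - W n * Matrix.det (Matrix.of fun j k : Fin (n + 2) => g (j + 1) k)
        * Matrix.det (Matrix.of fun j k : Fin n => g (j + 1) k.castSucc.succ)
      = (e 0 - e (Fin.last (n + 1)))
        * Matrix.det (Matrix.of fun j k : Fin (n + 1) => g (j + 1) k.castSucc)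
        * Matrix.det (Matrix.of fun j k : Fin (n + 1) => g (j + 1) k.succ) := by
  set ρ : Matrix (Fin (n + 1)) (Fin (n + 2)) R := Matrix.of fun j k => g (j + 1) k with hρ
  have key := sum_det_cons_mul_interior ρ ρ e
  -- The recurrence rewrites the prepended row; the part with `c j` repeats a row of `ρ`. Of the
  -- rows `g j` and `g (j + 2)` only `g 0` and `g (n + 2)` do not already occur in `ρ`, so one `V`
  -- term and one `W` term survive.
  have hlin : ∀ j : Fin (n + 1),
      (consRow (fun k => e k * ρ j k) ρ).det
      = V j * (consRow (g j) ρ).det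
        + W j * (consRow (g (j + 2)) ρ).det := by
    intro j
    have h0 : (consRow (g (j + 1)) ρ).det = 0 := by
      rw [Matrix.det_zero_of_row_eq (i := 0) (j := j.succ) (Fin.succ_ne_zero _).symm]
      ext k
      simp [hρ]
    have h1 : ∀ z : Fin (n + 2) → R, (consRow z ρ).det
      = ∑ k : Fin (n + 2), (-1) ^ (k : ℕ) * z k * (ρ.submatrix id k.succAbove).det := fun z => det_cons_row z ρ
    rw [h1] at h0 ⊢
    rw [h1, h1, Finset.mul_sum, Finset.mul_sum, ← Finset.sum_add_distrib,
      ← sub_eq_zero, ← mul_zero (c j), ← h0, Finset.mul_sum, ← Finset.sum_sub_distrib]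
    refine Finset.sum_congr rfl fun k _ => ?_
    simp only [hρ, Matrix.of_apply]
    rw [hrec j j.isLt k]
    ring
  have hV : ∀ j : Fin (n + 1), j ≠ 0 →
      (consRow (g j) ρ).det = 0 := by
    intro j hj
    obtain ⟨i, rfl⟩ := Fin.exists_succ_eq.2 hj
    rw [Matrix.det_zero_of_row_eq (i := 0) (j := i.castSucc.succ) (Fin.succ_ne_zero _).symm]
    ext k
    simp [hρ]
  have hW : ∀ j : Fin (n + 1), j ≠ Fin.last n →
      (consRow (g (j + 2)) ρ).det = 0 := by
    intro j hj
    obtain ⟨i, rfl⟩ := Fin.exists_castSucc_eq.2 hj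
    rw [Matrix.det_zero_of_row_eq (i := 0) (j := i.succ.succ) (Fin.succ_ne_zero _).symm]
    ext k
    simp [hρ]
  have hsplit : ∀ j ∈ (Finset.univ : Finset (Fin (n + 1))),
      (-1) ^ (j : ℕ) * (consRow (fun k => e k * ρ j k) ρ).det
        * (ρ.submatrix j.succAbove fun i : Fin n => i.castSucc.succ).det
      = (-1) ^ (j : ℕ) * (V j * (consRow (g j) ρ).det)
          * (ρ.submatrix j.succAbove fun i : Fin n => i.castSucc.succ).det
        + (-1) ^ (j : ℕ) * (W j * (consRow (g (j + 2)) ρ).det)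
          * (ρ.submatrix j.succAbove fun i : Fin n => i.castSucc.succ).det := by
    intro j _
    rw [hlin j]
    ring
  rw [Finset.sum_congr rfl hsplit, Finset.sum_add_distrib] at key
  rw [Finset.sum_eq_single (0 : Fin (n + 1)), Finset.sum_eq_single (Fin.last n)] at key
  · have e1 : consRow (g ((0 : Fin (n + 1)) : ℕ)) ρ
        = Matrix.of fun j k : Fin (n + 2) => g j k := by
      ext i k
      refine Fin.cases ?_ (fun i => ?_) i <;> simp [hρ]
    have e2 : snocRow (g (n + 2)) ρ
        = Matrix.of fun j k : Fin (n + 2) => g (j + 1) k := by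
      ext i k
      refine Fin.lastCases ?_ (fun i => ?_) i <;> simp [hρ]
    have e3 := det_snoc_row (g (n + 2)) ρ
    rw [e2] at e3
    have e4 : (ρ.submatrix (0 : Fin (n + 1)).succAbove fun i : Fin n => i.castSucc.succ)
        = Matrix.of fun j k : Fin n => g (j + 2) k.castSucc.succ := by
      ext i k
      simp [hρ, add_assoc]
    have e5 : (ρ.submatrix (Fin.last n).succAbove fun i : Fin n => i.castSucc.succ)
        = Matrix.of fun j k : Fin n => g (j + 1) k.castSucc.succ := by
      ext i k
      simp [hρ]
    have e6 : ρ.submatrix id Fin.castSucc = Matrix.of fun j k : Fin (n + 1) => g (j + 1) k.castSucc := rfl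
    have e7 : ρ.submatrix id Fin.succ = Matrix.of fun j k : Fin (n + 1) => g (j + 1) k.succ := rfl
    rw [e1, e4, e5, e6, e7] at key
    rw [e3]
    simp only [Fin.val_zero, pow_zero, one_mul, Fin.val_last] at key
    rw [pow_succ]
    linear_combination key
  · intro j _ hj
    rw [hW j hj]; ring
  · simp
  · intro j _ hj
    rw [hV j hj]; ring
  · simp

/-- Complementary minors of two matrices with `A * B = 0`. -/
theorem complementary_minors {m r ι : Type*} [Fintype m] [DecidableEq m] [Fintype r]
    [DecidableEq r] [Fintype ι] [DecidableEq ι] (A : Matrix m ι R) (B : Matrix ι r R)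
    (hAB : A * B = 0) (e f : m ⊕ r ≃ ι) :
    (A.submatrix id fun i => f (Sum.inl i)).det * (B.submatrix (fun i => e (Sum.inr i)) id).det
      = (Equiv.Perm.sign (e.trans f.symm) : ℤ)
        * ((A.submatrix id fun i => e (Sum.inl i)).det
          * (B.submatrix (fun i => f (Sum.inr i)) id).det) := by
  -- `X` is `A` bordered by unit rows at the columns `e (inr ·)`, and `Y` is `B` bordered by unit
  -- columns at the rows `f (inl ·)`. Multiplied over `ι`, they give a block triangular matrix
  -- because `A * B = 0`, with the two minors of the left-hand side on the diagonal. The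
  -- determinants of `X` and `Y` themselves are the minors of the right-hand side, and aligning the
  -- two orderings of `ι` costs the sign.
  set X : Matrix (m ⊕ r) (m ⊕ r) R := Matrix.fromBlocks (A.submatrix id fun i => e (Sum.inl i))
    (A.submatrix id fun i => e (Sum.inr i)) 0 1 with hX
  set Y : Matrix (m ⊕ r) (m ⊕ r) R := Matrix.fromBlocks 1
    (B.submatrix (fun i => f (Sum.inl i)) id) 0 (B.submatrix (fun i => f (Sum.inr i)) id) with hY
  set X' : Matrix (m ⊕ r) ι R := X.submatrix id e.symm with hX'
  set Y' : Matrix ι (m ⊕ r) R := Y.submatrix f.symm id with hY'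
  have hX1 : X' = Matrix.of fun i k =>
      Sum.elim (fun i => A i k) (fun i => if k = e (Sum.inr i) then 1 else 0) i := by
    ext i k
    obtain ⟨k, rfl⟩ := e.surjective k
    rcases i with i | i <;> rcases k with k | k <;>
      simp [hX', hX, Matrix.one_apply, eq_comm]
  have hY1 : Y' = Matrix.of fun k => Sum.elim (fun i => if k = f (Sum.inl i) then 1 else 0) (B k) := by
    ext k i
    obtain ⟨k, rfl⟩ := f.surjective k
    rcases i with i | i <;> rcases k with k | k <;>
      simp [hY', hY, Matrix.one_apply]
  have hmul : X' * Y' = Matrix.fromBlocks (A.submatrix id fun i => f (Sum.inl i)) 0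
      (Matrix.of fun i j => if e (Sum.inr i) = f (Sum.inl j) then 1 else 0)
      (B.submatrix (fun i => e (Sum.inr i)) id) := by
    rw [hX1, hY1]
    ext i j
    rcases i with i | i <;> rcases j with j | j
    · simp [Matrix.mul_apply]
    · simpa [Matrix.mul_apply] using congrFun (congrFun hAB i) j
    · simp [Matrix.mul_apply, eq_comm]
    · simp [Matrix.mul_apply]
  have hmul2 : X' * Y' = X * Y.submatrix (e.trans f.symm) id := by
    ext i j
    simp only [hX', hY', Matrix.mul_apply, Matrix.submatrix_apply, id]
    rw [← Equiv.sum_comp e]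
    simp
  have hdet := congrArg Matrix.det (hmul.symm.trans hmul2)
  rw [Matrix.det_mul, Matrix.det_permute, Matrix.det_fromBlocks_zero₁₂, hX, hY,
    Matrix.det_fromBlocks_zero₂₁, Matrix.det_fromBlocks_zero₂₁, Matrix.det_one, Matrix.det_one] at hdet
  rw [hdet]
  ring

/-- The determinant of polynomial values is divisible by the Vandermonde product of the nodes. -/
theorem det_eval_eq_vandermonde_mul {m : ℕ} (t : Fin m → R) (f : Fin m → Polynomial R) :
    ∃ Q : R, Matrix.det (Matrix.of fun j k => (f k).eval (t j))
      = (∏ i : Fin m, ∏ j ∈ Finset.Ioi i, (t j - t i)) * Q := by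
  induction m with
  | zero => exact ⟨1, by simp⟩
  | succ m ih =>
    -- After subtraction of the first row, row `j` is divisible by `t j - t 0`; the minors of the
    -- first row are then determinants of the same kind with one node fewer.
    have hg : ∀ k, ∃ g : Polynomial R, f k - Polynomial.C ((f k).eval (t 0))
        = (Polynomial.X - Polynomial.C (t 0)) * g := fun k =>
      Polynomial.X_sub_C_dvd_sub_C_eval
    choose g hg using hg
    have hg' : ∀ j k, (f k).eval (t j) = (f k).eval (t 0) + (t j - t 0) * (g k).eval (t j) := by
      intro j k
      have := congrArg (Polynomial.eval (t j)) (hg k)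
      simp at this
      linear_combination this
    choose Q hQ using fun k : Fin (m + 1) => ih (fun j => t j.succ) (fun l => g (k.succAbove l))
    have h1 : Matrix.det (Matrix.of fun j k => (f k).eval (t j))
        = (consRow (fun k => (f k).eval (t 0))
          (Matrix.of fun (j : Fin m) k => (t j.succ - t 0) * (g k).eval (t j.succ))).det := by
      refine Matrix.det_eq_of_forall_row_eq_smul_add_const (fun j => if j = 0 then 0 else 1) 0
        (by simp) ?_
      intro j k
      refine Fin.cases ?_ (fun j => ?_) j
      · simp
      · simp only [Matrix.of_apply, consRow_succ, consRow_zero, Fin.succ_ne_zero, if_false]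
        rw [hg' j.succ k]
        ring
    have h2 : ∀ k : Fin (m + 1), (Matrix.submatrix (Matrix.of fun (j : Fin m) (k : Fin (m + 1)) =>
        (t (Fin.succ j) - t 0) * (g k).eval (t (Fin.succ j))) id k.succAbove).det
        = (∏ j : Fin m, (t j.succ - t 0))
          * ((∏ i : Fin m, ∏ j ∈ Finset.Ioi i, (t j.succ - t i.succ)) * Q k) := by
      intro k
      rw [← hQ k, ← Matrix.det_mul_column]
      rfl
    refine ⟨∑ k : Fin (m + 1), (-1) ^ (k : ℕ) * (f k).eval (t 0) * Q k, ?_⟩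
    have h3 := det_cons_row (fun k => (f k).eval (t 0))
      (Matrix.of fun (j : Fin m) (k : Fin (m + 1)) =>
        (t (Fin.succ j) - t 0) * (g k).eval (t (Fin.succ j)))
    rw [h1]
    refine h3.trans ?_
    simp_rw [h2]
    rw [Fin.prod_univ_succ, Fin.prod_Ioi_zero, Finset.mul_sum]
    simp_rw [Fin.prod_Ioi_succ]
    refine Finset.sum_congr rfl fun k _ => ?_
    ring

end LinearAlgebra

/-! ### The half-step lattice, the products φ_M, and cancellation of entire factors. -/

/-- The point `x + i h γ / 2` of the half-step lattice through `x`. -/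
noncomputable def pt (F : Family) (x : ℂ) (h : ℤ) : ℂ := x + Complex.I * (h / 2) * gam F

/-- The number `c` with `η(x + i d γ / 2) - η(x - i d γ / 2) = c φ(x)`. -/
noncomputable def etaBracket : Family → ℤ → ℂ
  | .wilson, d => Complex.I * d
  | .askeyWilson q _ _, d => -Complex.sin (Complex.I * (d / 2) * Real.log q)

/-- The Casorati determinant without its power of `i`. -/
noncomputable def cas (F : Family) {n : ℕ} (f : Fin n → ℂ → ℂ) (x : ℂ) : ℂ :=
  Matrix.det (Matrix.of fun j k : Fin n => f k (pt F x (n - 1 - 2 * (j : ℤ))))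

section Lattice

variable (F : Family)

theorem node_eq_pt (n s : ℕ) (x : ℂ) : node F n s x = pt F x (n - 1 - 2 * s) := by
  simp only [node, pt]
  push_cast
  ring

theorem pt_pt (x : ℂ) (a b : ℤ) : pt F (pt F x a) b = pt F x (a + b) := by
  simp only [pt]
  push_cast
  ring

@[simp] theorem pt_zero (x : ℂ) : pt F x 0 = x := by
  simp [pt]

theorem neg_pt (x : ℂ) (h : ℤ) : -pt F x h = pt F (-x) (-h) := by
  simp only [pt]
  push_cast
  ring

theorem eta_neg (x : ℂ) : eta F (-x) = eta F x := by
  cases F <;> simp [eta]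

theorem phi_neg (x : ℂ) : phi F (-x) = -phi F x := by
  cases F <;> simp [phi]

theorem etaBracket_ne_zero {d : ℤ} (hd : d ≠ 0) : etaBracket F d ≠ 0 := by
  cases F with
  | wilson => simpa [etaBracket] using hd
  | askeyWilson q h₀ h₁ =>
    simp only [etaBracket, neg_ne_zero]
    intro h
    have h2 : Complex.I * ((d : ℂ) / 2) * (Real.log q : ℂ)
        = ((d / 2 * Real.log q : ℝ) : ℂ) * Complex.I := by
      push_cast; ring
    rw [h2, Complex.sin_mul_I, mul_eq_zero] at h
    rcases h with h | h
    · rw [← Complex.ofReal_sinh, Complex.ofReal_eq_zero, Real.sinh_eq_zero] at h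
      have := (Real.log_neg h₀ h₁).ne
      have hd' : (d : ℝ) ≠ 0 := by exact_mod_cast hd
      exact mul_ne_zero (div_ne_zero hd' two_ne_zero) this h
    · exact Complex.I_ne_zero h

theorem eta_pt_sub_eta_pt (x : ℂ) (c d : ℤ) :
    eta F (pt F x (c + d)) - eta F (pt F x (c - d)) = etaBracket F d * phi F (pt F x c) := by
  cases F with
  | wilson =>
    simp only [eta, pt, etaBracket, phi, gam]
    push_cast
    ring
  | askeyWilson q h₀ h₁ =>
    simp only [eta, pt, etaBracket, phi, gam]
    have h1 : x + Complex.I * (((c + d : ℤ) : ℂ) / 2) * (Real.log q : ℂ)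
        = (x + Complex.I * ((c : ℂ) / 2) * (Real.log q : ℂ))
          + Complex.I * ((d : ℂ) / 2) * (Real.log q : ℂ) := by push_cast; ring
    have h2 : x + Complex.I * (((c - d : ℤ) : ℂ) / 2) * (Real.log q : ℂ)
        = (x + Complex.I * ((c : ℂ) / 2) * (Real.log q : ℂ))
          - Complex.I * ((d : ℂ) / 2) * (Real.log q : ℂ) := by push_cast; ring
    rw [h1, h2, Complex.cos_add, Complex.cos_sub]
    ring

theorem differentiable_pt (h : ℤ) : Differentiable ℂ fun x => pt F x h := by
  unfold pt
  fun_prop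

theorem differentiable_eta : Differentiable ℂ (eta F) := by
  cases F with
  | wilson => exact (differentiable_id.pow 2)
  | askeyWilson q h₀ h₁ => exact Complex.differentiable_cos

theorem differentiable_phi : Differentiable ℂ (phi F) := by
  cases F with
  | wilson => exact (differentiable_const _).mul differentiable_id
  | askeyWilson q h₀ h₁ => exact (differentiable_const _).mul Complex.differentiable_sin

theorem exists_phi_ne_zero : ∃ x, phi F x ≠ 0 := by
  cases F with
  | wilson => exact ⟨1, by simp [phi]⟩
  | askeyWilson q h₀ h₁ => exact ⟨Real.pi / 2, by simp [phi, Complex.sin_pi_div_two]⟩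

/-- Entire functions have no zero divisors. -/
theorem eq_zero_of_mul_eq_zero {f g : ℂ → ℂ} (hf : Differentiable ℂ f) (hg : Differentiable ℂ g)
    (h : ∀ x, f x * g x = 0) (hg0 : ∃ x, g x ≠ 0) (x : ℂ) : f x = 0 := by
  have hfa : AnalyticOnNhd ℂ f Set.univ := fun x _ => hf.analyticAt x
  have hga : AnalyticOnNhd ℂ g Set.univ := fun x _ => hg.analyticAt x
  rcases hfa.eq_zero_or_eq_zero_of_mul_eq_zero hga (fun x _ => h x) isPreconnected_univ with h | h
  · exact h x (Set.mem_univ x)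
  · obtain ⟨y, hy⟩ := hg0
    exact absurd (h y (Set.mem_univ y)) hy

theorem exists_mul_ne_zero {f g : ℂ → ℂ} (hf : Differentiable ℂ f) (hg : Differentiable ℂ g)
    (hf0 : ∃ x, f x ≠ 0) (hg0 : ∃ x, g x ≠ 0) : ∃ x, f x * g x ≠ 0 := by
  by_contra! h
  obtain ⟨y, hy⟩ := hf0
  exact hy (eq_zero_of_mul_eq_zero hf hg h hg0 y)

theorem exists_comp_pt_ne_zero {f : ℂ → ℂ} (h : ℤ) (hf : ∃ x, f x ≠ 0) :
    ∃ x, f (pt F x h) ≠ 0 := by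
  obtain ⟨x, hx⟩ := hf
  exact ⟨pt F x (-h), by simpa [pt_pt] using hx⟩

theorem prod_phi_centered (K : ℕ) (x : ℂ) :
    ∏ j ∈ Finset.range K, phi F (pt F x (K - 1 - 2 * (j : ℤ)))
      = phi F x ^ (K % 2) * ∏ k ∈ Finset.Icc 1 K,
        (phi F (x - Complex.I * (k / 2) * gam F) * phi F (x + Complex.I * (k / 2) * gam F))
          ^ ((K - k) % 2) := by
  induction K using Nat.twoStepInduction with
  | zero => simp
  | one => simp
  | more K ih _ =>
    rw [Finset.prod_range_succ, Finset.prod_range_succ']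
    have h1 : ∀ j ∈ Finset.range K, phi F (pt F x (((K + 2 : ℕ) : ℤ) - 1 - 2 * ((j + 1 : ℕ) : ℤ)))
        = phi F (pt F x (K - 1 - 2 * (j : ℤ))) := by
      intro j _
      congr 2
      push_cast
      ring
    rw [Finset.prod_congr rfl h1, ih, Finset.prod_Icc_succ_top (by omega),
      Finset.prod_Icc_succ_top (by omega)]
    have h2 : ∀ k ∈ Finset.Icc 1 K,
        (phi F (x - Complex.I * (k / 2) * gam F) * phi F (x + Complex.I * (k / 2) * gam F))
          ^ ((K + 2 - k) % 2)
        = (phi F (x - Complex.I * (k / 2) * gam F) * phi F (x + Complex.I * (k / 2) * gam F))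
          ^ ((K - k) % 2) := by
      intro k hk
      congr 1
      have := (Finset.mem_Icc.1 hk).2
      omega
    rw [Finset.prod_congr rfl h2]
    have h3 : (K + 1 + 1 - (K + 1)) % 2 = 1 := by omega
    have h4 : (K + 1 + 1 - (K + 1 + 1)) % 2 = 0 := by omega
    have h5 : (K + 2) % 2 = K % 2 := by omega
    rw [h3, h4, h5, pow_zero, pow_one, mul_one]
    have h6 : pt F x (((K + 2 : ℕ) : ℤ) - 1 - 2 * ((0 : ℕ) : ℤ))
        = x + Complex.I * (((K + 1 : ℕ) : ℂ) / 2) * gam F := by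
      simp only [pt]; push_cast; ring
    have h7 : pt F x (((K + 2 : ℕ) : ℤ) - 1 - 2 * ((K + 1 : ℕ) : ℤ))
        = x - Complex.I * (((K + 1 : ℕ) : ℂ) / 2) * gam F := by
      simp only [pt]; push_cast; ring
    rw [h6, h7]
    ring

theorem phiM_eq_prod_Icc (M K : ℕ) (hK : M ≤ K + 2) (x : ℂ) :
    phiM F M x = phi F x ^ (M / 2) * ∏ k ∈ Finset.Icc 1 K,
      (phi F (x - Complex.I * (k / 2) * gam F) * phi F (x + Complex.I * (k / 2) * gam F))
        ^ ((M - k) / 2) := by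
  unfold phiM
  congr 1
  refine Finset.prod_subset (Finset.Icc_subset_Icc_right (by omega)) fun k hk hk' => ?_
  have h1 := Finset.mem_Icc.1 hk
  have h2 : ¬ (1 ≤ k ∧ k ≤ M - 2) := fun h => hk' (Finset.mem_Icc.2 h)
  rw [show (M - k) / 2 = 0 by omega, pow_zero]

/-- The exponents in φ_{K+1} and φ_K differ by parities, and the points with odd parity are exactly
K centred nodes. The identities for φ_M below are inductions on this recursion and involve no
integer parts. -/
theorem phiM_succ (K : ℕ) (x : ℂ) :
    phiM F (K + 1) x = (∏ j ∈ Finset.range K, phi F (pt F x (K - 1 - 2 * (j : ℤ))))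
      * phiM F K x := by
  rw [phiM_eq_prod_Icc F (K + 1) K (by omega), phiM_eq_prod_Icc F K K (by omega),
    prod_phi_centered, mul_mul_mul_comm, ← pow_add, ← Finset.prod_mul_distrib]
  congr 1
  · congr 1
    omega
  · refine Finset.prod_congr rfl fun k hk => ?_
    rw [← pow_add]
    congr 1
    have := (Finset.mem_Icc.1 hk).2
    omega

@[simp] theorem phiM_zero (x : ℂ) : phiM F 0 x = 1 := by
  simp [phiM]

@[simp] theorem phiM_one (x : ℂ) : phiM F 1 x = 1 := by
  simp [phiM]

theorem differentiable_phiM (M : ℕ) : Differentiable ℂ (phiM F M) := by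
  induction M with
  | zero => simp [funext (phiM_zero F)]
  | succ K ih =>
    rw [funext (phiM_succ F K)]
    exact (Differentiable.fun_finsetProd fun j _ =>
      (differentiable_phi F).comp (differentiable_pt F _)).mul ih

theorem exists_prod_ne_zero {ι : Type*} (s : Finset ι) (f : ι → ℂ → ℂ)
    (hf : ∀ i, Differentiable ℂ (f i)) (h : ∀ i, ∃ x, f i x ≠ 0) : ∃ x, ∏ i ∈ s, f i x ≠ 0 := by
  classical
  induction s using Finset.induction_on with
  | empty => exact ⟨0, by simp⟩
  | insert i s hi ih =>
    simp_rw [Finset.prod_insert hi]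
    exact exists_mul_ne_zero (hf i) (Differentiable.fun_finsetProd fun j _ => hf j) (h i) ih

theorem exists_phiM_ne_zero (M : ℕ) : ∃ x, phiM F M x ≠ 0 := by
  induction M with
  | zero => exact ⟨0, by simp⟩
  | succ K ih =>
    rw [funext (phiM_succ F K)]
    refine exists_mul_ne_zero (Differentiable.fun_finsetProd fun j _ =>
      (differentiable_phi F).comp (differentiable_pt F _)) (differentiable_phiM F K)
      (exists_prod_ne_zero _ _ (fun j => (differentiable_phi F).comp (differentiable_pt F _))
        fun j => exists_comp_pt_ne_zero F _ (exists_phi_ne_zero F)) ih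

theorem phiM_succ_pt (K : ℕ) (x : ℂ) (c : ℤ) :
    phiM F (K + 1) (pt F x c)
      = (∏ j ∈ Finset.range K, phi F (pt F x (c + K - 1 - 2 * (j : ℤ)))) * phiM F K (pt F x c) := by
  rw [phiM_succ]
  congr 1
  refine Finset.prod_congr rfl fun j _ => ?_
  rw [pt_pt]
  congr 2
  ring

/-- The split-off factors sit at the midpoints between the top node and the K others, which is the
form in which a Vandermonde product loses its first node. -/
theorem phiM_succ_top (K : ℕ) (x : ℂ) (c : ℤ) :
    phiM F (K + 1) (pt F x c)
      = (∏ j ∈ Finset.range K, phi F (pt F x (c + K - 1 - (j : ℤ)))) * phiM F K (pt F x (c - 1)) := by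
  induction K with
  | zero => simp
  | succ K ih =>
    rw [phiM_succ_pt, ih, phiM_succ_pt, Finset.prod_range_succ', Finset.prod_range_succ']
    have h1 : ∀ j ∈ Finset.range K,
        phi F (pt F x (c + ((K + 1 : ℕ) : ℤ) - 1 - 2 * ((j + 1 : ℕ) : ℤ)))
        = phi F (pt F x (c - 1 + K - 1 - 2 * (j : ℤ))) := by
      intro j _; congr 2; push_cast; ring
    have h2 : ∀ j ∈ Finset.range K,
        phi F (pt F x (c + ((K + 1 : ℕ) : ℤ) - 1 - ((j + 1 : ℕ) : ℤ)))
        = phi F (pt F x (c + K - 1 - (j : ℤ))) := by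
      intro j _; congr 2; push_cast; ring
    rw [Finset.prod_congr rfl h1, Finset.prod_congr rfl h2]
    simp only [Nat.cast_zero, mul_zero, sub_zero]
    ring

/-- This identity and the two shift identities after it carry the prefactors in `multiDet_duality`,
where determinants of neighbouring sizes meet at half-shifted centres. -/
theorem phiM_bilinear (n : ℕ) (x : ℂ) (c : ℤ) :
    phiM F (n + 2) (pt F x c) * phiM F n (pt F x c)
      = phi F (pt F x c) * phiM F (n + 1) (pt F x (c + 1)) * phiM F (n + 1) (pt F x (c - 1)) := by
  induction n with
  | zero => simp [phiM_succ_pt]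
  | succ n ih =>
    rw [phiM_succ_pt F (n + 2), phiM_succ_pt F n x c, phiM_succ_pt F (n + 1) x (c + 1),
      phiM_succ_pt F (n + 1) x (c - 1)]
    have h1 : ∏ j ∈ Finset.range (n + 2), phi F (pt F x (c + ((n + 2 : ℕ) : ℤ) - 1 - 2 * (j : ℤ)))
        = (∏ j ∈ Finset.range (n + 1), phi F (pt F x (c + 1 + ((n + 1 : ℕ) : ℤ) - 1 - 2 * (j : ℤ))))
          * phi F (pt F x (c - n - 1)) := by
      rw [Finset.prod_range_succ]
      congr 1
      · refine Finset.prod_congr rfl fun j _ => ?_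
        congr 2; push_cast; ring
      · congr 2; push_cast; ring
    have h2 : ∏ j ∈ Finset.range (n + 1), phi F (pt F x (c - 1 + ((n + 1 : ℕ) : ℤ) - 1 - 2 * (j : ℤ)))
        = (∏ j ∈ Finset.range n, phi F (pt F x (c + n - 1 - 2 * (j : ℤ))))
          * phi F (pt F x (c - n - 1)) := by
      rw [Finset.prod_range_succ]
      congr 1
      · refine Finset.prod_congr rfl fun j _ => ?_
        congr 2; push_cast; ring
      · congr 2; push_cast; ring
    rw [h1, h2]
    linear_combination (∏ j ∈ Finset.range (n + 1),
        phi F (pt F x (c + 1 + ((n + 1 : ℕ) : ℤ) - 1 - 2 * (j : ℤ))))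
      * phi F (pt F x (c - n - 1))
      * (∏ j ∈ Finset.range n, phi F (pt F x (c + n - 1 - 2 * (j : ℤ)))) * ih

theorem phiM_shift_up (s : ℕ) (x : ℂ) (c : ℤ) :
    phiM F (s + 2) (pt F x (c + 1)) * phiM F s (pt F x (c - 1)) * phi F (pt F x c)
      = phi F (pt F x (c + s)) * phi F (pt F x (c + s + 1)) * phiM F (s + 1) (pt F x c) ^ 2 := by
  induction s with
  | zero => simp [phiM_succ_pt]; ring
  | succ s ih =>
    rw [phiM_succ_pt F (s + 2), phiM_succ_pt F s x (c - 1), phiM_succ_pt F (s + 1) x c]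
    have h1 : ∏ j ∈ Finset.range (s + 2),
          phi F (pt F x (c + 1 + ((s + 2 : ℕ) : ℤ) - 1 - 2 * (j : ℤ)))
        = (∏ j ∈ Finset.range (s + 1), phi F (pt F x (c + ((s + 1 : ℕ) : ℤ) - 1 - 2 * (j : ℤ))))
          * phi F (pt F x (c + s + 1 + 1)) := by
      rw [Finset.prod_range_succ']
      congr 1
      · refine Finset.prod_congr rfl fun j _ => ?_
        congr 2; push_cast; ring
      · congr 2; push_cast; ring
    have h2 : ∏ j ∈ Finset.range (s + 1), phi F (pt F x (c + ((s + 1 : ℕ) : ℤ) - 1 - 2 * (j : ℤ)))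
        = (∏ j ∈ Finset.range s, phi F (pt F x (c - 1 + s - 1 - 2 * (j : ℤ))))
          * phi F (pt F x (c + s)) := by
      rw [Finset.prod_range_succ']
      congr 1
      · refine Finset.prod_congr rfl fun j _ => ?_
        congr 2; push_cast; ring
      · congr 2; push_cast; ring
    rw [h1, h2]
    push_cast
    rw [show c + (s + 1 : ℤ) = c + s + 1 by ring]
    linear_combination (∏ j ∈ Finset.range s, phi F (pt F x (c - 1 + s - 1 - 2 * (j : ℤ)))) ^ 2
      * phi F (pt F x (c + s)) * phi F (pt F x (c + s + 1 + 1)) * ih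

theorem phiM_shift_down (s : ℕ) (x : ℂ) (c : ℤ) :
    phiM F (s + 2) (pt F x (c - 1)) * phiM F s (pt F x (c + 1)) * phi F (pt F x c)
      = phi F (pt F x (c - s)) * phi F (pt F x (c - s - 1)) * phiM F (s + 1) (pt F x c) ^ 2 := by
  induction s with
  | zero => simp [phiM_succ_pt]; ring
  | succ s ih =>
    rw [phiM_succ_pt F (s + 2), phiM_succ_pt F s x (c + 1), phiM_succ_pt F (s + 1) x c]
    have h1 : ∏ j ∈ Finset.range (s + 2),
          phi F (pt F x (c - 1 + ((s + 2 : ℕ) : ℤ) - 1 - 2 * (j : ℤ)))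
        = (∏ j ∈ Finset.range (s + 1), phi F (pt F x (c + ((s + 1 : ℕ) : ℤ) - 1 - 2 * (j : ℤ))))
          * phi F (pt F x (c - s - 1 - 1)) := by
      rw [Finset.prod_range_succ]
      congr 1
      · refine Finset.prod_congr rfl fun j _ => ?_
        congr 2; push_cast; ring
      · congr 2; push_cast; ring
    have h2 : ∏ j ∈ Finset.range (s + 1), phi F (pt F x (c + ((s + 1 : ℕ) : ℤ) - 1 - 2 * (j : ℤ)))
        = (∏ j ∈ Finset.range s, phi F (pt F x (c + 1 + s - 1 - 2 * (j : ℤ))))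
          * phi F (pt F x (c - s)) := by
      rw [Finset.prod_range_succ]
      congr 1
      · refine Finset.prod_congr rfl fun j _ => ?_
        congr 2; push_cast; ring
      · congr 2; push_cast; ring
    rw [h1, h2]
    push_cast
    rw [show c - (s + 1 : ℤ) = c - s - 1 by ring]
    linear_combination (∏ j ∈ Finset.range s, phi F (pt F x (c + 1 + s - 1 - 2 * (j : ℤ)))) ^ 2
      * phi F (pt F x (c - s)) * phi F (pt F x (c - s - 1 - 1)) * ih

end Lattice

/-! ### Casorati determinants as φ_m times a polynomial in η. -/

section Existence

variable (F : Family)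

theorem differentiable_cas {n : ℕ} {f : Fin n → ℂ → ℂ} (hf : ∀ k, Differentiable ℂ (f k)) :
    Differentiable ℂ (cas F f) := by
  unfold cas
  simp only [Matrix.det_apply, Matrix.of_apply]
  refine Differentiable.fun_sum fun σ _ => ?_
  refine Differentiable.const_smul (Differentiable.fun_finsetProd fun j _ => ?_) _
  exact (hf j).comp (differentiable_pt F _)

/-- Casorati determinants of even functions have a parity. -/
theorem cas_neg {n : ℕ} {f : Fin n → ℂ → ℂ} (hf : ∀ k x, f k (-x) = f k x) (x : ℂ) :
    cas F f (-x) = (Equiv.Perm.sign (Fin.revPerm : Equiv.Perm (Fin n)) : ℤ) * cas F f x := by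
  unfold cas
  rw [← Matrix.det_permute]
  congr 1
  ext j k
  simp only [Matrix.of_apply, Matrix.submatrix_apply, id, Fin.revPerm_apply]
  rw [← hf k, neg_pt, neg_neg]
  congr 2
  rw [Fin.val_rev]
  have := j.isLt
  push_cast [Nat.cast_sub (show (j : ℕ) + 1 ≤ n from this)]
  ring

theorem exists_phi_sq : ∃ s : Polynomial ℂ, ∀ x, phi F x ^ 2 = s.eval (eta F x) := by
  cases F with
  | wilson =>
    refine ⟨Polynomial.C 4 * Polynomial.X, fun x => ?_⟩
    simp [phi, eta]
    ring
  | askeyWilson q h₀ h₁ =>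
    refine ⟨Polynomial.C 4 - Polynomial.C 4 * Polynomial.X ^ 2, fun x => ?_⟩
    simp [phi, eta]
    linear_combination 4 * Complex.sin_sq_add_cos_sq x

theorem exists_eta_pt (h : ℤ) : ∃ p r : Polynomial ℂ, ∀ x,
    eta F (pt F x h) = p.eval (eta F x) + phi F x * r.eval (eta F x) := by
  cases F with
  | wilson =>
    refine ⟨Polynomial.X + Polynomial.C ((Complex.I * (h / 2)) ^ 2),
      Polynomial.C (Complex.I * (h / 2)), fun x => ?_⟩
    simp [phi, eta, pt, gam]
    ring
  | askeyWilson q h₀ h₁ =>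
    refine ⟨Polynomial.C (Complex.cos (Complex.I * (h / 2) * Real.log q)) * Polynomial.X,
      Polynomial.C (-Complex.sin (Complex.I * (h / 2) * Real.log q) / 2), fun x => ?_⟩
    simp only [phi, eta, pt, gam, Complex.cos_add, Polynomial.eval_mul, Polynomial.eval_C,
      Polynomial.eval_X]
    ring

/-- The functions `p(η) + φ r(η)`. -/
def etaPhiSubalgebra : Subalgebra ℂ (ℂ → ℂ) where
  carrier := {f | ∃ p r : Polynomial ℂ, ∀ x, f x = p.eval (eta F x) + phi F x * r.eval (eta F x)}
  mul_mem' := by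
    rintro f g ⟨p, r, hf⟩ ⟨p', r', hg⟩
    obtain ⟨s, hs⟩ := exists_phi_sq F
    refine ⟨p * p' + s * r * r', p * r' + r * p', fun x => ?_⟩
    simp only [Pi.mul_apply, hf, hg, Polynomial.eval_add, Polynomial.eval_mul, ← hs]
    ring
  add_mem' := by
    rintro f g ⟨p, r, hf⟩ ⟨p', r', hg⟩
    refine ⟨p + p', r + r', fun x => ?_⟩
    simp only [Pi.add_apply, hf, hg, Polynomial.eval_add]
    ring
  algebraMap_mem' := fun c => ⟨Polynomial.C c, 0, fun x => by simp⟩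

theorem differentiable_eval_eta (p : Polynomial ℂ) : Differentiable ℂ fun x => p.eval (eta F x) :=
  p.differentiable.comp (differentiable_eta F)

/-- The difference of η at two nodes is a nonzero constant times φ at their midpoint
(`eta_pt_sub_eta_pt`), so the Vandermonde product of the nodes collects the factors of φ_m. -/
theorem prod_eta_sub_eq_phiM (m : ℕ) : ∃ C : ℂ, C ≠ 0 ∧ ∀ (x : ℂ) (c : ℤ),
    ∏ i : Fin m, ∏ j ∈ Finset.Ioi i, (eta F (pt F x (c - 2 * (j : ℤ))) - eta F (pt F x (c - 2 * (i : ℤ))))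
      = C * phiM F m (pt F x (c - m + 1)) := by
  induction m with
  | zero => exact ⟨1, one_ne_zero, by simp⟩
  | succ m ih =>
    obtain ⟨C, hC, h⟩ := ih
    refine ⟨(∏ j : Fin m, -etaBracket F ((j : ℤ) + 1)) * C, mul_ne_zero
      (Finset.prod_ne_zero_iff.2 fun j _ => neg_ne_zero.2 (etaBracket_ne_zero F (by omega))) hC,
      fun x c => ?_⟩
    rw [Fin.prod_univ_succ, Fin.prod_Ioi_zero]
    simp_rw [Fin.prod_Ioi_succ]
    have h1 : ∀ j : Fin m, eta F (pt F x (c - 2 * ((j.succ : Fin (m + 1)) : ℤ)))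
        - eta F (pt F x (c - 2 * ((0 : Fin (m + 1)) : ℤ)))
        = -etaBracket F ((j : ℤ) + 1) * phi F (pt F x (c - 1 - (j : ℤ))) := by
      intro j
      have := eta_pt_sub_eta_pt F x (c - 1 - (j : ℤ)) ((j : ℤ) + 1)
      rw [neg_mul, ← this, neg_sub]
      congr 3
      · simp; ring
      · simp; ring
    have h2 : ∀ i j : Fin m, eta F (pt F x (c - 2 * ((j.succ : Fin (m + 1)) : ℤ)))
        - eta F (pt F x (c - 2 * ((i.succ : Fin (m + 1)) : ℤ)))
        = eta F (pt F x (c - 2 - 2 * (j : ℤ))) - eta F (pt F x (c - 2 - 2 * (i : ℤ))) := by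
      intro i j
      congr 3 <;> simp <;> ring
    simp_rw [h1, h2]
    rw [h x (c - 2), Finset.prod_mul_distrib, phiM_succ_top,
      Fin.prod_univ_eq_prod_range (fun j : ℕ => phi F (pt F x (c - 1 - (j : ℤ))))]
    have h3 : ∀ j ∈ Finset.range m,
        phi F (pt F x (c - ((m + 1 : ℕ) : ℤ) + 1 + m - 1 - (j : ℤ))) = phi F (pt F x (c - 1 - (j : ℤ))) := by
      intro j _
      congr 2
      push_cast
      ring
    rw [Finset.prod_congr rfl h3, show c - 2 - (m : ℤ) + 1 = c - ((m + 1 : ℕ) : ℤ) + 1 - 1 by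
      push_cast; ring]
    ring

theorem cas_eta_pow (m : ℕ) : ∃ C : ℂ, C ≠ 0 ∧ ∀ x : ℂ,
    cas F (fun (k : Fin m) x => eta F x ^ (k : ℕ)) x = C * phiM F m x := by
  obtain ⟨C, hC, h⟩ := prod_eta_sub_eq_phiM F m
  refine ⟨C, hC, fun x => ?_⟩
  have h1 := h x (m - 1)
  rw [show (m : ℤ) - 1 - m + 1 = 0 by ring, pt_zero] at h1
  rw [← h1, ← Matrix.det_vandermonde fun j : Fin m => eta F (pt F x (m - 1 - 2 * (j : ℤ)))]
  rfl

/-- The Casorati determinant of polynomials in `η` is `φ_m` times a polynomial in `η`. -/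
theorem exists_polyPart {m : ℕ} (f : Fin m → Polynomial ℂ) : ∃ p : Polynomial ℂ, ∀ x,
    cas F (fun k x => (f k).eval (eta F x)) x = phiM F m x * p.eval (eta F x) := by
  obtain ⟨C, hC, hV⟩ := cas_eta_pow F m
  -- Divisibility is obtained in the ring ℂ[η] + φ ℂ[η], which contains every translate of η, so the
  -- quotient `Q` has the form p(η) + φ r(η).
  obtain ⟨Q, hQ⟩ := det_eval_eq_vandermonde_mul (R := etaPhiSubalgebra F)
    (fun j => ⟨fun x => eta F (pt F x (m - 1 - 2 * (j : ℤ))), exists_eta_pt F _⟩)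
    (fun k => (f k).map (algebraMap ℂ (etaPhiSubalgebra F)))
  rw [← Matrix.det_vandermonde] at hQ
  have hQx : ∀ x, cas F (fun k x => (f k).eval (eta F x)) x = C * phiM F m x * (Q : ℂ → ℂ) x := by
    intro x
    set ev : etaPhiSubalgebra F →ₐ[ℂ] ℂ := (Pi.evalAlgHom ℂ (fun _ : ℂ => ℂ) x).comp
      (etaPhiSubalgebra F).val with hev
    have h := congrArg ev hQ
    rw [map_mul, AlgHom.map_det, AlgHom.map_det] at h
    rw [← hV x]
    refine Eq.trans ?_ (h.trans ?_)
    · unfold cas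
      congr 1
      ext j k
      simp only [AlgHom.mapMatrix_apply, Matrix.map_apply, Matrix.of_apply,
        Polynomial.eval_map_algebraMap]
      rw [← Polynomial.aeval_algHom_apply]
      rw [Polynomial.coe_aeval_eq_eval]
      rfl
    · congr 1
  obtain ⟨p, r, hpr⟩ := Q.2
  have hQd : Differentiable ℂ (Q : ℂ → ℂ) := by
    rw [funext hpr]
    exact (differentiable_eval_eta F p).add
      ((differentiable_phi F).mul (differentiable_eval_eta F r))
  have hsgn : ((Equiv.Perm.sign (Fin.revPerm : Equiv.Perm (Fin m)) : ℤ) : ℂ) ≠ 0 := by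
    rcases Int.units_eq_one_or (Equiv.Perm.sign (Fin.revPerm : Equiv.Perm (Fin m))) with h | h <;>
      simp [h]
  -- The determinant and the Vandermonde determinant acquire the same sign under x ↦ -x, so `Q` is
  -- even. Since φ is odd, averaging over x and -x leaves only p(η).
  have heven : ∀ x, (Q : ℂ → ℂ) (-x) - (Q : ℂ → ℂ) x = 0 := by
    refine eq_zero_of_mul_eq_zero ((hQd.comp differentiable_neg).sub hQd) (differentiable_phiM F m)
      (fun x => ?_) (exists_phiM_ne_zero F m)
    have h1 := cas_neg F (f := fun k x => (f k).eval (eta F x))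
      (fun k x => by simp only [eta_neg]) x
    have h2 := cas_neg F (f := fun (k : Fin m) x => eta F x ^ (k : ℕ))
      (fun k x => by simp only [eta_neg]) x
    rw [hV, hV] at h2
    rw [hQx, hQx, h2] at h1
    refine (mul_eq_zero.1 (?_ : (((Equiv.Perm.sign (Fin.revPerm : Equiv.Perm (Fin m)) : ℤ) : ℂ) * C)
      * _ = 0)).resolve_left (mul_ne_zero hsgn hC)
    linear_combination h1
  refine ⟨Polynomial.C C * p, fun x => ?_⟩
  rw [hQx, Polynomial.eval_mul, Polynomial.eval_C]
  have h1 := heven x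
  have h2 := hpr x
  have h3 := hpr (-x)
  rw [eta_neg, phi_neg] at h3
  linear_combination C * phiM F m x * (-h1 / 2 + h2 / 2 + h3 / 2)

end Existence

/-! ### Shifted factorials. -/

section Pochhammer

theorem poch_succ (a : ℂ) (n : ℕ) : poch a (n + 1) = poch a n * (a + n) := by
  simp [poch, Finset.prod_range_succ]

theorem poch_succ_left (a : ℂ) (n : ℕ) : poch a (n + 1) = a * poch (a + 1) n := by
  simp only [poch, Finset.prod_range_succ']
  rw [mul_comm]
  congr 1
  · simp
  · refine Finset.prod_congr rfl fun i _ => ?_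
    push_cast
    ring

@[simp] theorem poch_zero (a : ℂ) : poch a 0 = 1 := by simp [poch]

theorem qpoch_succ (a q : ℂ) (n : ℕ) : qpoch a q (n + 1) = qpoch a q n * (1 - a * q ^ n) := by
  simp [qpoch, Finset.prod_range_succ]

theorem qpoch_succ_left (a q : ℂ) (n : ℕ) :
    qpoch a q (n + 1) = (1 - a) * qpoch (a * q) q n := by
  simp only [qpoch, Finset.prod_range_succ']
  rw [mul_comm]
  congr 1
  · simp
  · refine Finset.prod_congr rfl fun i _ => ?_
    ring

@[simp] theorem qpoch_zero (a q : ℂ) : qpoch a q 0 = 1 := by simp [qpoch]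

/-- Coefficient comparison for an operator that sends the k-th basis element to a combination of the
k-th and the (k+1)-th, as both backward shifts do. -/
theorem sum_range_eq_of_ladder {n : ℕ} (r u w b : ℕ → ℂ) (h0 : r 0 = u 0) (hu : u (n + 1) = 0)
    (h : ∀ k ≤ n, r (k + 1) = u (k + 1) - w k) :
    ∑ k ∈ Finset.range (n + 2), r k * b k
      = ∑ k ∈ Finset.range (n + 1), (u k * b k - w k * b (k + 1)) := by
  have h1 : ∑ k ∈ Finset.range (n + 1), u k * b k = ∑ k ∈ Finset.range (n + 2), u k * b k := by
    rw [Finset.sum_range_succ _ (n + 1), hu, zero_mul, add_zero]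
  rw [Finset.sum_sub_distrib, h1, Finset.sum_range_succ', Finset.sum_range_succ' (fun k => u k * b k),
    h0, add_sub_right_comm, ← Finset.sum_sub_distrib]
  congr 1
  refine Finset.sum_congr rfl fun k hk => ?_
  rw [h k (by simpa [Nat.lt_succ_iff] using hk)]
  ring

end Pochhammer

/-! ### Shift relations of the Wilson polynomials. -/

section Wilson

/-- The coefficients of the Wilson polynomial in the basis `(a₁ + ix)_k (a₁ - ix)_k`. -/
noncomputable def wilsonCoeff (n k : ℕ) (a : Fin 4 → ℂ) : ℂ :=
  poch (-n) k * poch (n + (∑ i, a i) - 1) k / (k.factorial : ℂ)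
    * (poch (a 0 + a 1 + k) (n - k) * poch (a 0 + a 2 + k) (n - k) * poch (a 0 + a 3 + k) (n - k))

theorem wilsonPoly_eval (n : ℕ) (a : Fin 4 → ℂ) (x : ℂ) :
    (wilsonPoly n a).eval (x ^ 2) = ∑ k ∈ Finset.range (n + 1),
      wilsonCoeff n k a * (poch (a 0 + Complex.I * x) k * poch (a 0 - Complex.I * x) k) := by
  simp only [wilsonPoly, Polynomial.eval_finsetSum, Polynomial.eval_mul, Polynomial.eval_C,
    Polynomial.eval_prod, Polynomial.eval_add, Polynomial.eval_X, wilsonCoeff]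
  refine Finset.sum_congr rfl fun k _ => ?_
  congr 1
  simp only [poch]
  rw [← Finset.prod_mul_distrib]
  refine Finset.prod_congr rfl fun i _ => ?_
  linear_combination (x ^ 2) * Complex.I_sq

/-- The half-step difference maps the basis element of degree k + 1 at b₁ to a multiple of the one
of degree k at b₁ + 1/2 and kills the constant, so the coefficients can be compared one by one. -/
theorem wilsonPoly_forward (n : ℕ) (a b : Fin 4 → ℂ) (hab : ∀ k, a k = b k + 1 / 2) (x : ℂ) :
    (wilsonPoly (n + 1) b).eval ((x - Complex.I / 2) ^ 2)
        - (wilsonPoly (n + 1) b).eval ((x + Complex.I / 2) ^ 2)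
      = Complex.I * (n + 1) * (n + ∑ i, b i) * (2 * x) * (wilsonPoly n a).eval (x ^ 2) := by
  rw [wilsonPoly_eval, wilsonPoly_eval, wilsonPoly_eval, ← Finset.sum_sub_distrib,
    Finset.sum_range_succ', Finset.mul_sum]
  simp only [poch_zero, mul_one, sub_self, add_zero]
  refine Finset.sum_congr rfl fun k hk => ?_
  have hI := Complex.I_mul_I
  have hc : wilsonCoeff (n + 1) (k + 1) b * (-(k + 1))
      = (n + 1) * (n + ∑ i, b i) * wilsonCoeff n k a := by
    simp only [wilsonCoeff, Nat.add_sub_add_right, Fin.sum_univ_four, hab]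
    rw [poch_succ_left, poch_succ_left, Nat.factorial_succ]
    have h1 : (-((n + 1 : ℕ) : ℂ)) + 1 = -n := by push_cast; ring
    have h2 : (((n + 1 : ℕ) : ℂ)) + (b 0 + b 1 + b 2 + b 3) - 1 + 1
      = n + (b 0 + 1 / 2 + (b 1 + 1 / 2) + (b 2 + 1 / 2) + (b 3 + 1 / 2)) - 1 := by
        push_cast; ring
    have h3 : ∀ c d : ℂ, c + d + ((k + 1 : ℕ) : ℂ) = c + 1 / 2 + (d + 1 / 2) + k := by
      intro c d; push_cast; ring
    rw [h1, h2, h3, h3, h3]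
    have h4 : ((k.factorial : ℕ) : ℂ) ≠ 0 := by exact_mod_cast k.factorial_ne_zero
    have h5 : (k : ℂ) + 1 ≠ 0 := by exact_mod_cast k.succ_ne_zero
    push_cast
    field_simp
    ring
  have hb : poch (b 0 + Complex.I * (x - Complex.I / 2)) (k + 1)
        * poch (b 0 - Complex.I * (x - Complex.I / 2)) (k + 1)
      - poch (b 0 + Complex.I * (x + Complex.I / 2)) (k + 1)
        * poch (b 0 - Complex.I * (x + Complex.I / 2)) (k + 1)
      = -(k + 1) * Complex.I * (2 * x)
        * (poch (a 0 + Complex.I * x) k * poch (a 0 - Complex.I * x) k) := by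
    have e1 : b 0 + Complex.I * (x - Complex.I / 2) = a 0 + Complex.I * x := by
      rw [hab]; linear_combination -hI / 2
    have e2 : b 0 - Complex.I * (x + Complex.I / 2) = a 0 - Complex.I * x := by
      rw [hab]; linear_combination -hI / 2
    have e3 : b 0 - Complex.I * (x - Complex.I / 2) + 1 = a 0 - Complex.I * x := by
      rw [hab]; linear_combination hI / 2
    have e4 : b 0 + Complex.I * (x + Complex.I / 2) + 1 = a 0 + Complex.I * x := by
      rw [hab]; linear_combination hI / 2
    rw [e1, e2, poch_succ (a 0 + Complex.I * x), poch_succ (a 0 - Complex.I * x),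
      poch_succ_left (b 0 - Complex.I * (x - Complex.I / 2)),
      poch_succ_left (b 0 + Complex.I * (x + Complex.I / 2)), e3, e4]
    generalize poch (a 0 + Complex.I * x) k = p
    generalize poch (a 0 - Complex.I * x) k = r
    rw [hab]
    linear_combination (p * r * Complex.I * x) * hI
  rw [← mul_sub, hb]
  linear_combination Complex.I * (2 * x)
    * (poch (a 0 + Complex.I * x) k * poch (a 0 - Complex.I * x) k) * hc

/-- On a single basis element the weight factors b₁ ± ix are absorbed into the shifted factorials,
and what remains is a combination of two adjacent basis elements at b₁. The coefficients then
satisfy the relation required by `sum_range_eq_of_ladder`. -/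
theorem wilsonPoly_backward (n : ℕ) (a b : Fin 4 → ℂ) (hab : ∀ k, a k = b k + 1 / 2) (x : ℂ) :
    (∏ k, (b k + Complex.I * x)) * (wilsonPoly n a).eval ((x - Complex.I / 2) ^ 2)
        - (∏ k, (b k + Complex.I * (-x))) * (wilsonPoly n a).eval ((x + Complex.I / 2) ^ 2)
      = Complex.I * (2 * x) * (wilsonPoly (n + 1) b).eval (x ^ 2) := by
  have hI := Complex.I_mul_I
  set B : ℕ → ℂ := fun k => poch (b 0 + Complex.I * x) k * poch (b 0 - Complex.I * x) k with hB
  rw [wilsonPoly_eval, wilsonPoly_eval, wilsonPoly_eval]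
  have key := sum_range_eq_of_ladder (n := n) (fun k => wilsonCoeff (n + 1) k b)
    (fun k => wilsonCoeff n k a
      * ((b 0 + b 1 + k) * (b 0 + b 2 + k) * (b 0 + b 3 + k)))
    (fun k => wilsonCoeff n k a * ((∑ i, b i) + k)) B ?_ ?_ ?_
  · rw [show ∑ k ∈ Finset.range (n + 1 + 1), wilsonCoeff (n + 1) k b
        * (poch (b 0 + Complex.I * x) k * poch (b 0 - Complex.I * x) k) = _ from key,
      Finset.mul_sum, Finset.mul_sum, Finset.mul_sum, ← Finset.sum_sub_distrib]
    refine Finset.sum_congr rfl fun k _ => ?_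
    have e1 : a 0 + Complex.I * (x - Complex.I / 2) = b 0 + Complex.I * x + 1 := by
      rw [hab]; linear_combination -hI / 2
    have e2 : a 0 - Complex.I * (x - Complex.I / 2) = b 0 - Complex.I * x := by
      rw [hab]; linear_combination hI / 2
    have e3 : a 0 + Complex.I * (x + Complex.I / 2) = b 0 + Complex.I * x := by
      rw [hab]; linear_combination hI / 2
    have e4 : a 0 - Complex.I * (x + Complex.I / 2) = b 0 - Complex.I * x + 1 := by
      rw [hab]; linear_combination -hI / 2
    rw [e1, e2, e3, e4]
    have h1 := (poch_succ_left (b 0 + Complex.I * x) k).symm.trans (poch_succ (b 0 + Complex.I * x) k)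
    have h2 := (poch_succ_left (b 0 - Complex.I * x) k).symm.trans (poch_succ (b 0 - Complex.I * x) k)
    simp only [hB, poch_succ, Fin.prod_univ_four, Fin.sum_univ_four]
    generalize poch (b 0 + Complex.I * x) k = p at *
    generalize poch (b 0 - Complex.I * x) k = r at *
    generalize poch (b 0 + Complex.I * x + 1) k = p' at *
    generalize poch (b 0 - Complex.I * x + 1) k = r' at *
    have hx : (Complex.I * x) ^ 2 = -x ^ 2 := by
      rw [mul_pow, Complex.I_sq]; ring
    generalize hu : Complex.I * x = u at *
    rw [show Complex.I * -x = -u by rw [← hu]; ring, show Complex.I * (2 * x) = 2 * u by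
      rw [← hu]; ring]
    linear_combination wilsonCoeff n k a * (b 1 + u) * (b 2 + u) * (b 3 + u) * r * h1
      - wilsonCoeff n k a * (b 1 - u) * (b 2 - u) * (b 3 - u) * p * h2
  · simp only [wilsonCoeff, poch_zero, Nat.factorial_zero, Nat.cast_zero, add_zero, Nat.sub_zero,
      hab, poch_succ_left]
    have h3 : ∀ c d : ℂ, c + 1 / 2 + (d + 1 / 2) = c + d + 1 := by intros; ring
    simp only [h3]
    ring
  · have h0 : poch (-(n : ℂ)) (n + 1) = 0 := by rw [poch_succ]; simp
    simp [wilsonCoeff, h0]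
  · intro k hk
    simp only [wilsonCoeff, Nat.add_sub_add_right]
    have h1 : ∑ i, a i = (∑ i, b i) + 2 := by
      simp only [Fin.sum_univ_four, hab]; ring
    rw [h1, hab, hab, hab, hab]
    generalize ∑ i, b i = S
    have h3 : ∀ c d : ℂ, c + 1 / 2 + (d + 1 / 2) + k = c + d + ((k + 1 : ℕ) : ℂ) := by
      intros; push_cast; ring
    have h3' : ∀ c d : ℂ, c + 1 / 2 + (d + 1 / 2) + ((k + 1 : ℕ) : ℂ)
        = c + d + ((k + 1 : ℕ) : ℂ) + 1 := by
      intros; push_cast; ring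
    simp only [h3, h3']
    rw [poch_succ_left (-((n + 1 : ℕ) : ℂ)), poch_succ (-(n : ℂ)), poch_succ_left (_ + S - 1),
      poch_succ (n + (S + 2) - 1), Nat.factorial_succ,
      show -((n + 1 : ℕ) : ℂ) + 1 = -n by push_cast; ring,
      show ((n + 1 : ℕ) : ℂ) + S - 1 + 1 = n + (S + 2) - 1 by push_cast; ring]
    have h4 : ((k.factorial : ℕ) : ℂ) ≠ 0 := by exact_mod_cast k.factorial_ne_zero
    have h5 : (k : ℂ) + 1 ≠ 0 := by exact_mod_cast k.succ_ne_zero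
    rcases hk.lt_or_eq with hk | rfl
    · obtain ⟨l, hl⟩ : ∃ l, n - k = l + 1 := ⟨n - k - 1, by omega⟩
      rw [hl, show n - (k + 1) = l by omega, poch_succ_left, poch_succ_left, poch_succ_left]
      push_cast
      field_simp
      ring
    · simp only [Nat.sub_self, poch_zero]
      push_cast
      field_simp
      ring

end Wilson

/-! ### Shift relations of the Askey-Wilson polynomials. -/

section AskeyWilson

/-- The coefficients of the Askey-Wilson polynomial in the basis `(a₁z, a₁/z; q)_k`. -/
noncomputable def askeyWilsonCoeff (q : ℂ) (n k : ℕ) (a : Fin 4 → ℂ) : ℂ :=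
  (a 0 ^ n)⁻¹ * (qpoch (q ^ n)⁻¹ q k * qpoch ((∏ i, a i) * q ^ n / q) q k / qpoch q q k * q ^ k)
    * (qpoch (a 0 * a 1 * q ^ k) q (n - k) * qpoch (a 0 * a 2 * q ^ k) q (n - k)
      * qpoch (a 0 * a 3 * q ^ k) q (n - k))

theorem askeyWilsonPoly_eval (q : ℂ) (n : ℕ) (a : Fin 4 → ℂ) (z : ℂ) (hz : z ≠ 0) :
    (askeyWilsonPoly q n a).eval ((z + z⁻¹) / 2) = ∑ k ∈ Finset.range (n + 1),
      askeyWilsonCoeff q n k a * (qpoch (a 0 * z) q k * qpoch (a 0 / z) q k) := by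
  simp only [askeyWilsonPoly, Polynomial.eval_finsetSum, Polynomial.eval_mul, Polynomial.eval_C,
    Polynomial.eval_prod, Polynomial.eval_add, Polynomial.eval_sub, Polynomial.eval_one,
    Polynomial.eval_X, askeyWilsonCoeff]
  refine Finset.sum_congr rfl fun k _ => ?_
  congr 1
  simp only [qpoch]
  rw [← Finset.prod_mul_distrib]
  refine Finset.prod_congr rfl fun i _ => ?_
  field_simp
  ring

/-- The argument is that of the Wilson case in the variable z = e^{ix}; multiplication and division
of z by s = q^{1/2} are the two half steps. -/
theorem askeyWilsonPoly_forward {q s : ℂ} (hq0 : q ≠ 0) (hs : s ^ 2 = q)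
    (hq : ∀ k : ℕ, qpoch q q k ≠ 0) (n : ℕ) (a b : Fin 4 → ℂ) (hab : ∀ k, a k = b k * s)
    (hb0 : b 0 ≠ 0) (z : ℂ) (hz : z ≠ 0) :
    (askeyWilsonPoly q (n + 1) b).eval ((z * s + (z * s)⁻¹) / 2)
        - (askeyWilsonPoly q (n + 1) b).eval ((z / s + (z / s)⁻¹) / 2)
      = s ^ (n + 1) * (1 - (q ^ (n + 1))⁻¹) * (1 - (∏ i, b i) * q ^ n) * (z - z⁻¹)
        * (askeyWilsonPoly q n a).eval ((z + z⁻¹) / 2) := by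
  have hs0 : s ≠ 0 := by rintro rfl; exact hq0 (by simpa using hs.symm)
  rw [askeyWilsonPoly_eval _ _ _ _ (mul_ne_zero hz hs0),
    askeyWilsonPoly_eval _ _ _ _ (div_ne_zero hz hs0), askeyWilsonPoly_eval _ _ _ _ hz,
    ← Finset.sum_sub_distrib, Finset.sum_range_succ', Finset.mul_sum]
  simp only [qpoch_zero, mul_one, sub_self, add_zero]
  refine Finset.sum_congr rfl fun k hk => ?_
  have hA : ∏ i, a i = (∏ i, b i) * q ^ 2 := by
    simp only [Fin.prod_univ_four, hab, ← hs]; ring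
  have hc : askeyWilsonCoeff q (n + 1) (k + 1) b * (b 0 / s * (1 - q ^ (k + 1)))
      = s ^ (n + 1) * (1 - (q ^ (n + 1))⁻¹) * (1 - (∏ i, b i) * q ^ n)
        * askeyWilsonCoeff q n k a := by
    simp only [askeyWilsonCoeff, Nat.add_sub_add_right, hA]
    rw [qpoch_succ_left, qpoch_succ_left, qpoch_succ q]
    have h1 : (q ^ (n + 1))⁻¹ * q = (q ^ n)⁻¹ := by rw [pow_succ]; field_simp
    have h2 : (∏ i, b i) * q ^ (n + 1) / q = (∏ i, b i) * q ^ n := by rw [pow_succ]; field_simp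
    have h2' : (∏ i, b i) * q ^ 2 * q ^ n / q = (∏ i, b i) * q ^ n * q := by field_simp
    have h3 : ∀ i, a 0 * a i * q ^ k = b 0 * b i * q ^ (k + 1) := by
      intro i; rw [hab, hab, pow_succ, ← hs]; ring
    rw [h1, h2, h2', h3, h3, h3, hab]
    have h4 := hq k
    have h5 : 1 - q * q ^ k ≠ 0 := by
      have := hq (k + 1)
      rw [qpoch_succ] at this
      exact right_ne_zero_of_mul this
    rw [show 1 - q ^ (k + 1) = 1 - q * q ^ k by ring]
    generalize (1 : ℂ) - q * q ^ k = w at *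
    generalize 1 - (q ^ (n + 1))⁻¹ = w'
    rw [show q ^ (k + 1) = s ^ 2 * q ^ k by rw [hs]; ring]
    field_simp
    ring
  have hb : qpoch (b 0 * (z * s)) q (k + 1) * qpoch (b 0 / (z * s)) q (k + 1)
      - qpoch (b 0 * (z / s)) q (k + 1) * qpoch (b 0 / (z / s)) q (k + 1)
      = b 0 / s * (1 - q ^ (k + 1)) * (z - z⁻¹)
        * (qpoch (a 0 * z) q k * qpoch (a 0 / z) q k) := by
    have e1 : b 0 * (z * s) = a 0 * z := by rw [hab]; ring
    have e2 : b 0 / (z / s) = a 0 / z := by rw [hab]; field_simp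
    have e3 : b 0 / (z * s) * q = a 0 / z := by rw [hab, ← hs]; field_simp
    have e4 : b 0 * (z / s) * q = a 0 * z := by rw [hab, ← hs]; field_simp
    rw [e1, e2, qpoch_succ (a 0 * z), qpoch_succ (a 0 / z), qpoch_succ_left (b 0 / (z * s)),
      qpoch_succ_left (b 0 * (z / s)), e3, e4, hab]
    rw [show q ^ (k + 1) = s ^ 2 * q ^ k by rw [hs]; ring]
    field_simp
    ring
  rw [← mul_sub, hb]
  linear_combination (z - z⁻¹) * (qpoch (a 0 * z) q k * qpoch (a 0 / z) q k) * hc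

theorem askeyWilsonPoly_backward {q s : ℂ} (hq0 : q ≠ 0) (hs : s ^ 2 = q)
    (hq : ∀ k : ℕ, qpoch q q k ≠ 0) (n : ℕ) (a b : Fin 4 → ℂ) (hab : ∀ k, a k = b k * s)
    (hb0 : b 0 ≠ 0) (z : ℂ) (hz : z ≠ 0) :
    (z ^ 2)⁻¹ * (∏ k, (1 - b k * z)) * (askeyWilsonPoly q n a).eval ((z * s + (z * s)⁻¹) / 2)
        - z ^ 2 * (∏ k, (1 - b k / z)) * (askeyWilsonPoly q n a).eval ((z / s + (z / s)⁻¹) / 2)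
      = -(s ^ n)⁻¹ * (z - z⁻¹) * (askeyWilsonPoly q (n + 1) b).eval ((z + z⁻¹) / 2) := by
  have hs0 : s ≠ 0 := by rintro rfl; exact hq0 (by simpa using hs.symm)
  have hA : ∏ i, a i = (∏ i, b i) * q ^ 2 := by
    simp only [Fin.prod_univ_four, hab, ← hs]; ring
  set B : ℕ → ℂ := fun k => qpoch (b 0 * z) q k * qpoch (b 0 / z) q k with hB
  rw [askeyWilsonPoly_eval _ _ _ _ (mul_ne_zero hz hs0),
    askeyWilsonPoly_eval _ _ _ _ (div_ne_zero hz hs0), askeyWilsonPoly_eval _ _ _ _ hz]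
  have key := sum_range_eq_of_ladder (n := n)
    (fun k => -(s ^ n)⁻¹ * askeyWilsonCoeff q (n + 1) k b)
    (fun k => -askeyWilsonCoeff q n k a / (b 0 * q ^ k)
      * ((1 - b 0 * b 1 * q ^ k) * (1 - b 0 * b 2 * q ^ k) * (1 - b 0 * b 3 * q ^ k)))
    (fun k => -askeyWilsonCoeff q n k a / (b 0 * q ^ k) * (1 - (∏ i, b i) * q ^ k)) B ?_ ?_ ?_
  · have hsum : -(s ^ n)⁻¹ * (z - z⁻¹) * ∑ k ∈ Finset.range (n + 1 + 1), askeyWilsonCoeff q (n + 1) k b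
        * (qpoch (b 0 * z) q k * qpoch (b 0 / z) q k)
        = (z - z⁻¹) * ∑ k ∈ Finset.range (n + 2), -(s ^ n)⁻¹ * askeyWilsonCoeff q (n + 1) k b * B k := by
      rw [mul_comm (-(s ^ n)⁻¹), mul_assoc, Finset.mul_sum]
      congr 1
      exact Finset.sum_congr rfl fun k _ => by rw [hB]; ring
    rw [hsum, key, Finset.mul_sum, Finset.mul_sum, Finset.mul_sum, ← Finset.sum_sub_distrib]
    refine Finset.sum_congr rfl fun k _ => ?_
    have e1 : a 0 * (z * s) = b 0 * z * q := by rw [hab, ← hs]; ring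
    have e2 : a 0 / (z * s) = b 0 / z := by rw [hab]; field_simp
    have e3 : a 0 * (z / s) = b 0 * z := by rw [hab]; field_simp
    have e4 : a 0 / (z / s) = b 0 / z * q := by rw [hab, ← hs]; field_simp
    rw [e1, e2, e3, e4]
    have h1 := (qpoch_succ_left (b 0 * z) q k).symm.trans (qpoch_succ (b 0 * z) q k)
    have h2 := (qpoch_succ_left (b 0 / z) q k).symm.trans (qpoch_succ (b 0 / z) q k)
    simp only [hB, qpoch_succ, Fin.prod_univ_four]
    generalize qpoch (b 0 * z) q k = p at *
    generalize qpoch (b 0 / z) q k = r at *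
    generalize qpoch (b 0 * z * q) q k = p' at *
    generalize qpoch (b 0 / z * q) q k = r' at *
    have hqk : q ^ k ≠ 0 := pow_ne_zero _ hq0
    generalize q ^ k = Q at *
    generalize askeyWilsonCoeff q n k a = C
    have h3 : (z ^ 2)⁻¹ * ((1 - b 0 * z) * (1 - b 1 * z) * (1 - b 2 * z) * (1 - b 3 * z)) * (C * (p' * r))
        = (z ^ 2)⁻¹ * ((1 - b 1 * z) * (1 - b 2 * z) * (1 - b 3 * z))
          * (C * ((p * (1 - b 0 * z * Q)) * r)) := by
      rw [← h1]; ring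
    have h4 : z ^ 2 * ((1 - b 0 / z) * (1 - b 1 / z) * (1 - b 2 / z) * (1 - b 3 / z)) * (C * (p * r'))
        = z ^ 2 * ((1 - b 1 / z) * (1 - b 2 / z) * (1 - b 3 / z))
          * (C * (p * (r * (1 - b 0 / z * Q)))) := by
      rw [← h2]; ring
    rw [h3, h4]
    field_simp
    ring
  · simp only [askeyWilsonCoeff, qpoch_zero, pow_zero, mul_one, Nat.sub_zero, hab, qpoch_succ_left]
    have h3 : ∀ c d : ℂ, c * s * (d * s) = c * d * q := by intro c d; rw [← hs]; ring
    simp only [h3]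
    field_simp
    ring
  · have h0 : qpoch (q ^ n)⁻¹ q (n + 1) = 0 := by
      rw [qpoch_succ, inv_mul_cancel₀ (pow_ne_zero _ hq0)]; simp
    simp [askeyWilsonCoeff, h0]
  · intro k hk
    simp only [askeyWilsonCoeff, Nat.add_sub_add_right, hA]
    generalize ∏ i, b i = S
    have h3 : ∀ i, a 0 * a i * q ^ k = b 0 * b i * q ^ (k + 1) := by
      intro i; rw [hab, hab, pow_succ, ← hs]; ring
    have h3' : ∀ i, a 0 * a i * q ^ (k + 1) = b 0 * b i * q ^ (k + 1) * q := by
      intro i; rw [hab, hab, ← hs]; ring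
    have h2 : S * q ^ (n + 1) / q = S * q ^ n := by rw [pow_succ]; field_simp
    have h2' : S * q ^ 2 * q ^ n / q = S * q ^ n * q := by field_simp
    simp only [h3, h3', h2, h2']
    rw [qpoch_succ_left (q ^ (n + 1))⁻¹, qpoch_succ (q ^ n)⁻¹, qpoch_succ_left (S * q ^ n),
      qpoch_succ (S * q ^ n * q), qpoch_succ q,
      show (q ^ (n + 1))⁻¹ * q = (q ^ n)⁻¹ by rw [pow_succ]; field_simp, hab]
    have h4 := hq k
    have h5 : 1 - q * q ^ k ≠ 0 := by
      have := hq (k + 1)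
      rw [qpoch_succ] at this
      exact right_ne_zero_of_mul this
    have h5' : 1 - q ^ (k + 1) ≠ 0 := by rwa [pow_succ']
    rcases hk.lt_or_eq with hk | rfl
    · obtain ⟨l, hl⟩ : ∃ l, n - k = l + 1 := ⟨n - k - 1, by omega⟩
      rw [hl, show n - (k + 1) = l by omega, qpoch_succ_left, qpoch_succ_left, qpoch_succ_left]
      generalize hT : qpoch (q ^ n)⁻¹ q k = T
      rw [mul_pow]
      field_simp
      ring
    · simp only [Nat.sub_self, qpoch_zero, inv_mul_cancel₀ (pow_ne_zero k hq0), sub_self]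
      have hqk : q ^ k ≠ 0 := pow_ne_zero _ hq0
      rw [mul_pow, pow_succ q k]
      generalize qpoch (q ^ k)⁻¹ q k = T
      generalize qpoch (S * q ^ k * q) q k = U
      generalize qpoch q q k = V at *
      generalize q ^ k = Q at *
      -- The denominator 1 - q^{k+1} becomes the variable, so that it is a single symbol when
      -- fractions are cleared.
      obtain ⟨w, hw⟩ : ∃ w, w = 1 - q * Q := ⟨_, rfl⟩
      obtain rfl : Q = (1 - w) / q := by rw [hw]; field_simp; ring
      rw [← hw] at h5
      rw [show 1 - q * ((1 - w) / q) = w by field_simp; ring]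
      have h6 : 1 - w ≠ 0 := by
        rintro h; rw [h] at hqk; simp at hqk
      field_simp
      ring

end AskeyWilson

/-! ### Both families in one notation: shift relations, resonances, difference equation. -/

/-- The weight function: `∏ (a_k + ix)` for Wilson, and `∏ (a_k^{-1/2} e^{-ix/2} - a_k^{1/2} e^{ix/2})`
for Askey-Wilson. -/
noncomputable def wt : Family → (Fin 4 → ℂ) → ℂ → ℂ
  | .wilson, lam, x => ∏ k, (lam k + Complex.I * x)
  | .askeyWilson q _ _, lam, x => ∏ k, (Complex.exp (-((Real.log q * lam k + Complex.I * x) / 2))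
      - Complex.exp ((Real.log q * lam k + Complex.I * x) / 2))

/-- The factor of the forward shift relation. -/
noncomputable def fwd : Family → ℕ → (Fin 4 → ℂ) → ℂ
  | .wilson, n, lam => Complex.I * n * (n - 1 + ∑ k, lam k)
  | .askeyWilson q _ _, n, lam => Complex.I * Complex.exp (Real.log q / 2) ^ n * (1 - ((q : ℂ) ^ n)⁻¹)
      * (1 - (∏ k, (q : ℂ) ^ lam k) * (q : ℂ) ^ n / q)

/-- The factor of the backward shift relation. -/
noncomputable def bwd : Family → ℕ → (Fin 4 → ℂ) → ℂ
  | .wilson, _, _ => Complex.I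
  | .askeyWilson q _ _, n, lam => -(Complex.I * (Complex.exp (Real.log q / 2) ^ n)⁻¹
      * Complex.exp (-(Real.log q * (∑ k, lam k) / 2)))

/-- The resonance condition excluded by genericity. -/
def Resonant (F : Family) (lam : Fin 4 → ℂ) (m : ℤ) : Prop :=
  match F with
  | .wilson => ∑ k, param .wilson lam k = (m : ℂ)
  | .askeyWilson q h₀ h₁ => ∏ k, param (.askeyWilson q h₀ h₁) lam k = (q : ℂ) ^ m

theorem generic_iff (F : Family) (lam : Fin 4 → ℂ) (lo hi : ℤ) :
    Generic F lam lo hi ↔ ∀ m, lo ≤ m → m ≤ hi → ¬ Resonant F lam m := by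
  cases F <;> exact Iff.rfl

section ShiftRelations

variable (F : Family)

theorem exp_log_eq {q : ℝ} (h₀ : 0 < q) : Complex.exp (Real.log q) = q := by
  rw [← Complex.ofReal_exp, Real.exp_log h₀]

theorem cpow_eq_exp {q : ℝ} (h₀ : 0 < q) (c : ℂ) :
    (q : ℂ) ^ c = Complex.exp (Real.log q * c) := by
  rw [Complex.cpow_def_of_ne_zero (by exact_mod_cast h₀.ne'), Complex.ofReal_log h₀.le]

theorem zpow_eq_exp {q : ℝ} (h₀ : 0 < q) (m : ℤ) :
    (q : ℂ) ^ m = Complex.exp (Real.log q * m) := by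
  rw [mul_comm, Complex.exp_int_mul, exp_log_eq h₀]

theorem wt_shift (lam : Fin 4 → ℂ) (s : ℕ) (x : ℂ) :
    wt F (shift lam s) x = wt F lam (pt F x s) := by
  have hI := Complex.I_mul_I
  cases F with
  | wilson =>
    simp only [wt, shift, pt, gam]
    refine Finset.prod_congr rfl fun k _ => ?_
    push_cast
    linear_combination (-(s : ℂ) / 2) * hI
  | askeyWilson q h₀ h₁ =>
    simp only [wt, shift, pt, gam]
    refine Finset.prod_congr rfl fun k _ => ?_
    have : (Real.log q : ℂ) * (lam k - s / 2) + Complex.I * x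
        = Real.log q * lam k + Complex.I * (x + Complex.I * (((s : ℤ) : ℂ) / 2) * Real.log q) := by
      push_cast
      linear_combination (-(s : ℂ) / 2 * Real.log q) * hI
    rw [this]

/-- Each of the four factors only changes sign, thanks to the symmetric normalisation of `wt`.
Together with `wt_shift`, this makes the weights at shifted and twisted parameters translates or
reflections of one function. -/
theorem wt_twist (lam : Fin 4 → ℂ) (x : ℂ) : wt F (twist lam) x = wt F lam (pt F (-x) 2) := by
  have hI := Complex.I_mul_I
  cases F with
  | wilson =>
    simp only [wt, twist, pt, gam, Fin.prod_univ_four]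
    have : ∀ k, 1 - lam k + Complex.I * x
        = -(lam k + Complex.I * (-x + Complex.I * (((2 : ℤ) : ℂ) / 2) * ((1 : ℝ) : ℂ))) := by
      intro k
      push_cast
      linear_combination hI
    rw [this, this, this, this]
    ring
  | askeyWilson q h₀ h₁ =>
    simp only [wt, twist, pt, gam, Fin.prod_univ_four]
    have : ∀ k, (Real.log q : ℂ) * (1 - lam k) + Complex.I * x
        = -(Real.log q * lam k
          + Complex.I * (-x + Complex.I * (((2 : ℤ) : ℂ) / 2) * (Real.log q : ℂ))) := by
      intro k
      push_cast
      linear_combination (Real.log q : ℂ) * hI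
    have h2 : ∀ k, Complex.exp (-(((Real.log q : ℂ) * (1 - lam k) + Complex.I * x) / 2))
        - Complex.exp ((((Real.log q : ℂ) * (1 - lam k) + Complex.I * x) / 2))
        = -(Complex.exp (-((Real.log q * lam k
            + Complex.I * (-x + Complex.I * (((2 : ℤ) : ℂ) / 2) * (Real.log q : ℂ))) / 2))
          - Complex.exp (((Real.log q * lam k
            + Complex.I * (-x + Complex.I * (((2 : ℤ) : ℂ) / 2) * (Real.log q : ℂ))) / 2))) := by
      intro k
      rw [this, neg_sub, neg_div, neg_neg]
    rw [h2, h2, h2, h2]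
    ring

theorem differentiable_wt (lam : Fin 4 → ℂ) : Differentiable ℂ (wt F lam) := by
  cases F with
  | wilson => unfold wt; fun_prop
  | askeyWilson q h₀ h₁ => unfold wt; fun_prop

theorem qpoch_self_ne_zero {q : ℝ} (h₀ : 0 < q) (h₁ : q < 1) (k : ℕ) : qpoch (q : ℂ) q k ≠ 0 := by
  unfold qpoch
  refine Finset.prod_ne_zero_iff.2 fun i _ => ?_
  rw [← pow_succ', ← Complex.ofReal_pow, ← Complex.ofReal_one, ← Complex.ofReal_sub]
  have := pow_lt_one₀ h₀.le h₁ i.succ_ne_zero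
  exact_mod_cast (sub_pos.2 this).ne'

theorem cos_eq_exp (x : ℂ) : Complex.cos x
    = (Complex.exp (Complex.I * x) + (Complex.exp (Complex.I * x))⁻¹) / 2 := by
  rw [← Complex.exp_neg, Complex.cos, mul_comm, neg_mul, mul_comm x]

theorem two_sin_eq_exp (x : ℂ) : Complex.I * (2 * Complex.sin x)
    = Complex.exp (Complex.I * x) - (Complex.exp (Complex.I * x))⁻¹ := by
  rw [← Complex.exp_neg, Complex.sin, mul_comm x, neg_mul, mul_comm x]
  linear_combination (Complex.exp (-(Complex.I * x)) - Complex.exp (Complex.I * x)) * Complex.I_mul_I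

theorem exp_pt_askeyWilson {q : ℝ} (h₀ : 0 < q) (h₁ : q < 1) (x : ℂ) (h : ℤ) :
    Complex.exp (Complex.I * pt (.askeyWilson q h₀ h₁) x h)
      = Complex.exp (Complex.I * x) * Complex.exp (Real.log q / 2) ^ (-h) := by
  rw [← Complex.exp_int_mul, ← Complex.exp_add]
  congr 1
  simp only [pt, gam]
  push_cast
  linear_combination ((h : ℂ) / 2 * Real.log q) * Complex.I_mul_I

theorem PCheck_forward (n : ℕ) (lam : Fin 4 → ℂ) (x : ℂ) :
    PCheck F (n + 1) (shift lam 1) (pt F x (-1)) - PCheck F (n + 1) (shift lam 1) (pt F x 1)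
      = fwd F (n + 1) (shift lam 1) * phi F x * PCheck F n lam x := by
  cases F with
  | wilson =>
    have h := wilsonPoly_forward n lam (shift lam 1) (fun k => by simp [shift]) x
    have e1 : pt .wilson x (-1) = x - Complex.I / 2 := by simp [pt, gam]; ring
    have e2 : pt .wilson x 1 = x + Complex.I / 2 := by simp [pt, gam]; ring
    simp only [PCheck, eigenPoly, eta, phi, fwd, e1, e2]
    refine h.trans ?_
    push_cast
    simp only [add_sub_cancel_right]
    rfl
  | askeyWilson q h₀ h₁ =>
    have hq0 : (q : ℂ) ≠ 0 := by exact_mod_cast h₀.ne'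
    set s := Complex.exp (Real.log q / 2) with hs
    have hs2 : s ^ 2 = q := by
      rw [hs, ← Complex.exp_nat_mul, ← exp_log_eq h₀]; congr 1; push_cast; ring
    have hs0 : s ≠ 0 := Complex.exp_ne_zero _
    set z := Complex.exp (Complex.I * x) with hz
    have h := askeyWilsonPoly_forward hq0 hs2 (qpoch_self_ne_zero h₀ h₁) n
      (param (.askeyWilson q h₀ h₁) lam) (param (.askeyWilson q h₀ h₁) (shift lam 1))
      (fun k => by
        simp only [param, shift, cpow_eq_exp h₀, hs, ← Complex.exp_add]
        congr 1; push_cast; ring)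
      (by simp only [param, cpow_eq_exp h₀]; exact Complex.exp_ne_zero _) z (Complex.exp_ne_zero _)
    simp only [PCheck, eigenPoly, eta, phi, fwd, cos_eq_exp, exp_pt_askeyWilson h₀ h₁, ← hs, ← hz]
    have hA : (∏ k, (q : ℂ) ^ shift lam 1 k) * (q : ℂ) ^ (n + 1) / q
        = (∏ i, param (.askeyWilson q h₀ h₁) (shift lam 1) i) * (q : ℂ) ^ n := by
      rw [pow_succ]; simp only [param]; field_simp
    have hphi := two_sin_eq_exp x
    rw [← hz] at hphi
    rw [hA, neg_neg, zpow_one, zpow_neg_one, ← div_eq_mul_inv]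
    refine h.trans ?_
    rw [← hphi]
    ring

theorem wt_askeyWilson {q : ℝ} (h₀ : 0 < q) (h₁ : q < 1) (lam : Fin 4 → ℂ) (x : ℂ) :
    wt (.askeyWilson q h₀ h₁) lam x = Complex.exp (-(Real.log q * (∑ k, lam k) / 2))
      * ((Complex.exp (Complex.I * x) ^ 2)⁻¹
        * ∏ k, (1 - param (.askeyWilson q h₀ h₁) lam k * Complex.exp (Complex.I * x))) := by
  have h : ∀ k, Complex.exp (-((Real.log q * lam k + Complex.I * x) / 2))
        - Complex.exp ((Real.log q * lam k + Complex.I * x) / 2)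
      = Complex.exp (-(Real.log q * lam k / 2)) * Complex.exp (-(Complex.I * x) / 2)
        * (1 - param (.askeyWilson q h₀ h₁) lam k * Complex.exp (Complex.I * x)) := by
    intro k
    simp only [param, cpow_eq_exp h₀]
    rw [← Complex.exp_add, ← Complex.exp_add, mul_sub, ← Complex.exp_add, mul_one]
    congr 2 <;> ring
  simp only [wt]
  rw [Finset.prod_congr rfl fun k _ => h k, Finset.prod_mul_distrib, Finset.prod_mul_distrib,
    ← Complex.exp_sum, Finset.prod_const, Finset.card_univ, Fintype.card_fin,
    ← Complex.exp_nat_mul, ← Complex.exp_nat_mul, ← Complex.exp_neg, mul_assoc]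
  congr 2
  · rw [Finset.sum_neg_distrib, Finset.mul_sum, Finset.sum_div]
  · congr 1; push_cast; ring

theorem PCheck_backward (n : ℕ) (lam : Fin 4 → ℂ) (x : ℂ) :
    wt F (shift lam 1) x * PCheck F n lam (pt F x (-1))
        - wt F (shift lam 1) (-x) * PCheck F n lam (pt F x 1)
      = bwd F n (shift lam 1) * phi F x * PCheck F (n + 1) (shift lam 1) x := by
  cases F with
  | wilson =>
    have h := wilsonPoly_backward n lam (shift lam 1) (fun k => by simp [shift]) x
    have e1 : pt .wilson x (-1) = x - Complex.I / 2 := by simp [pt, gam]; ring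
    have e2 : pt .wilson x 1 = x + Complex.I / 2 := by simp [pt, gam]; ring
    simp only [PCheck, eigenPoly, eta, phi, bwd, wt, e1, e2]
    exact h
  | askeyWilson q h₀ h₁ =>
    have hq0 : (q : ℂ) ≠ 0 := by exact_mod_cast h₀.ne'
    set s := Complex.exp (Real.log q / 2) with hs
    have hs2 : s ^ 2 = q := by
      rw [hs, ← Complex.exp_nat_mul, ← exp_log_eq h₀]; congr 1; push_cast; ring
    have hs0 : s ≠ 0 := Complex.exp_ne_zero _
    set z := Complex.exp (Complex.I * x) with hz
    have h := askeyWilsonPoly_backward hq0 hs2 (qpoch_self_ne_zero h₀ h₁) n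
      (param (.askeyWilson q h₀ h₁) lam) (param (.askeyWilson q h₀ h₁) (shift lam 1))
      (fun k => by
        simp only [param, shift, cpow_eq_exp h₀, hs, ← Complex.exp_add]
        congr 1; push_cast; ring)
      (by simp only [param, cpow_eq_exp h₀]; exact Complex.exp_ne_zero _) z (Complex.exp_ne_zero _)
    have hneg : Complex.exp (Complex.I * -x) = z⁻¹ := by
      rw [mul_neg, Complex.exp_neg]
    simp only [PCheck, eigenPoly, eta, phi, bwd, cos_eq_exp, exp_pt_askeyWilson h₀ h₁, ← hs, ← hz,
      wt_askeyWilson, hneg]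
    have hphi := two_sin_eq_exp x
    rw [← hz] at hphi
    rw [neg_neg, zpow_one, zpow_neg_one, ← div_eq_mul_inv, inv_pow, inv_inv]
    simp only [← div_eq_mul_inv (param _ _ _)]
    rw [← hphi] at h
    generalize Complex.exp (-(Real.log q * (∑ k, shift lam 1 k) / 2)) = c
    linear_combination c * h

theorem PCheck_zero (lam : Fin 4 → ℂ) (x : ℂ) : PCheck F 0 lam x = 1 := by
  cases F <;> simp [PCheck, eigenPoly, wilsonPoly, askeyWilsonPoly]

theorem differentiable_PCheck (n : ℕ) (lam : Fin 4 → ℂ) : Differentiable ℂ (PCheck F n lam) :=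
  differentiable_eval_eta F _

theorem prod_param_shift {q : ℝ} (h₀ : 0 < q) (h₁ : q < 1) (lam : Fin 4 → ℂ) :
    ∏ k, param (.askeyWilson q h₀ h₁) lam k = Complex.exp (Real.log q * ∑ k, lam k) := by
  simp only [param, cpow_eq_exp h₀, ← Complex.exp_sum, Finset.mul_sum]

theorem sum_shift (lam : Fin 4 → ℂ) (s : ℕ) : ∑ k, shift lam s k = (∑ k, lam k) - 2 * s := by
  simp only [shift, Fin.sum_univ_four]; ring

theorem sum_twist (lam : Fin 4 → ℂ) : ∑ k, twist lam k = 4 - ∑ k, lam k := by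
  simp only [twist, Fin.sum_univ_four]; ring

theorem resonant_shift (lam : Fin 4 → ℂ) (s : ℕ) (m : ℤ) :
    Resonant F (shift lam s) m ↔ Resonant F lam (m + 2 * s) := by
  cases F with
  | wilson =>
    simp only [Resonant, param, sum_shift]
    push_cast
    exact sub_eq_iff_eq_add
  | askeyWilson q h₀ h₁ =>
    simp only [Resonant, prod_param_shift, sum_shift, zpow_eq_exp h₀]
    rw [show (Real.log q : ℂ) * ((m + 2 * s : ℤ) : ℂ) = Real.log q * m + Real.log q * (2 * s) by
      push_cast; ring, Complex.exp_add, mul_sub, Complex.exp_sub,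
      div_eq_iff (Complex.exp_ne_zero _)]

theorem resonant_twist (lam : Fin 4 → ℂ) (m : ℤ) :
    Resonant F (twist lam) m ↔ Resonant F lam (4 - m) := by
  cases F with
  | wilson =>
    simp only [Resonant, param, sum_twist]
    push_cast
    constructor <;> intro h <;> linear_combination -h
  | askeyWilson q h₀ h₁ =>
    simp only [Resonant, prod_param_shift, sum_twist, zpow_eq_exp h₀]
    rw [show (Real.log q : ℂ) * ((4 - m : ℤ) : ℂ) = Real.log q * 4 - Real.log q * m by
      push_cast; ring, mul_sub, Complex.exp_sub, Complex.exp_sub,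
      div_eq_iff (Complex.exp_ne_zero _), eq_div_iff (Complex.exp_ne_zero _), eq_comm,
      mul_comm]

theorem fwd_ne_zero {n : ℕ} (hn : n ≠ 0) {lam : Fin 4 → ℂ} (h : ¬ Resonant F lam (1 - n)) :
    fwd F n lam ≠ 0 := by
  cases F with
  | wilson =>
    refine mul_ne_zero (mul_ne_zero Complex.I_ne_zero (by exact_mod_cast hn)) fun h' => h ?_
    simp only [Resonant, param]
    push_cast
    linear_combination h'
  | askeyWilson q h₀ h₁ =>
    have hq0 : (q : ℂ) ≠ 0 := by exact_mod_cast h₀.ne'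
    refine mul_ne_zero (mul_ne_zero (mul_ne_zero Complex.I_ne_zero
      (pow_ne_zero _ (Complex.exp_ne_zero _))) ?_) ?_
    · have h1 := pow_lt_one₀ h₀.le h₁ hn
      intro h2
      rw [sub_eq_zero, eq_comm, inv_eq_one] at h2
      exact h1.ne (by exact_mod_cast h2)
    · intro h'
      apply h
      simp only [Resonant, param]
      rw [zpow_sub₀ hq0, zpow_one, zpow_natCast, eq_div_iff (pow_ne_zero _ hq0)]
      field_simp at h'
      linear_combination -h'

/-- The eigenvalue of the difference operator on `P_n`. -/
noncomputable def energy (n : ℕ) (lam : Fin 4 → ℂ) : ℂ :=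
  fwd F n lam * bwd F (n - 1) lam

/-- The parameters shifted up by `δ`. -/
noncomputable def raise (lam : Fin 4 → ℂ) : Fin 4 → ℂ := fun k => lam k + 1 / 2

@[simp] theorem shift_raise (lam : Fin 4 → ℂ) : shift (raise lam) 1 = lam := by
  funext k
  simp [shift, raise]

theorem fwd_zero (lam : Fin 4 → ℂ) : fwd F 0 lam = 0 := by
  cases F <;> simp [fwd]

/-- The forward shift followed by the backward shift, with the denominators φ cleared. -/
theorem PCheck_difference_eq (n : ℕ) (lam : Fin 4 → ℂ) (x : ℂ) :
    wt F lam x * phi F (pt F x 1) * (PCheck F n lam (pt F x (-2)) - PCheck F n lam x)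
        + wt F lam (-x) * phi F (pt F x (-1)) * (PCheck F n lam (pt F x 2) - PCheck F n lam x)
      = energy F n lam * phi F x * phi F (pt F x 1) * phi F (pt F x (-1)) * PCheck F n lam x := by
  cases n with
  -- At `n = 0` the truncated index `n - 1` in `energy` is harmless, because the forward factor
  -- vanishes.
  | zero => simp [PCheck_zero, energy, fwd_zero]
  | succ n =>
    have h1 := PCheck_forward F n (raise lam) (pt F x (-1))
    have h2 := PCheck_forward F n (raise lam) (pt F x 1)
    have h3 := PCheck_backward F n (raise lam) x
    simp only [shift_raise, pt_pt] at h1 h2 h3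
    norm_num at h1 h2
    simp only [energy, Nat.add_sub_cancel]
    linear_combination wt F lam x * phi F (pt F x 1) * h1 - wt F lam (-x) * phi F (pt F x (-1)) * h2
      + fwd F (n + 1) lam * phi F (pt F x 1) * phi F (pt F x (-1)) * h3

/-- Up to nonzero factors the difference of eigenvalues is k - l, respectively q^k - q^l, times a
factor that depends on k + l only and vanishes exactly at the excluded resonance. -/
theorem energy_ne {k l : ℕ} (hkl : k ≠ l) {lam : Fin 4 → ℂ}
    (h : ¬ Resonant F lam (1 - k - l)) : energy F k lam ≠ energy F l lam := by
  cases F with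
  | wilson =>
    intro h'
    simp only [energy, fwd, bwd] at h'
    have h1 : ((k : ℂ) - l) * ((∑ i, lam i) - (1 - k - l)) = 0 := by
      linear_combination -h' + ((k : ℂ) * (k - 1 + ∑ i, lam i) - l * (l - 1 + ∑ i, lam i))
        * Complex.I_mul_I
    rcases mul_eq_zero.1 h1 with h2 | h2
    · exact hkl (by exact_mod_cast sub_eq_zero.1 h2)
    · refine h ?_
      simp only [Resonant, param]
      push_cast
      exact sub_eq_zero.1 h2
  | askeyWilson q h₀ h₁ =>
    have hq0 : (q : ℂ) ≠ 0 := by exact_mod_cast h₀.ne'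
    intro h'
    set s := Complex.exp (Real.log q / 2) with hs
    have hs0 : s ≠ 0 := Complex.exp_ne_zero _
    set A := ∏ k, (q : ℂ) ^ lam k with hA
    set c := Complex.exp (-(Real.log q * (∑ k, lam k) / 2)) with hc
    have hc0 : c ≠ 0 := Complex.exp_ne_zero _
    have h3 : ∀ n, energy (.askeyWilson q h₀ h₁) n lam
        = c * s * ((1 - ((q : ℂ) ^ n)⁻¹) * (1 - A * (q : ℂ) ^ n / q)) := by
      intro n
      simp only [energy, fwd, bwd, ← hs, ← hA, ← hc]
      cases n with
      | zero => simp
      | succ n =>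
        have h5 : s ^ (n + 1) * (s ^ n)⁻¹ = s := by rw [pow_succ]; field_simp
        rw [Nat.add_sub_cancel]
        linear_combination (-Complex.I ^ 2 * c * ((1 - ((q : ℂ) ^ (n + 1))⁻¹)
          * (1 - A * (q : ℂ) ^ (n + 1) / q))) * h5
          - c * s * ((1 - ((q : ℂ) ^ (n + 1))⁻¹) * (1 - A * (q : ℂ) ^ (n + 1) / q)) * Complex.I_sq
    rw [h3, h3] at h'
    have h4 := mul_left_cancel₀ (mul_ne_zero hc0 hs0) h'
    have hk0 : (q : ℂ) ^ k ≠ 0 := pow_ne_zero _ hq0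
    have hl0 : (q : ℂ) ^ l ≠ 0 := pow_ne_zero _ hq0
    have h1 : ((q : ℂ) ^ k - (q : ℂ) ^ l) * (A * (q : ℂ) ^ k * (q : ℂ) ^ l - q) = 0 := by
      field_simp at h4
      linear_combination -h4
    rcases mul_eq_zero.1 h1 with h2 | h2
    · have h6 : q ^ k = q ^ l := by exact_mod_cast sub_eq_zero.1 h2
      exact hkl (pow_right_injective₀ h₀ h₁.ne h6)
    · refine h ?_
      simp only [Resonant, param]
      rw [← hA, zpow_sub₀ hq0, zpow_sub₀ hq0, zpow_one, zpow_natCast, zpow_natCast, div_div,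
        eq_div_iff (mul_ne_zero hk0 hl0)]
      linear_combination h2

end ShiftRelations

/-! ### The dual Cauchy kernel and its kernel function identity. -/

/-- The odd function whose products are the differences of `η`. -/
noncomputable def halfSine : Family → ℂ → ℂ
  | .wilson, u => u
  | .askeyWilson _ _ _, u => Complex.sin (u / 2)

/-- The constant in `η(x) - η(y) = c T(x + y) T(x - y)`. -/
noncomputable def etaConst : Family → ℂ
  | .wilson => 1
  | .askeyWilson _ _ _ => -2

/-- The product of `T` over `n` equidistant nodes centered at `u`. -/
noncomputable def halfSineProd (F : Family) (n : ℕ) (u : ℂ) : ℂ :=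
  ∏ j ∈ Finset.range n, halfSine F (pt F u (n - 1 - 2 * (j : ℤ)))

/-- The dual Cauchy kernel `∏ (η(x) - η(y_j))` over `N` equidistant nodes centered at `y`. -/
noncomputable def kern (F : Family) (N : ℕ) (x y : ℂ) : ℂ :=
  ∏ j ∈ Finset.range N, (eta F x - eta F (pt F y (N - 1 - 2 * (j : ℤ))))

section Kernel

variable (F : Family)

theorem eta_sub_eta (x y : ℂ) :
    eta F x - eta F y = etaConst F * (halfSine F (x + y) * halfSine F (x - y)) := by
  cases F with
  | wilson => simp only [eta, etaConst, halfSine]; ring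
  | askeyWilson q h₀ h₁ =>
    simp only [eta, etaConst, halfSine, Complex.cos_sub_cos]
    ring

theorem pt_add (x y : ℂ) (h : ℤ) : pt F x h + y = pt F (x + y) h := by
  simp only [pt]; ring

theorem add_pt (x y : ℂ) (h : ℤ) : x + pt F y h = pt F (x + y) h := by
  simp only [pt]; ring

theorem pt_sub (x y : ℂ) (h : ℤ) : pt F x h - y = pt F (x - y) h := by
  simp only [pt]; ring

theorem sub_pt (x y : ℂ) (h : ℤ) : x - pt F y h = pt F (x - y) (-h) := by
  simp only [pt]; push_cast; ring

/-- In the variables x + y and x - y the kernel separates into two equidistant products. A half step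
in x or in y therefore only adds or removes end factors, and the kernel behaves alike in both
arguments. -/
theorem kern_eq (N : ℕ) (x y : ℂ) :
    kern F N x y = etaConst F ^ N * (halfSineProd F N (x + y) * halfSineProd F N (x - y)) := by
  have h : halfSineProd F N (x - y)
      = ∏ j ∈ Finset.range N, halfSine F (pt F (x - y) (-(N - 1 - 2 * (j : ℤ)))) := by
    unfold halfSineProd
    rw [← Finset.prod_range_reflect]
    refine Finset.prod_congr rfl fun j hj => ?_
    have := Finset.mem_range.1 hj
    congr 2
    rw [Nat.cast_sub (by omega), Nat.cast_sub (by omega)]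
    push_cast
    ring
  rw [h]
  unfold kern halfSineProd
  simp_rw [eta_sub_eta, add_pt, sub_pt]
  rw [Finset.prod_mul_distrib, Finset.prod_const, Finset.card_range, Finset.prod_mul_distrib]

theorem halfSineProd_succ_top (n : ℕ) (u : ℂ) (c : ℤ) :
    halfSineProd F (n + 1) (pt F u c)
      = halfSine F (pt F u (c + n)) * halfSineProd F n (pt F u (c - 1)) := by
  unfold halfSineProd
  rw [Finset.prod_range_succ', mul_comm]
  simp only [pt_pt]
  congr 1
  · congr 2; push_cast; ring
  · refine Finset.prod_congr rfl fun j _ => ?_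
    congr 2; push_cast; ring

theorem halfSineProd_succ_bot (n : ℕ) (u : ℂ) (c : ℤ) :
    halfSineProd F (n + 1) (pt F u c)
      = halfSineProd F n (pt F u (c + 1)) * halfSine F (pt F u (c - n)) := by
  unfold halfSineProd
  rw [Finset.prod_range_succ]
  simp only [pt_pt]
  congr 1
  · refine Finset.prod_congr rfl fun j _ => ?_
    congr 2; push_cast; ring
  · congr 2; push_cast; ring

theorem halfSine_mul_left (x y : ℂ) (h : ℤ) :
    etaConst F * (halfSine F (pt F (x + y) h) * halfSine F (pt F (x - y) h))
      = eta F (pt F x h) - eta F y := by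
  rw [eta_sub_eta, pt_add, pt_sub]

theorem halfSine_mul_right (x y : ℂ) (h : ℤ) :
    etaConst F * (halfSine F (pt F (x + y) h) * halfSine F (pt F (x - y) (-h)))
      = eta F x - eta F (pt F y h) := by
  rw [eta_sub_eta, add_pt, sub_pt]

theorem kern_succ_left (n : ℕ) (x y : ℂ) :
    kern F (n + 1) (pt F x (-1)) y = kern F n x y * (eta F (pt F x (-(n + 1 : ℤ))) - eta F y)
      ∧ kern F (n + 1) (pt F x 1) y = kern F n x y * (eta F (pt F x (n + 1)) - eta F y) := by
  simp only [kern_eq, pt_add, pt_sub]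
  rw [halfSineProd_succ_bot, halfSineProd_succ_bot, halfSineProd_succ_top, halfSineProd_succ_top,
    ← halfSine_mul_left, ← halfSine_mul_left]
  norm_num
  rw [show (-1 : ℤ) - n = -1 + -n by ring, show (1 : ℤ) + n = n + 1 by ring]
  constructor <;> ring

theorem kern_succ_right (n : ℕ) (x y : ℂ) :
    kern F (n + 1) x (pt F y (-1)) = kern F n x y * (eta F x - eta F (pt F y (-(n + 1 : ℤ))))
      ∧ kern F (n + 1) x (pt F y 1) = kern F n x y * (eta F x - eta F (pt F y (n + 1))) := by
  simp only [kern_eq, add_pt, sub_pt]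
  rw [halfSineProd_succ_bot, halfSineProd_succ_top F n (x + y) 1, neg_neg,
    halfSineProd_succ_top F n (x - y) 1, halfSineProd_succ_bot F n (x - y) (-1),
    ← halfSine_mul_right, ← halfSine_mul_right]
  norm_num
  rw [show (-1 : ℤ) - n = -1 + -n by ring, show (1 : ℤ) + n = n + 1 by ring]
  constructor <;> ring

theorem kern_succ (n : ℕ) (x y : ℂ) :
    kern F (n + 2) x y = kern F n x y
      * ((eta F (pt F x (-(n + 1 : ℤ))) - eta F y) * (eta F (pt F x (n + 1)) - eta F y)) := by
  simp only [kern_eq]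
  have h : ∀ u, halfSineProd F (n + 2) u
      = halfSine F (pt F u (n + 1)) * (halfSineProd F n u * halfSine F (pt F u (-(n + 1 : ℤ)))) := by
    intro u
    have h1 := halfSineProd_succ_top F (n + 1) u 0
    have h2 := halfSineProd_succ_bot F n u (-1)
    simp only [pt_zero, zero_add, zero_sub, neg_add_cancel] at h1 h2
    rw [h1, h2, show (-1 : ℤ) - n = -(n + 1 : ℤ) by ring]
    push_cast
    ring
  rw [h, h, ← halfSine_mul_left, ← halfSine_mul_left]
  ring

/-- The constant of the kernel function identity. -/
noncomputable def kernConst (n : ℕ) (lam : Fin 4 → ℂ) : ℂ :=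
  match F with
  | .wilson => -Complex.I * ((∑ k, lam k) - (n + 4))
  | .askeyWilson q _ _ => 2 * Complex.I * Complex.exp (-(Real.log q * (∑ k, lam k) / 2))
      * ((∏ k, (q : ℂ) ^ lam k) / (Complex.exp (Real.log q / 2) ^ n * q ^ 2)
        - Complex.exp (Real.log q / 2) ^ n * q ^ 2)

/-- For n ≥ 1 this is `kern_identity` divided by `kern F (n - 1) x y`, since each kernel there
contains that factor and at most two more differences of η. What remains is a finite identity,
rational in X and Y, which is verified by expansion. -/
theorem kernel_interpolation (n : ℕ) (lam : Fin 4 → ℂ) (x y : ℂ) :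
    phi F y * (wt F (shift lam (n + 2)) x * (eta F (pt F x (-n)) - eta F y)
        - wt F (shift lam (n + 2)) (-x) * (eta F (pt F x n) - eta F y))
      + phi F x * (wt F (twist lam) y * (eta F x - eta F (pt F y (-n)))
        - wt F (twist lam) (-y) * (eta F x - eta F (pt F y n)))
      = kernConst F n lam * phi F x * phi F y
        * ((eta F (pt F x (-n)) - eta F y) * (eta F (pt F x n) - eta F y)) := by
  simp only [wt_shift, wt_twist, neg_neg]
  cases F with
  | wilson =>
    -- With X = ix and Y = iy the imaginary unit disappears from the weights and from η.
    obtain ⟨X, rfl⟩ : ∃ X, x = -Complex.I * X := ⟨Complex.I * x, by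
      linear_combination x * Complex.I_mul_I⟩
    obtain ⟨Y, rfl⟩ : ∃ Y, y = -Complex.I * Y := ⟨Complex.I * y, by
      linear_combination y * Complex.I_mul_I⟩
    have h1 : ∀ (X : ℂ) (h : ℤ), Complex.I * pt .wilson (-Complex.I * X) h = X - h / 2 := by
      intro X h
      simp only [pt, gam]
      push_cast
      linear_combination (-X + (h : ℂ) / 2) * Complex.I_mul_I
    have h1' : ∀ (X : ℂ) (h : ℤ), Complex.I * pt .wilson (-(-Complex.I * X)) h = -X - h / 2 := by
      intro X h
      rw [← h1]; congr 2; ring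
    have h2 : ∀ (X : ℂ) (h : ℤ), eta .wilson (pt .wilson (-Complex.I * X) h) = -(X - h / 2) ^ 2 := by
      intro X h
      rw [← h1, mul_pow, Complex.I_sq]
      simp [eta]
    have h3 : ∀ (X : ℂ), eta .wilson (-Complex.I * X) = -X ^ 2 := by
      intro X
      simp [eta, mul_pow]
    simp only [wt, kernConst, h1, h1', h2, h3, phi, Fin.prod_univ_four, Fin.sum_univ_four]
    push_cast
    linear_combination (4 * Complex.I * ((lam 0 + lam 1 + lam 2 + lam 3) - (n + 4)) * X * Y
      * ((-(X - -n / 2) ^ 2 - -Y ^ 2) * (-(X - n / 2) ^ 2 - -Y ^ 2))) * Complex.I_sq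
  | askeyWilson q h₀ h₁ =>
    have hq0 : (q : ℂ) ≠ 0 := by exact_mod_cast h₀.ne'
    set s := Complex.exp (Real.log q / 2) with hs
    have hs2 : s ^ 2 = q := by
      rw [hs, ← Complex.exp_nat_mul, ← exp_log_eq h₀]; congr 1; push_cast; ring
    have hs0 : s ≠ 0 := Complex.exp_ne_zero _
    have hneg : ∀ x, Complex.exp (Complex.I * -x) = (Complex.exp (Complex.I * x))⁻¹ := by
      intro x
      rw [mul_neg, Complex.exp_neg]
    have hphi : ∀ x, 2 * Complex.sin x = -Complex.I * (Complex.exp (Complex.I * x)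
        - (Complex.exp (Complex.I * x))⁻¹) := by
      intro x
      rw [← two_sin_eq_exp]
      linear_combination (2 * Complex.sin x) * Complex.I_mul_I
    simp only [wt_askeyWilson, kernConst, eta, phi, cos_eq_exp, exp_pt_askeyWilson, hneg, hphi, ← hs]
    have hX0 := Complex.exp_ne_zero (Complex.I * x)
    have hY0 := Complex.exp_ne_zero (Complex.I * y)
    generalize Complex.exp (Complex.I * x) = X at *
    generalize Complex.exp (Complex.I * y) = Y at *
    generalize Complex.exp (-(Real.log q * (∑ k, lam k) / 2)) = c
    simp only [Fin.prod_univ_four, param]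
    generalize (q : ℂ) ^ lam 0 = a0
    generalize (q : ℂ) ^ lam 1 = a1
    generalize (q : ℂ) ^ lam 2 = a2
    generalize (q : ℂ) ^ lam 3 = a3
    have e1 : s ^ (-((n + 2 : ℕ) : ℤ)) = (s ^ n * q)⁻¹ := by
      rw [zpow_neg, zpow_natCast, pow_add, hs2]
    have e2 : s ^ (-(-(n : ℤ))) = s ^ n := by rw [neg_neg, zpow_natCast]
    have e3 : s ^ (-(n : ℤ)) = (s ^ n)⁻¹ := by rw [zpow_neg, zpow_natCast]
    have e4 : s ^ (-(2 : ℤ)) = (q : ℂ)⁻¹ := by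
      rw [zpow_neg, ← hs2]; norm_cast
    rw [e1, e2, e3, e4]
    have hH0 : s ^ n ≠ 0 := pow_ne_zero _ hs0
    generalize s ^ n = H at *
    generalize (q : ℂ) = p at *
    have key : (Y - Y⁻¹) * (((X * (H * p)⁻¹) ^ 2)⁻¹ * ((1 - a0 * (X * (H * p)⁻¹)) * (1 - a1 * (X * (H * p)⁻¹))
          * (1 - a2 * (X * (H * p)⁻¹)) * (1 - a3 * (X * (H * p)⁻¹)))
          * ((X * H + (X * H)⁻¹) / 2 - (Y + Y⁻¹) / 2)
        - ((X⁻¹ * (H * p)⁻¹) ^ 2)⁻¹ * ((1 - a0 * (X⁻¹ * (H * p)⁻¹)) * (1 - a1 * (X⁻¹ * (H * p)⁻¹))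
          * (1 - a2 * (X⁻¹ * (H * p)⁻¹)) * (1 - a3 * (X⁻¹ * (H * p)⁻¹)))
          * ((X * H⁻¹ + (X * H⁻¹)⁻¹) / 2 - (Y + Y⁻¹) / 2))
      + (X - X⁻¹) * (((Y⁻¹ * p⁻¹) ^ 2)⁻¹ * ((1 - a0 * (Y⁻¹ * p⁻¹)) * (1 - a1 * (Y⁻¹ * p⁻¹))
          * (1 - a2 * (Y⁻¹ * p⁻¹)) * (1 - a3 * (Y⁻¹ * p⁻¹)))
          * ((X + X⁻¹) / 2 - (Y * H + (Y * H)⁻¹) / 2)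
        - ((Y * p⁻¹) ^ 2)⁻¹ * ((1 - a0 * (Y * p⁻¹)) * (1 - a1 * (Y * p⁻¹))
          * (1 - a2 * (Y * p⁻¹)) * (1 - a3 * (Y * p⁻¹)))
          * ((X + X⁻¹) / 2 - (Y * H⁻¹ + (Y * H⁻¹)⁻¹) / 2))
      = 2 * (a0 * a1 * a2 * a3 / (H * p ^ 2) - H * p ^ 2) * (X - X⁻¹) * (Y - Y⁻¹)
        * (((X * H + (X * H)⁻¹) / 2 - (Y + Y⁻¹) / 2) * ((X * H⁻¹ + (X * H⁻¹)⁻¹) / 2 - (Y + Y⁻¹) / 2)) := by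
      field_simp
      ring
    linear_combination (-Complex.I * c) * key
      - 2 * Complex.I * c * (a0 * a1 * a2 * a3 / (H * p ^ 2) - H * p ^ 2) * (X - X⁻¹) * (Y - Y⁻¹)
        * (((X * H + (X * H)⁻¹) / 2 - (Y + Y⁻¹) / 2) * ((X * H⁻¹ + (X * H⁻¹)⁻¹) / 2 - (Y + Y⁻¹) / 2))
        * Complex.I_sq

end Kernel

/-! ### Expansion of the kernel in products of eigenpolynomials. -/

section KernelExpansion

variable (F : Family)

theorem kernConst_ne_zero {n : ℕ} {lam : Fin 4 → ℂ} (h : ¬ Resonant F lam (n + 4)) :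
    kernConst F n lam ≠ 0 := by
  cases F with
  | wilson =>
    refine mul_ne_zero (neg_ne_zero.2 Complex.I_ne_zero) fun h' => h ?_
    simp only [Resonant, param]
    push_cast
    exact sub_eq_zero.1 h'
  | askeyWilson q h₀ h₁ =>
    have hq0 : (q : ℂ) ≠ 0 := by exact_mod_cast h₀.ne'
    refine mul_ne_zero (mul_ne_zero (mul_ne_zero two_ne_zero Complex.I_ne_zero)
      (Complex.exp_ne_zero _)) fun h' => h ?_
    have hs0 : Complex.exp (Real.log q / 2) ^ n ≠ 0 := pow_ne_zero _ (Complex.exp_ne_zero _)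
    have hs2 : (Complex.exp (Real.log q / 2) ^ n) ^ 2 = (q : ℂ) ^ n := by
      rw [← exp_log_eq h₀, ← Complex.exp_nat_mul, ← Complex.exp_nat_mul, ← Complex.exp_nat_mul]
      congr 1; push_cast; ring
    rw [sub_eq_zero, div_eq_iff (mul_ne_zero hs0 (pow_ne_zero _ hq0))] at h'
    simp only [Resonant, param]
    rw [h', show ((n : ℤ) + 4) = ((n + 4 : ℕ) : ℤ) by push_cast; ring, zpow_natCast, pow_add, ← hs2]
    ring

/-- The two brackets are the operators of the backward shift in x and in y, each acting on the
kernel with n nodes. This is the step n → n + 1 of the expansion. -/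
theorem kern_identity (n : ℕ) (lam : Fin 4 → ℂ) (x y : ℂ) :
    phi F y * (wt F (shift lam (n + 2)) x * kern F n (pt F x (-1)) y
        - wt F (shift lam (n + 2)) (-x) * kern F n (pt F x 1) y)
      + phi F x * (wt F (twist lam) y * kern F n x (pt F y (-1))
        - wt F (twist lam) (-y) * kern F n x (pt F y 1))
      = kernConst F n lam * phi F x * phi F y * kern F (n + 1) x y := by
  have h := kernel_interpolation F n lam
  cases n with
  | succ n =>
    obtain ⟨e1, e2⟩ := kern_succ_left F n x y
    obtain ⟨e3, e4⟩ := kern_succ_right F n x y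
    rw [e1, e2, e3, e4, kern_succ]
    have := h x y
    push_cast at this
    linear_combination kern F n x y * this
  | zero =>
    have h1 : ∀ x y, kern F 0 x y = 1 := by intros; simp [kern]
    have h2 : ∀ x y, kern F 1 x y = eta F x - eta F y := by intros; simp [kern]
    simp only [h1, zero_add, h2, mul_one]
    refine sub_eq_zero.1 (eq_zero_of_mul_eq_zero (g := fun x => eta F x - eta F y)
      (f := fun x => (phi F y * (wt F (shift lam 2) x - wt F (shift lam 2) (-x))
        + phi F x * (wt F (twist lam) y - wt F (twist lam) (-y)))
        - kernConst F 0 lam * phi F x * phi F y * (eta F x - eta F y)) ?_ ((differentiable_eta F).sub_const _) (fun x => ?_) ?_ x)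
    · have d1 := differentiable_wt F (shift lam 2)
      have d2 : Differentiable ℂ fun x => wt F (shift lam 2) (-x) := d1.comp differentiable_neg
      have d3 := differentiable_phi F
      have d4 := differentiable_eta F
      fun_prop
    · have := h x y
      simp only [Nat.cast_zero, neg_zero, pt_zero] at this
      linear_combination this
    · by_contra! hc
      obtain ⟨z, hz⟩ := exists_phi_ne_zero F
      have := eta_pt_sub_eta_pt F z 0 1
      rw [sub_eq_zero.1 (hc (pt F z (0 + 1))), sub_eq_zero.1 (hc (pt F z (0 - 1))), sub_self,
        pt_zero] at this
      exact mul_ne_zero (etaBracket_ne_zero F one_ne_zero) hz this.symm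

theorem kern_forward_left (n : ℕ) (x y : ℂ) :
    kern F (n + 1) (pt F x (-1)) y - kern F (n + 1) (pt F x 1) y
      = -etaBracket F (n + 1) * phi F x * kern F n x y := by
  obtain ⟨e1, e2⟩ := kern_succ_left F n x y
  have := eta_pt_sub_eta_pt F x 0 (n + 1)
  rw [zero_add, zero_sub, pt_zero] at this
  rw [e1, e2]
  linear_combination -kern F n x y * this

theorem kern_forward_right (n : ℕ) (x y : ℂ) :
    kern F (n + 1) x (pt F y (-1)) - kern F (n + 1) x (pt F y 1)
      = etaBracket F (n + 1) * phi F y * kern F n x y := by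
  obtain ⟨e1, e2⟩ := kern_succ_right F n x y
  have := eta_pt_sub_eta_pt F y 0 (n + 1)
  rw [zero_add, zero_sub, pt_zero] at this
  rw [e1, e2]
  linear_combination kern F n x y * this

theorem resonant_raise (lam : Fin 4 → ℂ) (m : ℤ) :
    Resonant F (raise lam) m ↔ Resonant F lam (m - 2) := by
  have := resonant_shift F (raise lam) 1 (m - 2)
  rw [shift_raise] at this
  rw [this]
  norm_num

/-- The forward shift kills P_0 and lowers every other index by one, with factors that are nonzero
off the resonances; this gives the induction. -/
theorem PCheck_independent (n : ℕ) (lam : Fin 4 → ℂ)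
    (hlam : ∀ m : ℤ, 2 - 2 * n ≤ m → m ≤ 0 → ¬ Resonant F lam m) (a : ℕ → ℂ)
    (h : ∀ x, ∑ k ∈ Finset.range (n + 1), a k * PCheck F k lam x = 0) : ∀ k ≤ n, a k = 0 := by
  induction n generalizing lam a with
  | zero =>
    intro k hk
    obtain rfl : k = 0 := by omega
    simpa [PCheck_zero] using h 0
  | succ n ih =>
    have h1 : ∀ x, ∑ k ∈ Finset.range (n + 1),
        (a (k + 1) * fwd F (k + 1) lam) * PCheck F k (raise lam) x = 0 := by
      refine eq_zero_of_mul_eq_zero (Differentiable.fun_sum fun k _ =>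
        (differentiable_PCheck F k _).const_mul _) (differentiable_phi F) (fun x => ?_)
        (exists_phi_ne_zero F)
      have h2 := h (pt F x (-1))
      have h3 := h (pt F x 1)
      rw [Finset.sum_range_succ'] at h2 h3
      simp only [PCheck_zero] at h2 h3
      rw [Finset.sum_mul]
      refine Eq.trans ?_ ((congrArg₂ (· - ·) h2 h3).trans (sub_zero 0))
      rw [add_sub_add_right_eq_sub, ← Finset.sum_sub_distrib]
      refine Finset.sum_congr rfl fun k _ => ?_
      have := PCheck_forward F k (raise lam) x
      rw [shift_raise] at this
      linear_combination -a (k + 1) * this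
    have h4 := ih (raise lam) (fun m hm1 hm2 => by
      rw [resonant_raise]
      exact hlam _ (by push_cast; omega) (by omega)) _ h1
    have h5 : ∀ k ≤ n, a (k + 1) = 0 := by
      intro k hk
      refine (mul_eq_zero.1 (h4 k hk)).resolve_right (fwd_ne_zero F k.succ_ne_zero
        (hlam _ ?_ ?_)) <;> push_cast <;> omega
    have h6 : a 0 = 0 := by
      have := h 0
      rw [Finset.sum_range_succ', Finset.sum_eq_zero fun k hk => by
        rw [h5 k (by simpa [Nat.lt_succ_iff] using hk), zero_mul]] at this
      simpa [PCheck_zero] using this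
    intro k hk
    cases k with
    | zero => exact h6
    | succ k => exact h5 k (by omega)

theorem exists_PCheck_ne_zero (n : ℕ) (lam : Fin 4 → ℂ)
    (hlam : ∀ m : ℤ, 2 - 2 * n ≤ m → m ≤ 0 → ¬ Resonant F lam m) : ∃ x, PCheck F n lam x ≠ 0 := by
  by_contra! hc
  have := PCheck_independent F n lam hlam (fun k => if k = n then 1 else 0) (fun x => by
    simp [hc]) n le_rfl
  simp at this

theorem shift_shift (lam : Fin 4 → ℂ) (s t : ℕ) : shift (shift lam s) t = shift lam (s + t) := by
  funext k
  simp only [shift]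
  push_cast
  ring

theorem shift_twist_shift (lam : Fin 4 → ℂ) : shift (twist (shift lam 1)) 1 = twist lam := by
  funext k
  simp only [shift, twist]
  push_cast
  ring

/-- The dual Cauchy identity for the kernel. -/
theorem kern_expansion (N : ℕ) (lam : Fin 4 → ℂ)
    (hlam : ∀ m : ℤ, 4 ≤ m → m ≤ 2 * N + 2 → ¬ Resonant F lam m) :
    ∃ c : ℕ → ℂ, (∀ k ≤ N, c k ≠ 0) ∧ ∀ x y, kern F N x y = ∑ k ∈ Finset.range (N + 1),
      c k * PCheck F k (shift lam (N + 1)) x * PCheck F (N - k) (twist lam) y := by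
  induction N generalizing lam with
  | zero => exact ⟨fun _ => 1, fun _ _ => one_ne_zero, fun x y => by simp [kern, PCheck_zero]⟩
  | succ n ih =>
    -- The kernel with n nodes is expanded twice. With λ the y-parameters are already right and the
    -- backward shift in x corrects the x-parameters; with λ - δ the roles of x and y are exchanged.
    obtain ⟨d, hd0, hd⟩ := ih lam fun m h1 h2 => hlam m h1 (by push_cast; omega)
    obtain ⟨d', hd'0, hd'⟩ := ih (shift lam 1) fun m h1 h2 => by
      rw [resonant_shift]
      exact hlam _ (by push_cast; omega) (by push_cast; omega)
    rw [shift_shift, show 1 + (n + 1) = n + 2 by ring] at hd'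
    set lb := shift lam (n + 2) with hlb
    have hlb1 : shift (shift lam (n + 1)) 1 = lb := shift_shift lam _ _
    set tw := twist lam with htw
    set tw' := twist (shift lam 1) with htw'
    have htw1 : shift tw' 1 = tw := shift_twist_shift lam
    have hc : kernConst F n lam ≠ 0 := kernConst_ne_zero F (hlam _ (by omega) (by push_cast; omega))
    set c := kernConst F n lam with hcdef
    -- The backward shift in x yields no term with k = 0, the one in y no term with k = n + 1.
    set C : ℕ → ℂ := fun k => c⁻¹ * ((if k = 0 then 0 else d (k - 1) * bwd F (k - 1) lb)
      + (if k ≤ n then d' k * bwd F (n - k) tw else 0)) with hC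
    have hexp : ∀ x y, kern F (n + 1) x y = ∑ k ∈ Finset.range (n + 2),
        C k * PCheck F k lb x * PCheck F (n + 1 - k) tw y := by
      have hx : ∀ x y, wt F lb x * kern F n (pt F x (-1)) y - wt F lb (-x) * kern F n (pt F x 1) y
          = phi F x * ∑ k ∈ Finset.range (n + 1),
            d k * bwd F k lb * PCheck F (k + 1) lb x * PCheck F (n - k) tw y := by
        intro x y
        rw [hd, hd, Finset.mul_sum, Finset.mul_sum, Finset.mul_sum, ← Finset.sum_sub_distrib]
        refine Finset.sum_congr rfl fun k _ => ?_
        have := PCheck_backward F k (shift lam (n + 1)) x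
        rw [hlb1] at this
        linear_combination d k * PCheck F (n - k) tw y * this
      have hy : ∀ x y, wt F tw y * kern F n x (pt F y (-1)) - wt F tw (-y) * kern F n x (pt F y 1)
          = phi F y * ∑ k ∈ Finset.range (n + 1),
            d' k * bwd F (n - k) tw * PCheck F k lb x * PCheck F (n + 1 - k) tw y := by
        intro x y
        rw [hd', hd', Finset.mul_sum, Finset.mul_sum, Finset.mul_sum, ← Finset.sum_sub_distrib]
        refine Finset.sum_congr rfl fun k hk => ?_
        have := PCheck_backward F (n - k) tw' y
        rw [htw1, show n - k + 1 = n + 1 - k by have := Finset.mem_range.1 hk; omega] at this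
        linear_combination d' k * PCheck F k lb x * this
      have hsum : ∀ x y, ∑ k ∈ Finset.range (n + 2), C k * PCheck F k lb x * PCheck F (n + 1 - k) tw y
          = c⁻¹ * (∑ k ∈ Finset.range (n + 1),
              d k * bwd F k lb * PCheck F (k + 1) lb x * PCheck F (n - k) tw y
            + ∑ k ∈ Finset.range (n + 1),
              d' k * bwd F (n - k) tw * PCheck F k lb x * PCheck F (n + 1 - k) tw y) := by
        intro x y
        simp only [hC, mul_add, add_mul, Finset.sum_add_distrib]
        congr 1
        · rw [Finset.sum_range_succ', Finset.mul_sum]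
          simp only [if_true, mul_zero, zero_mul, add_zero, Nat.succ_ne_zero, if_false,
            Nat.add_sub_cancel, Nat.add_sub_add_right]
          refine Finset.sum_congr rfl fun k _ => ?_
          ring
        · rw [Finset.sum_range_succ, Finset.mul_sum]
          rw [if_neg (by omega)]
          simp only [mul_zero, zero_mul, add_zero]
          refine Finset.sum_congr rfl fun k hk => ?_
          rw [if_pos (by have := Finset.mem_range.1 hk; omega)]
          ring
      intro x y
      have hphi : ∀ x y, (phi F x * phi F y) * (kern F (n + 1) x y - ∑ k ∈ Finset.range (n + 2),
        C k * PCheck F k lb x * PCheck F (n + 1 - k) tw y) = 0 := by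
        intro x y
        have := kern_identity F n lam x y
        rw [← hlb, ← htw, hx, hy] at this
        rw [hsum]
        field_simp
        linear_combination -this
      have hk1 : ∀ y, Differentiable ℂ fun x => kern F (n + 1) x y := fun y =>
        Differentiable.fun_finsetProd fun j _ => (differentiable_eta F).sub_const _
      have hk2 : ∀ x, Differentiable ℂ fun y => kern F (n + 1) x y := fun x =>
        Differentiable.fun_finsetProd fun j _ =>
          ((differentiable_eta F).comp (differentiable_pt F _)).const_sub _
      have hy1 : ∀ x y, phi F x * (kern F (n + 1) x y - ∑ k ∈ Finset.range (n + 2),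
        C k * PCheck F k lb x * PCheck F (n + 1 - k) tw y) = 0 := by
        intro x
        refine eq_zero_of_mul_eq_zero (((hk2 x).sub (Differentiable.fun_sum fun k _ =>
          (differentiable_PCheck F _ _).const_mul _)).const_mul _) (differentiable_phi F)
          (fun y => ?_) (exists_phi_ne_zero F)
        linear_combination hphi x y
      refine sub_eq_zero.1 (eq_zero_of_mul_eq_zero (f := fun x => kern F (n + 1) x y
        - ∑ k ∈ Finset.range (n + 2), C k * PCheck F k lb x * PCheck F (n + 1 - k) tw y)
        ((hk1 y).sub (Differentiable.fun_sum fun k _ =>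
          ((differentiable_PCheck F _ _).const_mul _).mul_const _)) (differentiable_phi F)
          (fun x => ?_) (exists_phi_ne_zero F) x)
      linear_combination hy1 x y
    have hbr : etaBracket F (n + 1) ≠ 0 := etaBracket_ne_zero F (by omega)
    refine ⟨C, ?_, hexp⟩
    -- The formula for `C` is a sum in which cancellation could occur. Nonvanishing is seen instead
    -- from the forward shift in x, which sends the kernel with n + 1 nodes to a nonzero multiple of
    -- the one with n; comparison of the coefficients of P_k ties `C (k + 1)` to `d k`.
    have hsucc : ∀ k ≤ n, C (k + 1) ≠ 0 := by
      intro k hk hCk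
      obtain ⟨y, hy⟩ := exists_PCheck_ne_zero F (n - k) tw fun m h1 h2 => by
        rw [resonant_twist]
        refine hlam _ (by omega) ?_
        push_cast [Nat.cast_sub hk] at h1 ⊢
        omega
      have hx : ∀ x, ∑ k ∈ Finset.range (n + 1), ((C (k + 1) * fwd F (k + 1) lb
          + etaBracket F (n + 1) * d k) * PCheck F (n - k) tw y)
          * PCheck F k (shift lam (n + 1)) x = 0 := by
        refine eq_zero_of_mul_eq_zero (Differentiable.fun_sum fun k _ =>
          (differentiable_PCheck F _ _).const_mul _) (differentiable_phi F) (fun x => ?_)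
          (exists_phi_ne_zero F)
        have h1 := kern_forward_left F n x y
        rw [hexp, hexp, hd, Finset.sum_range_succ', Finset.sum_range_succ' (n := n + 1)] at h1
        simp only [PCheck_zero, Nat.add_sub_add_right] at h1
        rw [add_sub_add_right_eq_sub, ← Finset.sum_sub_distrib, Finset.mul_sum, ← sub_eq_zero,
          ← Finset.sum_sub_distrib] at h1
        rw [Finset.sum_mul, ← h1]
        refine Finset.sum_congr rfl fun k _ => ?_
        have := PCheck_forward F k (shift lam (n + 1)) x
        rw [hlb1] at this
        linear_combination -(C (k + 1) * PCheck F (n - k) tw y) * this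
      have h2 := PCheck_independent F n (shift lam (n + 1)) (fun m h1 h2 => by
        rw [resonant_shift]
        refine hlam _ ?_ ?_ <;> push_cast <;> omega) _ hx k hk
      rw [hCk, zero_mul, zero_add] at h2
      exact mul_ne_zero (mul_ne_zero hbr (hd0 k hk)) hy h2
    intro k hk
    cases k with
    | succ k => exact hsucc k (by omega)
    | zero =>
      -- The forward shift in x loses `C 0`; the forward shift in y retains it and ties it to `d'
      -- 0`.
      intro hC0
      obtain ⟨y, hy⟩ := exists_mul_ne_zero (differentiable_phi F) (differentiable_PCheck F n tw')
        (exists_phi_ne_zero F) (exists_PCheck_ne_zero F n tw' fun m h1 h2 => by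
          rw [htw', resonant_twist, resonant_shift]
          refine hlam _ ?_ ?_ <;> push_cast <;> omega)
      have hx : ∀ x, ∑ k ∈ Finset.range (n + 1 + 1), (if k ≤ n then (C k * fwd F (n + 1 - k) tw
          - etaBracket F (n + 1) * d' k) * (phi F y * PCheck F (n - k) tw' y) else 0)
          * PCheck F k lb x = 0 := by
        intro x
        have h1 := kern_forward_right F n x y
        rw [hexp, hexp, hd', Finset.sum_range_succ, Finset.sum_range_succ (n := n + 1)] at h1
        simp only [PCheck_zero, Nat.sub_self] at h1
        rw [add_sub_add_right_eq_sub, ← Finset.sum_sub_distrib, Finset.mul_sum, ← sub_eq_zero,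
          ← Finset.sum_sub_distrib] at h1
        rw [Finset.sum_range_succ, if_neg (by omega), zero_mul, add_zero, ← h1]
        refine Finset.sum_congr rfl fun k hk => ?_
        have hk' : k ≤ n := by have := Finset.mem_range.1 hk; omega
        have := PCheck_forward F (n - k) tw' y
        rw [htw1, show n - k + 1 = n + 1 - k by omega] at this
        rw [if_pos hk']
        linear_combination -(C k * PCheck F k lb x) * this
      have h2 := PCheck_independent F (n + 1) lb (fun m h1 h2 => by
        rw [hlb, resonant_shift]
        refine hlam _ ?_ ?_ <;> push_cast at h1 ⊢ <;> omega) _ hx 0 (by omega)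
      rw [if_pos (Nat.zero_le n), hC0, zero_mul, zero_sub, Nat.sub_zero] at h2
      exact mul_ne_zero (neg_ne_zero.2 (mul_ne_zero hbr (hd'0 0 (Nat.zero_le n)))) hy h2

end KernelExpansion

/-! ### Casorati determinants of eigenpolynomials and complementary index sets. -/

section EigenCasoratian

variable (F : Family)

/-- The Casorati determinant of the eigenpolynomials with indices `f`. -/
noncomputable def casP (lam : Fin 4 → ℂ) {m : ℕ} (f : Fin m → ℕ) (x : ℂ) : ℂ :=
  cas F (fun k => PCheck F (f k) lam) x

theorem differentiable_casP (lam : Fin 4 → ℂ) {m : ℕ} (f : Fin m → ℕ) :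
    Differentiable ℂ (casP F lam f) :=
  differentiable_cas F fun k => differentiable_PCheck F (f k) lam

theorem exists_equiv_of_range_eq {m : ℕ} {f g : Fin m → ℕ} (hf : Function.Injective f)
    (hg : Function.Injective g) (h : Set.range f = Set.range g) :
    ∃ σ : Equiv.Perm (Fin m), ∀ k, f k = g (σ k) := by
  refine ⟨(Equiv.ofInjective f hf).trans ((Equiv.setCongr h).trans (Equiv.ofInjective g hg).symm),
    fun k => ?_⟩
  simp [Equiv.apply_ofInjective_symm hg]

theorem casP_comp_perm (lam : Fin 4 → ℂ) {m : ℕ} (f : Fin m → ℕ) (σ : Equiv.Perm (Fin m)) (x : ℂ) :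
    casP F lam (fun k => f (σ k)) x = (Equiv.Perm.sign σ : ℤ) * casP F lam f x :=
  Matrix.det_permute' σ (Matrix.of fun j k : Fin m =>
    PCheck F (f k) lam (pt F x (m - 1 - 2 * (j : ℤ))))

theorem casP_of_range_eq (lam : Fin 4 → ℂ) {m : ℕ} {f g : Fin m → ℕ} (hf : Function.Injective f)
    (hg : Function.Injective g) (h : Set.range f = Set.range g) :
    ∃ C : ℂ, C ≠ 0 ∧ ∀ x, casP F lam f x = C * casP F lam g x := by
  obtain ⟨σ, hσ⟩ := exists_equiv_of_range_eq hf hg h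
  obtain rfl : f = fun k => g (σ k) := funext hσ
  exact ⟨_, by exact_mod_cast (Equiv.Perm.sign σ).ne_zero, casP_comp_perm F lam g σ⟩

/-- The indices `0, 1, …, K - 1, K + n`. -/
def stairIndex (K n : ℕ) (k : Fin (K + 1)) : ℕ := if (k : ℕ) = K then K + n else k

theorem shift_zero (lam : Fin 4 → ℂ) : shift lam 0 = lam := by
  funext k
  simp [shift]

theorem raise_shift_succ (lam : Fin 4 → ℂ) (K : ℕ) : raise (shift lam (K + 1)) = shift lam K := by
  funext k
  simp only [raise, shift]
  push_cast
  ring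

/-- As P_0 = 1, differences of consecutive rows remove the first column, and the forward shift
lowers every other index by one. It contributes a φ for each row and a constant for each column. -/
theorem casP_stairIndex_succ (lam : Fin 4 → ℂ) (K n : ℕ) (x : ℂ) :
    casP F lam (stairIndex (K + 1) n) x
      = (∏ k : Fin (K + 1), fwd F (stairIndex K n k + 1) lam)
        * ((∏ j ∈ Finset.range (K + 1), phi F (pt F x (K - 2 * (j : ℤ))))
          * casP F (raise lam) (stairIndex K n) x) := by
  have hz : stairIndex (K + 1) n 0 = 0 := by simp [stairIndex]
  have hs : ∀ k : Fin (K + 1), stairIndex (K + 1) n k.succ = stairIndex K n k + 1 := by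
    intro k
    simp only [stairIndex, Fin.val_succ, Nat.add_right_cancel_iff]
    split_ifs <;> omega
  let A : Matrix (Fin (K + 1 + 1)) (Fin (K + 1 + 1)) ℂ :=
    Matrix.of fun j k => PCheck F (stairIndex (K + 1) n k) lam
      (pt F x (((K + 1 + 1 : ℕ) : ℤ) - 1 - 2 * (j : ℤ)))
  let B : Matrix (Fin (K + 1 + 1)) (Fin (K + 1 + 1)) ℂ :=
    Matrix.of (Fin.cons (A 0) fun i k => A i.succ k - A i.castSucc k)
  have hAB : A.det = B.det := by
    refine Matrix.det_eq_of_forall_row_eq_smul_add_pred (fun _ => 1) (fun j => rfl) fun i j => ?_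
    change A i.succ j = (A i.succ j - A i.castSucc j) + 1 * A i.castSucc j
    ring
  have hB : ∀ i : Fin (K + 1), B i.succ 0 = 0 := by
    intro i
    change A i.succ 0 - A i.castSucc 0 = 0
    simp only [A, Matrix.of_apply, hz, PCheck_zero, sub_self]
  have hB0 : B 0 0 = 1 := by
    change A 0 0 = 1
    simp only [A, Matrix.of_apply, hz, PCheck_zero]
  have hB' : ∀ i k : Fin (K + 1), B i.succ k.succ = phi F (pt F x (K - 2 * (i : ℤ)))
      * (fwd F (stairIndex K n k + 1) lam
        * PCheck F (stairIndex K n k) (raise lam) (pt F x (((K + 1 : ℕ) : ℤ) - 1 - 2 * (i : ℤ)))) := by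
    intro i k
    change A i.succ k.succ - A i.castSucc k.succ = _
    have := PCheck_forward F (stairIndex K n k) (raise lam) (pt F x (K - 2 * (i : ℤ)))
    rw [shift_raise, pt_pt, pt_pt] at this
    simp only [A, Matrix.of_apply, hs]
    have e1 : (((K + 1 + 1 : ℕ) : ℤ) - 1 - 2 * ((i.succ : Fin (K + 1 + 1)) : ℕ)) = K - 2 * (i : ℤ) + -1 := by
      push_cast [Fin.val_succ]; ring
    have e2 : (((K + 1 + 1 : ℕ) : ℤ) - 1 - 2 * ((i.castSucc : Fin (K + 1 + 1)) : ℕ)) = K - 2 * (i : ℤ) + 1 := by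
      push_cast [Fin.val_castSucc]; ring
    have e3 : (((K + 1 : ℕ) : ℤ) - 1 - 2 * (i : ℤ)) = K - 2 * (i : ℤ) := by push_cast; ring
    rw [e1, e2, e3, this]
    ring
  change A.det = _
  rw [hAB, Matrix.det_succ_column_zero, Finset.sum_eq_single 0]
  · rw [hB0]
    have : B.submatrix (Fin.succAbove 0) Fin.succ = Matrix.of fun i k : Fin (K + 1) =>
        phi F (pt F x (K - 2 * (i : ℤ))) * (Matrix.of fun i k : Fin (K + 1) =>
          fwd F (stairIndex K n k + 1) lam * (Matrix.of fun i k : Fin (K + 1) =>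
            PCheck F (stairIndex K n k) (raise lam)
              (pt F x (((K + 1 : ℕ) : ℤ) - 1 - 2 * (i : ℤ)))) i k) i k := by
      ext i k
      exact hB' i k
    rw [this, Matrix.det_mul_column, Matrix.det_mul_row, Finset.prod_range]
    simp only [casP, cas, Fin.val_zero, pow_zero, one_mul]
    ring
  · intro i _ hi
    obtain ⟨i', rfl⟩ := Fin.exists_succ_eq.2 hi
    rw [hB]
    ring
  · simp

/-- K forward shifts leave the single polynomial P_n, while the row factors accumulate to φ_{K+1}.
With K = N + 1 this is the start of the induction for (1); with n = 0 it gives the reference minors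
in `casP_complement`. -/
theorem casP_stairIndex (lam : Fin 4 → ℂ) (K n : ℕ)
    (hlam : ∀ m : ℤ, 2 - n ≤ m → m ≤ 2 * K → ¬ Resonant F lam m) :
    ∃ C : ℂ, C ≠ 0 ∧ ∀ x, casP F (shift lam K) (stairIndex K n) x
      = C * (phiM F (K + 1) x * PCheck F n lam x) := by
  induction K with
  | zero =>
    refine ⟨1, one_ne_zero, fun x => ?_⟩
    simp [casP, cas, stairIndex, shift_zero, pt_zero]
  | succ K ih =>
    obtain ⟨C, hC, h⟩ := ih fun m hm1 hm2 => hlam m hm1 (by push_cast; omega)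
    refine ⟨(∏ k : Fin (K + 1), fwd F (stairIndex K n k + 1) (shift lam (K + 1))) * C,
      mul_ne_zero (Finset.prod_ne_zero_iff.2 fun k _ => fwd_ne_zero F (Nat.succ_ne_zero _) ?_) hC,
      fun x => ?_⟩
    · rw [resonant_shift]
      have := k.2
      refine hlam _ ?_ ?_ <;> simp only [stairIndex] <;> split_ifs <;> push_cast <;> omega
    · rw [casP_stairIndex_succ, raise_shift_succ, h, phiM_succ F (K + 1)]
      have : ∀ j : ℕ, ((K + 1 : ℕ) : ℤ) - 1 - 2 * (j : ℤ) = K - 2 * j := by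
        intro j; push_cast; ring
      simp only [this]
      ring

theorem casP_range_shift (lam : Fin 4 → ℂ) (K : ℕ)
    (hlam : ∀ m : ℤ, 2 ≤ m → m ≤ 2 * K → ¬ Resonant F lam m) :
    ∃ C : ℂ, C ≠ 0 ∧ ∀ x, casP F (shift lam K) (fun k : Fin (K + 1) => (k : ℕ)) x
      = C * phiM F (K + 1) x := by
  obtain ⟨C, hC, h⟩ := casP_stairIndex F lam K 0 (by simpa using hlam)
  refine ⟨C, hC, fun x => ?_⟩
  have := h x
  rw [PCheck_zero, mul_one] at this
  rw [← this]
  congr 1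
  funext k
  simp only [stairIndex]
  split_ifs <;> omega

theorem casP_empty (lam : Fin 4 → ℂ) (f : Fin 0 → ℕ) (x : ℂ) : casP F lam f x = 1 := by
  simp [casP, cas]

theorem casP_range (lam : Fin 4 → ℂ) (N m : ℕ) (hm : m ≤ N + 1)
    (hlam : ∀ m : ℤ, 4 ≤ m → m ≤ 2 * N + 2 → ¬ Resonant F lam m) :
    ∃ C : ℂ, C ≠ 0 ∧ ∀ x, casP F (shift lam (N + 1)) (fun k : Fin m => (k : ℕ)) x
      = C * phiM F m x := by
  cases m with
  | zero => exact ⟨1, one_ne_zero, fun x => by simp [casP_empty]⟩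
  | succ K =>
    obtain ⟨t, rfl⟩ := Nat.exists_eq_add_of_le (Nat.lt_succ_iff.1 hm)
    have := casP_range_shift F (shift lam (t + 1)) K fun m hm1 hm2 => by
      rw [resonant_shift]
      refine hlam _ ?_ ?_ <;> push_cast <;> omega
    rwa [shift_shift, show t + 1 + K = K + t + 1 by ring] at this

theorem casP_range_twist (lam : Fin 4 → ℂ) (N r : ℕ) (hr : r ≤ N + 1)
    (hlam : ∀ m : ℤ, 4 ≤ m → m ≤ 2 * N + 2 → ¬ Resonant F lam m) :
    ∃ C : ℂ, C ≠ 0 ∧ ∀ x, casP F (twist lam) (fun k : Fin r => (k : ℕ)) x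
      = C * phiM F r x := by
  cases r with
  | zero => exact ⟨1, one_ne_zero, fun x => by simp [casP_empty]⟩
  | succ K =>
    have := casP_range_shift F (twist (shift lam K)) K fun m hm1 hm2 => by
      rw [resonant_twist, resonant_shift]
      refine hlam _ ?_ ?_ <;> omega
    have e : shift (twist (shift lam K)) K = twist lam := by
      funext k
      simp only [shift, twist]
      ring
    rwa [e] at this

/-- The m + r = N + 1 sample points are placed so that each entry of `A * B` is a kernel value at
one of its zeros. Proportionality of complementary minors compares `e` with the initial segment,
whose two determinants are known explicitly. -/
theorem casP_complement (lam : Fin 4 → ℂ) (N m r : ℕ) (e : Fin m ⊕ Fin r ≃ Fin (N + 1))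
    (hlam : ∀ m : ℤ, 4 ≤ m → m ≤ 2 * N + 2 → ¬ Resonant F lam m) :
    ∃ C : ℂ, C ≠ 0 ∧ ∀ x,
      casP F (shift lam (N + 1)) (fun k => (e (Sum.inl k) : ℕ)) x * phiM F r x
        = C * (casP F (twist lam) (fun l => N - (e (Sum.inr l) : ℕ)) x * phiM F m x) := by
  have hmr : m + r = N + 1 := by simpa using Fintype.card_congr e
  obtain ⟨c, hc, hK⟩ := kern_expansion F N lam hlam
  obtain ⟨C₁, hC₁, h₁⟩ := casP_range F lam N m (by omega) hlam
  obtain ⟨C₂, hC₂, h₂⟩ := casP_range_twist F lam N r (by omega) hlam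
  -- The reference splitting: the first m indices on the left, the last r reversed on the right, so
  -- that N minus the index runs through 0, …, r - 1.
  let f : Fin m ⊕ Fin r ≃ Fin (N + 1) := (Equiv.sumCongr (Equiv.refl _) Fin.revPerm).trans
    (finSumFinEquiv.trans (finCongr hmr))
  have hf1 : ∀ k, (f (Sum.inl k) : ℕ) = k := fun k => by simp [f]
  have hf2 : ∀ l, N - (f (Sum.inr l) : ℕ) = l := fun l => by
    have := l.2
    simp [f, Fin.val_rev]
    omega
  have hcc : ∀ g : Fin m → Fin (N + 1), ∏ k, c (g k) ≠ 0 := fun g =>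
    Finset.prod_ne_zero_iff.2 fun k _ => hc _ (Nat.lt_succ_iff.1 (g k).2)
  have hsign : ((Equiv.Perm.sign (e.trans f.symm) : ℤ) : ℂ) ≠ 0 := by
    exact_mod_cast (Equiv.Perm.sign (e.trans f.symm)).ne_zero
  refine ⟨((Equiv.Perm.sign (e.trans f.symm) : ℤ) * (∏ k, c (e (Sum.inl k))) * C₂)⁻¹
    * ((∏ k, c (f (Sum.inl k))) * C₁), mul_ne_zero (inv_ne_zero (mul_ne_zero (mul_ne_zero hsign
      (hcc _)) hC₂)) (mul_ne_zero (hcc _) hC₁), fun x => ?_⟩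
  let A : Matrix (Fin m) (Fin (N + 1)) ℂ := Matrix.of fun j k =>
    c k * PCheck F k (shift lam (N + 1)) (pt F x (m - 1 - 2 * (j : ℤ)))
  let B : Matrix (Fin (N + 1)) (Fin r) ℂ := Matrix.of fun k l =>
    PCheck F (N - k) (twist lam) (pt F x (r - 1 - 2 * (l : ℤ)))
  have hAB : A * B = 0 := by
    ext j l
    rw [Matrix.mul_apply]
    have := hK (pt F x (m - 1 - 2 * (j : ℤ))) (pt F x (r - 1 - 2 * (l : ℤ)))
    rw [Finset.sum_range] at this
    refine this.symm.trans ?_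
    have hj := j.2
    have hl := l.2
    -- This kernel node of the l-th y-point coincides with the j-th x-point, because N = m + r - 1.
    refine Finset.prod_eq_zero (i := r - 1 - l + j) (Finset.mem_range.2 (by omega)) ?_
    rw [pt_pt, sub_eq_zero]
    congr 2
    omega
  have h := complementary_minors A B hAB e f
  have hA : ∀ g : Fin m → Fin (N + 1), (A.submatrix id g).det
      = (∏ k, c (g k)) * casP F (shift lam (N + 1)) (fun k => (g k : ℕ)) x := fun g =>
    Matrix.det_mul_row (fun k => c (g k)) _
  have hB : ∀ g : Fin r → Fin (N + 1), (B.submatrix g id).det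
      = casP F (twist lam) (fun l => N - (g l : ℕ)) x := fun g =>
    (Matrix.det_transpose _).symm
  rw [hA, hA, hB, hB] at h
  simp only [hf1, hf2] at h
  rw [h₁, h₂] at h
  rw [inv_mul_eq_div, div_mul_eq_mul_div, eq_div_iff (mul_ne_zero (mul_ne_zero hsign (hcc _)) hC₂)]
  simp only [hf1]
  linear_combination -h

end EigenCasoratian

/-! ### The bilinear identity of the difference equation, and nonvanishing. -/

section Bilinear

variable (F : Family)

/-- On n + 3 lattice points the difference equation is a three-term recurrence whose coefficients
are common to all indices, with the eigenvalue as spectral parameter, so `recurrence_bilinear`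
applies. -/
theorem casP_bilinear (lam : Fin 4 → ℂ) (n : ℕ) (f : Fin (n + 2) → ℕ) (x : ℂ) :
    phi F (pt F x (-n)) * phi F (pt F x (-n - 1)) * wt F lam (-pt F x n)
        * casP F lam f (pt F x 1) * casP F lam (fun k : Fin n => f k.castSucc.succ) (pt F x (-1))
      - phi F (pt F x n) * phi F (pt F x (n + 1)) * wt F lam (pt F x (-n))
        * casP F lam f (pt F x (-1)) * casP F lam (fun k : Fin n => f k.castSucc.succ) (pt F x 1)
      = (energy F (f 0) lam - energy F (f (Fin.last (n + 1))) lam)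
        * (phi F (pt F x n) * phi F (pt F x (n + 1))
          * (phi F (pt F x (-n)) * phi F (pt F x (-n - 1))))
        * casP F lam (fun k => f k.castSucc) x * casP F lam (fun k => f k.succ) x := by
  have hd : ∀ h : ℤ, Differentiable ℂ fun x => phi F (pt F x h) := fun h =>
    (differentiable_phi F).comp (differentiable_pt F h)
  have hc : ∀ {m : ℕ} (g : Fin m → ℕ) (h : ℤ), Differentiable ℂ fun x => casP F lam g (pt F x h) :=
    fun g h => (differentiable_casP F lam g).comp (differentiable_pt F h)
  have hw1 : Differentiable ℂ fun x => wt F lam (-pt F x n) :=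
    (differentiable_wt F lam).comp (differentiable_pt F n).neg
  have hw2 : Differentiable ℂ fun x => wt F lam (pt F x (-n)) :=
    (differentiable_wt F lam).comp (differentiable_pt F (-n))
  have hd1 := hd (-n)
  have hd2 := hd (-n - 1)
  have hd3 := hd n
  have hd4 := hd (n + 1)
  have hc1 := hc f 1
  have hc2 := hc f (-1)
  have hc3 := hc (fun k : Fin n => f k.castSucc.succ) 1
  have hc4 := hc (fun k : Fin n => f k.castSucc.succ) (-1)
  have hc5 := differentiable_casP F lam (fun k => f k.castSucc)
  have hc6 := differentiable_casP F lam (fun k => f k.succ)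
  refine sub_eq_zero.1 (eq_zero_of_mul_eq_zero
    (f := fun x => phi F (pt F x (-n)) * phi F (pt F x (-n - 1)) * wt F lam (-pt F x n)
        * casP F lam f (pt F x 1) * casP F lam (fun k : Fin n => f k.castSucc.succ) (pt F x (-1))
      - phi F (pt F x n) * phi F (pt F x (n + 1)) * wt F lam (pt F x (-n))
        * casP F lam f (pt F x (-1)) * casP F lam (fun k : Fin n => f k.castSucc.succ) (pt F x 1)
      - (energy F (f 0) lam - energy F (f (Fin.last (n + 1))) lam)
        * (phi F (pt F x n) * phi F (pt F x (n + 1))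
          * (phi F (pt F x (-n)) * phi F (pt F x (-n - 1))))
        * casP F lam (fun k => f k.castSucc) x * casP F lam (fun k => f k.succ) x)
    (g := fun x => ∏ h ∈ Finset.Icc (-(n : ℤ) - 1) (n + 1), phi F (pt F x h)) ?_
    (Differentiable.fun_finsetProd fun h _ => hd h) (fun x => ?_)
    (exists_prod_ne_zero _ _ hd fun h => exists_comp_pt_ne_zero F h (exists_phi_ne_zero F)) x)
  · fun_prop
  -- The recurrence has values of φ in its denominators. Multiplication by the product of φ over the
  -- whole window makes their zeros trivial, and this factor is removed again because the functions
  -- are entire.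
  by_cases h0 : ∏ h ∈ Finset.Icc (-(n : ℤ) - 1) (n + 1), phi F (pt F x h) = 0
  · simp only [h0, mul_zero]
  rw [← ne_eq, Finset.prod_ne_zero_iff] at h0
  have hne : ∀ h : ℤ, -(n : ℤ) - 1 ≤ h → h ≤ n + 1 → phi F (pt F x h) ≠ 0 := fun h h1 h2 =>
    h0 h (Finset.mem_Icc.2 ⟨h1, h2⟩)
  let z : ℕ → ℤ := fun j => n - 2 * (j : ℤ)
  have key := recurrence_bilinear (R := ℂ) (n := n)
    (fun j k => PCheck F (f k) lam (pt F x (n + 2 - 2 * (j : ℤ))))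
    (fun k => energy F (f k) lam)
    (fun j => wt F lam (-pt F x (z j)) / (phi F (pt F x (z j)) * phi F (pt F x (z j + 1))))
    (fun j => wt F lam (pt F x (z j)) / (phi F (pt F x (z j)) * phi F (pt F x (z j - 1))))
    (fun j => -(wt F lam (-pt F x (z j)) / (phi F (pt F x (z j)) * phi F (pt F x (z j + 1))))
      - wt F lam (pt F x (z j)) / (phi F (pt F x (z j)) * phi F (pt F x (z j - 1)))) (by
    intro j hj k
    have h := PCheck_difference_eq F (f k) lam (pt F x (z j))
    rw [pt_pt, pt_pt, pt_pt, pt_pt] at h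
    have n1 := hne (z j) (by simp only [z]; omega) (by simp only [z]; omega)
    have n2 := hne (z j + 1) (by simp only [z]; omega) (by simp only [z]; omega)
    have n3 := hne (z j - 1) (by simp only [z]; omega) (by simp only [z]; omega)
    rw [← sub_eq_add_neg, ← sub_eq_add_neg] at h
    have e1 : ((n : ℤ) + 2 - 2 * ((j + 1 : ℕ) : ℤ)) = z j := by simp only [z]; push_cast; ring
    have e2 : ((n : ℤ) + 2 - 2 * ((j + 2 : ℕ) : ℤ)) = z j - 2 := by simp only [z]; push_cast; ring
    have e3 : ((n : ℤ) + 2 - 2 * (j : ℤ)) = z j + 2 := by simp only [z]; ring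
    simp only [e1, e2, e3]
    field_simp
    linear_combination -h)
  have s1 : Matrix.det (Matrix.of fun j k : Fin (n + 2) =>
      PCheck F (f k) lam (pt F x (n + 2 - 2 * ((j : ℕ) : ℤ)))) = casP F lam f (pt F x 1) := by
    unfold casP cas
    congr 1; ext j k
    simp only [Matrix.of_apply, pt_pt]
    congr 2; push_cast; ring
  have s2 : Matrix.det (Matrix.of fun j k : Fin n =>
      PCheck F (f k.castSucc.succ) lam (pt F x (n + 2 - 2 * ((j + 2 : ℕ) : ℤ))))
      = casP F lam (fun k : Fin n => f k.castSucc.succ) (pt F x (-1)) := by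
    unfold casP cas
    congr 1; ext j k
    simp only [Matrix.of_apply, pt_pt]
    congr 2; push_cast; ring
  have s3 : Matrix.det (Matrix.of fun j k : Fin (n + 2) =>
      PCheck F (f k) lam (pt F x (n + 2 - 2 * ((j + 1 : ℕ) : ℤ)))) = casP F lam f (pt F x (-1)) := by
    unfold casP cas
    congr 1; ext j k
    simp only [Matrix.of_apply, pt_pt]
    congr 2; push_cast; ring
  have s4 : Matrix.det (Matrix.of fun j k : Fin n =>
      PCheck F (f k.castSucc.succ) lam (pt F x (n + 2 - 2 * ((j + 1 : ℕ) : ℤ))))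
      = casP F lam (fun k : Fin n => f k.castSucc.succ) (pt F x 1) := by
    unfold casP cas
    congr 1; ext j k
    simp only [Matrix.of_apply, pt_pt]
    congr 2; push_cast; ring
  have s5 : ∀ g : Fin (n + 1) → ℕ, Matrix.det (Matrix.of fun j k : Fin (n + 1) =>
      PCheck F (g k) lam (pt F x (n + 2 - 2 * ((j + 1 : ℕ) : ℤ)))) = casP F lam g x := by
    intro g
    unfold casP cas
    congr 1; ext j k
    simp only [Matrix.of_apply]
    congr 2; push_cast; ring
  have s6 := s5 fun k => f k.castSucc
  have s7 := s5 fun k => f k.succ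
  rw [s1, s2, s3, s4, s6, s7] at key
  have z0 : z 0 = n := by simp [z]
  have zn : z n = -n := by simp only [z]; ring
  rw [z0, zn] at key
  have n1 := hne n (by omega) (by omega)
  have n2 := hne (n + 1) (by omega) (by omega)
  have n3 := hne (-n) (by omega) (by omega)
  have n4 := hne (-n - 1) (by omega) (by omega)
  refine mul_eq_zero_of_left ?_ _
  field_simp at key
  linear_combination key

/-- An entire function that is not identically zero. -/
def EntireNonzero (f : ℂ → ℂ) : Prop := Differentiable ℂ f ∧ ∃ x, f x ≠ 0

theorem EntireNonzero.mul {f g : ℂ → ℂ} (hf : EntireNonzero f) (hg : EntireNonzero g) :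
    EntireNonzero fun x => f x * g x :=
  ⟨hf.1.mul hg.1, exists_mul_ne_zero hf.1 hg.1 hf.2 hg.2⟩

theorem EntireNonzero.cancel {f g : ℂ → ℂ} (hg : EntireNonzero g) (hf : Differentiable ℂ f)
    (h : ∀ x, f x * g x = 0) (x : ℂ) : f x = 0 :=
  eq_zero_of_mul_eq_zero hf hg.1 h hg.2 x

theorem entireNonzero_phi_pt (h : ℤ) : EntireNonzero fun x => phi F (pt F x h) :=
  ⟨(differentiable_phi F).comp (differentiable_pt F h),
    exists_comp_pt_ne_zero F h (exists_phi_ne_zero F)⟩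

theorem entireNonzero_phiM (M : ℕ) : EntireNonzero (phiM F M) :=
  ⟨differentiable_phiM F M, exists_phiM_ne_zero F M⟩

/-- If the determinant vanished identically, so would the left-hand side of `casP_bilinear`; the
right-hand side is a nonzero eigenvalue difference times values of φ and two shorter determinants,
nonzero by induction. -/
theorem entireNonzero_casP (lam : Fin 4 → ℂ) (N : ℕ)
    (hlam : ∀ m : ℤ, 2 - 2 * N ≤ m → m ≤ 0 → ¬ Resonant F lam m) (m : ℕ) (f : Fin m → ℕ)
    (hf : Function.Injective f) (hN : ∀ k, f k ≤ N) : EntireNonzero (casP F lam f) := by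
  induction m using Nat.strong_induction_on with
  | _ m ih =>
    refine ⟨differentiable_casP F lam f, ?_⟩
    match m, f, hf, hN, ih with
    | 0, f, _, _, _ => exact ⟨0, by simp [casP_empty]⟩
    | 1, f, _, hN, _ =>
      obtain ⟨x, hx⟩ := exists_PCheck_ne_zero F (f 0) lam fun m h1 h2 =>
        hlam m (by have := hN 0; omega) h2
      exact ⟨x, by simpa [casP, cas, pt_zero] using hx⟩
    | n + 2, f, hf, hN, ih =>
      by_contra! hc
      have h0 : f 0 ≠ f (Fin.last (n + 1)) := fun h => absurd (hf h) (Fin.last_pos.ne)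
      have hE : energy F (f 0) lam - energy F (f (Fin.last (n + 1))) lam ≠ 0 := by
        have := hN 0
        have := hN (Fin.last _)
        exact sub_ne_zero.2 (energy_ne F h0 (hlam _ (by omega) (by omega)))
      have h1 := ih (n + 1) (by omega) (fun k => f k.castSucc)
        (hf.comp (Fin.castSucc_injective _)) fun k => hN _
      have h2 := ih (n + 1) (by omega) (fun k => f k.succ)
        (hf.comp (Fin.succ_injective _)) fun k => hN _
      obtain ⟨-, x, hx⟩ := (h1.mul h2).mul (((entireNonzero_phi_pt F n).mul
        (entireNonzero_phi_pt F (n + 1))).mul ((entireNonzero_phi_pt F (-n)).mul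
        (entireNonzero_phi_pt F (-n - 1))))
      have h := casP_bilinear F lam n f x
      simp only [hc, mul_zero, zero_mul, sub_zero] at h
      refine mul_ne_zero hE hx ?_
      linear_combination -h

end Bilinear

/-! ### Recursions for the factors r_j. -/

section RatioFactor

variable (F : Family)

theorem rFactor_zero_zero (lam : Fin 4 → ℂ) (x : ℂ) : rFactor F 0 0 lam x = 1 := by
  cases F <;> simp [rFactor]

theorem I_mul_pt_wilson (x : ℂ) (h : ℤ) : Complex.I * pt .wilson x h = Complex.I * x - h / 2 := by
  simp only [pt, gam]
  push_cast
  linear_combination (h / 2 : ℂ) * Complex.I_mul_I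

/-- Each recursion splits off the leading factors of the shifted factorials, which form the weight
at x or at -x. The same constant serves both recursions and every s, so that a scalar can be
extracted from a whole column in `multiDet_desnanot`. -/
theorem rFactor_succ (M : ℕ) (lam : Fin 4 → ℂ) : ∃ C : ℂ, C ≠ 0 ∧ ∀ s ≤ M, ∀ x,
    rFactor F (M + 1) (s + 1) lam x
        = C * (wt F (shift lam (M + 1)) x * rFactor F M s lam (pt F x (-1))) ∧
      rFactor F (M + 1) s lam x
        = C * (wt F (shift lam (M + 1)) (-x) * rFactor F M s lam (pt F x 1)) := by
  cases F with
  | wilson =>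
    refine ⟨1, one_ne_zero, fun s hs x => ?_⟩
    obtain ⟨t, rfl⟩ := Nat.exists_eq_add_of_le hs
    simp only [rFactor, wt, param, I_mul_pt_wilson, shift, one_mul, ← Finset.prod_mul_distrib,
      show s + t + 1 - (s + 1) = t by omega, Nat.add_sub_cancel_left,
      show s + t + 1 - s = t + 1 by omega, poch_succ_left]
    constructor
    · refine Finset.prod_congr rfl fun k _ => ?_
      rw [show lam k - ((s + t + 1 : ℕ) : ℂ) / 2 + Complex.I * x + 1
          = lam k - ((s + t : ℕ) : ℂ) / 2 + (Complex.I * x - ((-1 : ℤ) : ℂ) / 2) by push_cast; ring,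
        show lam k - ((s + t + 1 : ℕ) : ℂ) / 2 - Complex.I * x
          = lam k - ((s + t : ℕ) : ℂ) / 2 - (Complex.I * x - ((-1 : ℤ) : ℂ) / 2) by push_cast; ring]
      ring
    · refine Finset.prod_congr rfl fun k _ => ?_
      rw [show lam k - ((s + t + 1 : ℕ) : ℂ) / 2 - Complex.I * x + 1
          = lam k - ((s + t : ℕ) : ℂ) / 2 - (Complex.I * x - ((1 : ℤ) : ℂ) / 2) by push_cast; ring,
        show lam k - ((s + t + 1 : ℕ) : ℂ) / 2 + Complex.I * x
          = lam k - ((s + t : ℕ) : ℂ) / 2 + (Complex.I * x - ((1 : ℤ) : ℂ) / 2) by push_cast; ring]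
      ring
  | askeyWilson q h₀ h₁ =>
    refine ⟨(q : ℂ) ^ M * Complex.exp (Real.log q * (∑ k, shift lam (M + 1) k) / 2),
      mul_ne_zero (pow_ne_zero _ (by exact_mod_cast h₀.ne')) (Complex.exp_ne_zero _),
      fun s hs x => ?_⟩
    obtain ⟨t, rfl⟩ := Nat.exists_eq_add_of_le hs
    have hI := Complex.I_mul_I
    have hpt : ∀ h : ℤ, Complex.I * pt (.askeyWilson q h₀ h₁) x h
        = Complex.I * x - h / 2 * Real.log q := by
      intro h
      simp only [pt, gam]
      linear_combination (h / 2 * Real.log q : ℂ) * hI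
    have hnpow : ∀ n : ℕ, (q : ℂ) ^ n = Complex.exp (Real.log q * n) := fun n => by
      rw [← zpow_natCast, zpow_eq_exp h₀]; push_cast; rfl
    have hq : (q : ℂ) = Complex.exp (Real.log q) := (exp_log_eq h₀).symm
    have hcancel : Complex.exp (Real.log q * (∑ k, shift lam (s + t + 1) k) / 2)
        * Complex.exp (-(Real.log q * (∑ k, shift lam (s + t + 1) k) / 2)) = 1 := by
      rw [← Complex.exp_add, add_neg_cancel, Complex.exp_zero]
    rw [wt_askeyWilson, wt_askeyWilson]
    simp only [rFactor, param, show s + t + 1 - (s + 1) = t by omega, Nat.add_sub_cancel_left,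
      show s + t + 1 - s = t + 1 by omega, qpoch_succ_left, Finset.prod_mul_distrib,
      mul_neg, neg_neg, ← Complex.exp_nat_mul, ← Complex.exp_neg]
    constructor
    · have e1 : ∀ k, (q : ℂ) ^ shift lam (s + t) k
            * Complex.exp (Complex.I * pt (.askeyWilson q h₀ h₁) x (-1))
          = (q : ℂ) ^ shift lam (s + t + 1) k * Complex.exp (Complex.I * x) * q := by
        intro k
        rw [hpt, cpow_eq_exp h₀, cpow_eq_exp h₀]
        rw [hq, ← Complex.exp_add, ← Complex.exp_add, ← Complex.exp_add]
        congr 1; simp only [shift]; push_cast; ring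
      have e2 : ∀ k, (q : ℂ) ^ shift lam (s + t) k
            * Complex.exp (-(Complex.I * pt (.askeyWilson q h₀ h₁) x (-1)))
          = (q : ℂ) ^ shift lam (s + t + 1) k * Complex.exp (-(Complex.I * x)) := by
        intro k
        rw [hpt, cpow_eq_exp h₀, cpow_eq_exp h₀, ← Complex.exp_add, ← Complex.exp_add]
        congr 1; simp only [shift]; push_cast; ring
      have e3 : Complex.exp (2 * Complex.I * x * (((s + t + 1 : ℕ) : ℂ) - 2 * ((s + 1 : ℕ) : ℂ)))
            * (q : ℂ) ^ (2 * (s + 1) * t)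
          = (q : ℂ) ^ (s + t) * Complex.exp (-((2 : ℕ) * (Complex.I * x)))
            * (Complex.exp (2 * Complex.I * pt (.askeyWilson q h₀ h₁) x (-1)
                * (((s + t : ℕ) : ℂ) - 2 * s)) * (q : ℂ) ^ (2 * s * t)) := by
        rw [mul_assoc 2 Complex.I (pt _ _ _), hpt, hnpow, hnpow, hnpow, ← Complex.exp_add,
          ← Complex.exp_add, ← Complex.exp_add, ← Complex.exp_add]
        congr 1; push_cast; ring
      simp only [e1, e2]
      rw [e3]
      linear_combination -((q : ℂ) ^ (s + t) * Complex.exp (-((2 : ℕ) * (Complex.I * x)))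
        * (Complex.exp (2 * Complex.I * pt (.askeyWilson q h₀ h₁) x (-1)
          * (((s + t : ℕ) : ℂ) - 2 * s)) * (q : ℂ) ^ (2 * s * t))
        * (∏ k, (1 - (q : ℂ) ^ shift lam (s + t + 1) k * Complex.exp (Complex.I * x)))
        * (∏ k, qpoch ((q : ℂ) ^ shift lam (s + t + 1) k * Complex.exp (Complex.I * x) * q) q s)
        * ∏ k, qpoch ((q : ℂ) ^ shift lam (s + t + 1) k * Complex.exp (-(Complex.I * x))) q t)
        * hcancel
    · have e1 : ∀ k, (q : ℂ) ^ shift lam (s + t) k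
            * Complex.exp (-(Complex.I * pt (.askeyWilson q h₀ h₁) x 1))
          = (q : ℂ) ^ shift lam (s + t + 1) k * Complex.exp (-(Complex.I * x)) * q := by
        intro k
        rw [hpt, cpow_eq_exp h₀, cpow_eq_exp h₀]
        rw [hq, ← Complex.exp_add, ← Complex.exp_add, ← Complex.exp_add]
        congr 1; simp only [shift]; push_cast; ring
      have e2 : ∀ k, (q : ℂ) ^ shift lam (s + t) k
            * Complex.exp (Complex.I * pt (.askeyWilson q h₀ h₁) x 1)
          = (q : ℂ) ^ shift lam (s + t + 1) k * Complex.exp (Complex.I * x) := by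
        intro k
        rw [hpt, cpow_eq_exp h₀, cpow_eq_exp h₀, ← Complex.exp_add, ← Complex.exp_add]
        congr 1; simp only [shift]; push_cast; ring
      have e3 : Complex.exp (2 * Complex.I * x * (((s + t + 1 : ℕ) : ℂ) - 2 * (s : ℂ)))
            * (q : ℂ) ^ (2 * s * (t + 1))
          = (q : ℂ) ^ (s + t) * Complex.exp ((2 : ℕ) * (Complex.I * x))
            * (Complex.exp (2 * Complex.I * pt (.askeyWilson q h₀ h₁) x 1
                * (((s + t : ℕ) : ℂ) - 2 * s)) * (q : ℂ) ^ (2 * s * t)) := by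
        rw [mul_assoc 2 Complex.I (pt _ _ _), hpt, hnpow, hnpow, hnpow, ← Complex.exp_add,
          ← Complex.exp_add, ← Complex.exp_add, ← Complex.exp_add]
        congr 1; push_cast; ring
      simp only [e1, e2]
      rw [e3]
      linear_combination -((q : ℂ) ^ (s + t) * Complex.exp ((2 : ℕ) * (Complex.I * x))
        * (Complex.exp (2 * Complex.I * pt (.askeyWilson q h₀ h₁) x 1
          * (((s + t : ℕ) : ℂ) - 2 * s)) * (q : ℂ) ^ (2 * s * t))
        * (∏ k, (1 - (q : ℂ) ^ shift lam (s + t + 1) k * Complex.exp (-(Complex.I * x))))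
        * (∏ k, qpoch ((q : ℂ) ^ shift lam (s + t + 1) k * Complex.exp (Complex.I * x)) q s)
        * ∏ k, qpoch ((q : ℂ) ^ shift lam (s + t + 1) k * Complex.exp (-(Complex.I * x)) * q) q t)
        * hcancel

theorem differentiable_rFactor (M s : ℕ) (lam : Fin 4 → ℂ) : Differentiable ℂ (rFactor F M s lam) := by
  cases F with
  | wilson => unfold rFactor poch; fun_prop
  | askeyWilson q h₀ h₁ => unfold rFactor qpoch; fun_prop

end RatioFactor

/-! ### The determinant defining the multi-indexed polynomials. -/

section MultiIndexed

variable (F : Family)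

/-- The matrix whose determinant defines the multi-indexed polynomial. -/
noncomputable def multiMatrix (lam : Fin 4 → ℂ) {M : ℕ} (d : Fin M → ℕ) (n : ℕ) (x : ℂ) :
    Matrix (Fin (M + 1)) (Fin (M + 1)) ℂ :=
  Matrix.of fun j k => Fin.snoc (α := fun _ => ℂ)
    (fun k : Fin M => PCheck F (d k) (twist lam) (pt F x (M - 2 * (j : ℤ))))
    (rFactor F M j lam x * PCheck F n lam (pt F x (M - 2 * (j : ℤ)))) k

theorem multiMatrix_castSucc (lam : Fin 4 → ℂ) {M : ℕ} (d : Fin M → ℕ) (n : ℕ) (x : ℂ)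
    (j : Fin (M + 1)) (k : Fin M) : multiMatrix F lam d n x j k.castSucc
      = PCheck F (d k) (twist lam) (pt F x (M - 2 * (j : ℤ))) := by
  simp [multiMatrix]

theorem multiMatrix_last (lam : Fin 4 → ℂ) {M : ℕ} (d : Fin M → ℕ) (n : ℕ) (x : ℂ)
    (j : Fin (M + 1)) : multiMatrix F lam d n x j (Fin.last M)
      = rFactor F M j lam x * PCheck F n lam (pt F x (M - 2 * (j : ℤ))) := by
  simp [multiMatrix]

/-- The determinant defining the multi-indexed polynomial, without its power of `i`. -/
noncomputable def multiDet (lam : Fin 4 → ℂ) {M : ℕ} (d : Fin M → ℕ) (n : ℕ) (x : ℂ) : ℂ :=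
  (multiMatrix F lam d n x).det

theorem differentiable_multiDet (lam : Fin 4 → ℂ) {M : ℕ} (d : Fin M → ℕ) (n : ℕ) :
    Differentiable ℂ (multiDet F lam d n) := by
  have h1 : ∀ n lam (h : ℤ), Differentiable ℂ fun x => PCheck F n lam (pt F x h) := fun n lam h =>
    (differentiable_PCheck F n lam).comp (differentiable_pt F h)
  unfold multiDet
  simp only [Matrix.det_apply]
  refine Differentiable.fun_sum fun σ _ => ?_
  refine Differentiable.const_smul (Differentiable.fun_finsetProd fun k _ => ?_) _
  refine Fin.lastCases ?_ (fun k => ?_) k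
  · simp only [multiMatrix_last]
    exact (differentiable_rFactor F M _ lam).fun_mul (h1 n lam _)
  · simp only [multiMatrix_castSucc]
    exact h1 _ _ _

/-- Desnanot-Jacobi with the column of index `a` first and the column with r_j last. Minors without
the last column are Casorati determinants; in those with it the recursions of `rFactor_succ` turn
the factors for M + 1 into factors for M. -/
theorem multiDet_desnanot (lam : Fin 4 → ℂ) {M : ℕ} (a : ℕ) (d : Fin M → ℕ) (n : ℕ) :
    ∃ C : ℂ, C ≠ 0 ∧ ∀ x,
      multiDet F lam (Fin.cons (α := fun _ => ℕ) a d : Fin (M + 1) → ℕ) n x * casP F (twist lam) d x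
        = C * (wt F (shift lam (M + 1)) x * multiDet F lam d n (pt F x (-1))
            * casP F (twist lam) (Fin.cons (α := fun _ => ℕ) a d : Fin (M + 1) → ℕ) (pt F x 1)
          - wt F (shift lam (M + 1)) (-x) * multiDet F lam d n (pt F x 1)
            * casP F (twist lam) (Fin.cons (α := fun _ => ℕ) a d : Fin (M + 1) → ℕ) (pt F x (-1))) := by
  obtain ⟨C, hC, hr⟩ := rFactor_succ F M lam
  refine ⟨C, hC, fun x => ?_⟩
  set A := multiMatrix F lam (Fin.cons (α := fun _ => ℕ) a d : Fin (M + 1) → ℕ) n x with hA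
  have h := desnanot_jacobi A
  have s1 : (A.submatrix (fun i : Fin M => i.castSucc.succ) fun i : Fin M => i.castSucc.succ).det
      = casP F (twist lam) d x := by
    unfold casP cas
    congr 1; ext j k
    rw [Matrix.submatrix_apply, Matrix.of_apply, Fin.succ_castSucc k, hA, multiMatrix_castSucc,
      Fin.cons_succ]
    congr 2; push_cast [Fin.val_succ, Fin.val_castSucc]; ring
  have s2 : ∀ (c : ℤ) (e : Fin (M + 1) → Fin (M + 2)),
      (∀ j, ((M + 1 : ℕ) : ℤ) - 2 * (e j : ℕ) = c + M - 2 * (j : ℕ)) →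
      (A.submatrix e Fin.castSucc).det
      = casP F (twist lam) (Fin.cons (α := fun _ => ℕ) a d : Fin (M + 1) → ℕ) (pt F x c) := by
    intro c e he
    unfold casP cas
    congr 1; ext j k
    rw [Matrix.submatrix_apply, Matrix.of_apply, hA, multiMatrix_castSucc, he, pt_pt]
    congr 2; push_cast; ring
  have s3 : ∀ (c : ℤ) (w : ℂ) (e : Fin (M + 1) → Fin (M + 2)),
      (∀ j, ((M + 1 : ℕ) : ℤ) - 2 * (e j : ℕ) = c + M - 2 * (j : ℕ)) →
      (∀ j : Fin (M + 1), rFactor F (M + 1) (e j) lam x = w * rFactor F M j lam (pt F x c)) →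
      (A.submatrix e Fin.succ).det = w * multiDet F lam d n (pt F x c) := by
    intro c w e he hw
    -- The scalar multiplies the last column only, hence the column weights (1, …, 1, w).
    have hlast : w = ∏ k : Fin (M + 1), Fin.snoc (α := fun _ => ℂ) (fun _ : Fin M => 1) w k := by
      rw [Fin.prod_univ_castSucc]; simp
    unfold multiDet
    conv_rhs => rw [hlast]
    rw [← Matrix.det_mul_row]
    congr 1; ext j k
    rw [Matrix.submatrix_apply, Matrix.of_apply, hA]
    refine Fin.lastCases ?_ (fun k => ?_) k
    · rw [Fin.succ_last, multiMatrix_last, multiMatrix_last, Fin.snoc_last, he, hw, pt_pt, mul_assoc,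
        add_sub_assoc]
    · rw [Fin.succ_castSucc, multiMatrix_castSucc, multiMatrix_castSucc, Fin.snoc_castSucc,
        Fin.cons_succ, he, pt_pt, one_mul, add_sub_assoc]
  have hup : ∀ j : Fin (M + 1), ((M + 1 : ℕ) : ℤ) - 2 * (j.castSucc : ℕ) = 1 + M - 2 * (j : ℕ) := by
    intro j; push_cast [Fin.val_castSucc]; ring
  have hdown : ∀ j : Fin (M + 1), ((M + 1 : ℕ) : ℤ) - 2 * (j.succ : ℕ) = -1 + M - 2 * (j : ℕ) := by
    intro j; push_cast [Fin.val_succ]; ring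
  have t1 := s2 1 Fin.castSucc hup
  have t2 := s2 (-1) Fin.succ hdown
  have t3 := s3 1 (C * wt F (shift lam (M + 1)) (-x)) Fin.castSucc hup
    fun j => ((hr j (Nat.lt_succ_iff.1 j.2) x).2.trans (mul_assoc _ _ _).symm)
  have t4 := s3 (-1) (C * wt F (shift lam (M + 1)) x) Fin.succ hdown
    fun j => ((hr j (Nat.lt_succ_iff.1 j.2) x).1.trans (mul_assoc _ _ _).symm)
  rw [s1, t1, t2, t3, t4] at h
  refine Eq.trans h ?_
  ring

end MultiIndexed

/-! ### The duality for generic parameters. -/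

section Duality

variable (F : Family)

/-- Moving the first element of the second summand to the front of the first one. -/
def sumFinShift (r M : ℕ) : Fin (r + 1) ⊕ Fin M ≃ Fin r ⊕ Fin (M + 1) where
  toFun := Sum.elim (Fin.cases (Sum.inr 0) Sum.inl) fun l => Sum.inr l.succ
  invFun := Sum.elim (fun k => Sum.inl k.succ) (Fin.cases (Sum.inl 0) Sum.inr)
  left_inv := by
    rintro (k | l)
    · refine Fin.cases ?_ (fun k => ?_) k <;> simp
    · simp
  right_inv := by
    rintro (k | l)
    · simp
    · refine Fin.cases ?_ (fun k => ?_) l <;> simp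

theorem casP_snoc_complete (lam : Fin 4 → ℂ) (N n : ℕ) (e : Fin (N + 1) ⊕ Fin 0 ≃ Fin (N + 1)) :
    ∃ C : ℂ, C ≠ 0 ∧ ∀ x, casP F lam
      (Fin.snoc (α := fun _ => ℕ) (fun k : Fin (N + 1) => (e (Sum.inl k) : ℕ)) (N + 1 + n)) x
        = C * casP F lam (stairIndex (N + 1) n) x := by
  refine casP_of_range_eq F lam ?_ ?_ ?_
  · refine Fin.snoc_injective_iff.2 ⟨fun k l h => ?_, ?_⟩
    · simpa using e.injective (Fin.ext h)
    · rintro ⟨k, hk⟩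
      have := (e (Sum.inl k)).2
      simp only at hk
      omega
  · intro k l h
    have := k.2
    have := l.2
    simp only [stairIndex] at h
    ext
    split_ifs at h <;> omega
  · ext i
    constructor
    · rintro ⟨k, rfl⟩
      refine Fin.lastCases ⟨Fin.last _, by simp [stairIndex]⟩ (fun k => ?_) k
      refine ⟨(e (Sum.inl k)).castSucc, ?_⟩
      have := (e (Sum.inl k)).2
      simp only [stairIndex, Fin.snoc_castSucc, Fin.val_castSucc]
      rw [if_neg (by omega)]
    · rintro ⟨k, rfl⟩
      refine Fin.lastCases ⟨Fin.last _, by simp [stairIndex]⟩ (fun k => ?_) k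
      obtain ⟨l, rfl⟩ := e.surjective k
      rcases l with l | l
      · refine ⟨l.castSucc, ?_⟩
        have := (e (Sum.inl l)).2
        simp only [stairIndex, Fin.snoc_castSucc, Fin.val_castSucc]
        rw [if_neg (by omega)]
      · exact l.elim0

/-- Moving the first index of D to the complementary side turns `multiDet_desnanot` into
`casP_bilinear`, term by term. The number r of complementary indices changes along the induction and
is therefore generalised. -/
theorem multiDet_duality (lam : Fin 4 → ℂ) (N n : ℕ)
    (hlam : ∀ m : ℤ, 2 - 2 * n ≤ m → m ≤ 2 * N + 2 → ¬ Resonant F lam m) (M r : ℕ)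
    (e : Fin r ⊕ Fin M ≃ Fin (N + 1)) :
    ∃ C : ℂ, C ≠ 0 ∧ ∀ x,
      multiDet F lam (fun l => N - (e (Sum.inr l) : ℕ)) n x * phiM F (r + 1) x
        = C * (casP F (shift lam (N + 1))
          (Fin.snoc (α := fun _ => ℕ) (fun k : Fin r => (e (Sum.inl k) : ℕ)) (N + 1 + n)) x
          * phiM F (M + 1) x) := by
  induction M generalizing r with
  | zero =>
    obtain rfl : r = N + 1 := by simpa using Fintype.card_congr e
    obtain ⟨C₁, hC₁, h₁⟩ := casP_snoc_complete F (shift lam (N + 1)) N n e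
    obtain ⟨C₂, hC₂, h₂⟩ := casP_stairIndex F lam (N + 1) n fun m hm1 hm2 =>
      hlam m (by omega) (by push_cast at hm2; omega)
    refine ⟨(C₁ * C₂)⁻¹, inv_ne_zero (mul_ne_zero hC₁ hC₂), fun x => ?_⟩
    rw [h₁, h₂]
    have : multiDet F lam (fun l => N - (e (Sum.inr l) : ℕ)) n x = PCheck F n lam x := by
      rw [multiDet, Matrix.det_fin_one]
      refine (multiMatrix_last F lam _ n x 0).trans ?_
      simp [rFactor_zero_zero, pt_zero]
    rw [this, phiM_one]
    field_simp
  | succ M ih =>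
    have hcard : r + (M + 1) = N + 1 := by simpa using Fintype.card_congr e
    set e' := (sumFinShift r M).trans e with he'
    have hgen : ∀ m : ℤ, 4 ≤ m → m ≤ 2 * N + 2 → ¬ Resonant F lam m := fun m h1 h2 =>
      hlam m (by omega) h2
    have hgen' : ∀ m : ℤ, 2 - 2 * N ≤ m → m ≤ 0 → ¬ Resonant F (shift lam (N + 1)) m := by
      intro m h1 h2
      rw [resonant_shift]
      exact hgen _ (by push_cast; omega) (by push_cast; omega)
    set a : ℕ := N - (e (Sum.inr 0) : ℕ) with ha
    set d : Fin M → ℕ := fun l => N - (e' (Sum.inr l) : ℕ) with hd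
    -- The list starts with the moved index and ends with N + 1 + n. Its interior is the old
    -- complement, without its last entry it is the complement of the shortened D, and without its
    -- first entry it is the list in the claim.
    set f : Fin (r + 2) → ℕ :=
      Fin.snoc (α := fun _ => ℕ) (fun k : Fin (r + 1) => (e' (Sum.inl k) : ℕ)) (N + 1 + n) with hf
    have hdc : (fun l => N - (e (Sum.inr l) : ℕ)) = (Fin.cons (α := fun _ => ℕ) a d : Fin (M + 1) → ℕ) := by
      funext l
      refine Fin.cases ?_ (fun l => ?_) l <;> simp [ha, hd, he', sumFinShift]
    have hf0 : f 0 = e (Sum.inr 0) := by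
      rw [← Fin.castSucc_zero, hf, Fin.snoc_castSucc]; simp [he', sumFinShift]
    have hfl : f (Fin.last (r + 1)) = N + 1 + n := by rw [hf, Fin.snoc_last]
    have hfm : (fun k : Fin r => f k.castSucc.succ) = fun k => (e (Sum.inl k) : ℕ) := by
      funext k
      rw [Fin.succ_castSucc, hf, Fin.snoc_castSucc]; simp [he', sumFinShift]
    have hfc : (fun k : Fin (r + 1) => f k.castSucc) = fun k => (e' (Sum.inl k) : ℕ) := by
      funext k
      rw [hf, Fin.snoc_castSucc]
    have hfs : (fun k : Fin (r + 1) => f k.succ)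
        = Fin.snoc (α := fun _ => ℕ) (fun k : Fin r => (e (Sum.inl k) : ℕ)) (N + 1 + n) := by
      funext k
      refine Fin.lastCases ?_ (fun k => ?_) k
      · rw [Fin.succ_last, hfl, Fin.snoc_last]
      · rw [Fin.snoc_castSucc]; exact congrFun hfm k
    obtain ⟨c₁, hc₁, h₁⟩ := casP_complement F lam N (r + 1) M e' hgen
    obtain ⟨c₂, hc₂, h₂⟩ := casP_complement F lam N r (M + 1) e hgen
    obtain ⟨c₃, hc₃, h₃⟩ := ih (r + 1) e'
    obtain ⟨C, hC, hA⟩ := multiDet_desnanot F lam a d n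
    rw [hdc] at h₂ ⊢
    rw [← hfc, ← hd] at h₁
    rw [← hf, ← hd] at h₃
    rw [← hfm] at h₂
    rw [← hfs]
    set lb := shift lam (N + 1) with hlb
    set ε := energy F (f 0) lb - energy F (f (Fin.last (r + 1))) lb with hε
    have hε0 : ε ≠ 0 := by
      have hlt := (e (Sum.inr 0)).2
      refine sub_ne_zero.2 (energy_ne F (by omega) ?_)
      rw [hlb, resonant_shift]
      refine hlam _ ?_ ?_ <;> rw [hf0, hfl] <;> push_cast <;> omega
    have hWA : EntireNonzero (casP F lb fun k => f k.castSucc) := by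
      rw [hfc]
      refine entireNonzero_casP F lb N hgen' _ _ (fun k l h => ?_) fun k => ?_
      · simpa using e'.injective (Fin.ext h)
      · exact Nat.lt_succ_iff.1 (e' (Sum.inl k)).2
    -- This factor of the Desnanot-Jacobi identity has to be cancelled; by `h₁` it inherits
    -- nonvanishing from the eigenpolynomial side.
    have hX : EntireNonzero (casP F (twist lam) d) := by
      refine ⟨differentiable_casP F _ _, ?_⟩
      obtain ⟨-, x, hx⟩ := hWA.mul (entireNonzero_phiM F M)
      exact ⟨x, fun h => hx ((h₁ x).trans (by rw [h, zero_mul, mul_zero]))⟩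
    refine ⟨c₂⁻¹ * (-(C * c₃ * c₁ * ε)), mul_ne_zero (inv_ne_zero hc₂) (neg_ne_zero.2
      (mul_ne_zero (mul_ne_zero (mul_ne_zero hC hc₃) hc₁) hε0)), fun x => ?_⟩
    rw [inv_mul_eq_div, div_mul_eq_mul_div, eq_div_iff hc₂]
    have hdL := differentiable_multiDet F lam (Fin.cons (α := fun _ => ℕ) a d : Fin (M + 1) → ℕ) n
    have hdR := differentiable_casP F lb fun k => f k.succ
    have hdq := differentiable_phiM F (r + 1)
    have hdY := differentiable_phiM F (M + 2)
    refine sub_eq_zero.1 (((hX.mul (((entireNonzero_phi_pt F r).mul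
      (entireNonzero_phi_pt F (r + 1))).mul ((entireNonzero_phi_pt F (-r)).mul
      (entireNonzero_phi_pt F (-r - 1))))).mul (entireNonzero_phiM F (r + 1))).cancel
      (f := fun x => multiDet F lam (Fin.cons (α := fun _ => ℕ) a d : Fin (M + 1) → ℕ) n x
        * phiM F (r + 1) x * c₂ - -(C * c₃ * c₁ * ε) * (casP F lb (fun k => f k.succ) x
          * phiM F (M + 1 + 1) x)) (by fun_prop) (fun x => ?_) x)
    have hB := casP_bilinear F lb r f x
    rw [← hε] at hB
    -- As r + (M + 1) = N + 1, the weights of the bilinear identity are those of the Desnanot-Jacobi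
    -- identity.
    have hw1 : wt F lb (pt F x (-r)) = wt F (shift lam (M + 1)) x := by
      rw [hlb, wt_shift, wt_shift, pt_pt]
      congr 2; omega
    have hw2 : wt F lb (-pt F x r) = wt F (shift lam (M + 1)) (-x) := by
      rw [hlb, wt_shift, wt_shift, neg_pt, pt_pt]
      congr 2; omega
    rw [hw1, hw2] at hB
    have up := phiM_shift_up F r x 0
    have down := phiM_shift_down F r x 0
    have bil := phiM_bilinear F M x 0
    simp only [zero_add, zero_sub, pt_zero] at up down bil
    -- The induction hypothesis at one half-shifted centre and the complementary determinant at the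
    -- other match one term on each side; `t2` is the mirror image.
    have t1 : c₂ * multiDet F lam d n (pt F x (-1))
          * casP F (twist lam) (Fin.cons (α := fun _ => ℕ) a d : Fin (M + 1) → ℕ) (pt F x 1)
          * (phi F (pt F x (-r)) * phi F (pt F x (-r - 1)) * phiM F (r + 1) x ^ 2)
        = c₃ * casP F lb f (pt F x (-1)) * casP F lb (fun k : Fin r => f k.castSucc.succ) (pt F x 1)
          * (phiM F (M + 2) x * phiM F M x) := by
      have i1 := h₂ (pt F x 1)
      have i2 := h₃ (pt F x (-1))
      linear_combination (-(c₂ * multiDet F lam d n (pt F x (-1))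
          * casP F (twist lam) (Fin.cons (α := fun _ => ℕ) a d : Fin (M + 1) → ℕ) (pt F x 1))) * down
        + (c₂ * casP F (twist lam) (Fin.cons (α := fun _ => ℕ) a d : Fin (M + 1) → ℕ) (pt F x 1)
          * phiM F r (pt F x 1) * phi F x) * i2
        - (c₃ * casP F lb f (pt F x (-1)) * phiM F (M + 1) (pt F x (-1)) * phi F x) * i1
        - (c₃ * casP F lb f (pt F x (-1))
          * casP F lb (fun k : Fin r => f k.castSucc.succ) (pt F x 1)) * bil
    have t2 : c₂ * multiDet F lam d n (pt F x 1)
          * casP F (twist lam) (Fin.cons (α := fun _ => ℕ) a d : Fin (M + 1) → ℕ) (pt F x (-1))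
          * (phi F (pt F x r) * phi F (pt F x (r + 1)) * phiM F (r + 1) x ^ 2)
        = c₃ * casP F lb f (pt F x 1) * casP F lb (fun k : Fin r => f k.castSucc.succ) (pt F x (-1))
          * (phiM F (M + 2) x * phiM F M x) := by
      have i1 := h₂ (pt F x (-1))
      have i2 := h₃ (pt F x 1)
      linear_combination (-(c₂ * multiDet F lam d n (pt F x 1)
          * casP F (twist lam) (Fin.cons (α := fun _ => ℕ) a d : Fin (M + 1) → ℕ) (pt F x (-1)))) * up
        + (c₂ * casP F (twist lam) (Fin.cons (α := fun _ => ℕ) a d : Fin (M + 1) → ℕ) (pt F x (-1))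
          * phiM F r (pt F x (-1)) * phi F x) * i2
        - (c₃ * casP F lb f (pt F x 1) * phiM F (M + 1) (pt F x 1) * phi F x) * i1
        - (c₃ * casP F lb f (pt F x 1)
          * casP F lb (fun k : Fin r => f k.castSucc.succ) (pt F x (-1))) * bil
    have hA' := hA x
    have h₁' := h₁ x
    generalize phi F (pt F x r) * phi F (pt F x (r + 1)) = pp at *
    generalize phi F (pt F x (-r)) * phi F (pt F x (-r - 1)) = pm at *
    linear_combination (c₂ * pp * pm * phiM F (r + 1) x ^ 2) * hA'
      + (C * wt F (shift lam (M + 1)) x * pp) * t1 - (C * wt F (shift lam (M + 1)) (-x) * pm) * t2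
      - (C * c₃ * phiM F (M + 2) x * phiM F M x) * hB
      - (C * c₃ * phiM F (M + 2) x * ε * pp * pm * casP F lb (fun k => f k.succ) x) * h₁'

end Duality

/-! ### Continuity in λ and perturbation to generic parameters. -/

section Perturbation

open Filter Topology

variable (F : Family)

theorem continuous_param (k : Fin 4) : Continuous fun lam : Fin 4 → ℂ => param F lam k := by
  cases F with
  | wilson => exact continuous_apply k
  | askeyWilson q h₀ h₁ =>
    simp only [param, cpow_eq_exp h₀]
    fun_prop

theorem continuous_PCheck (n : ℕ) (x : ℂ) : Continuous fun lam => PCheck F n lam x := by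
  have h := continuous_param F
  cases F with
  | wilson =>
    simp only [PCheck, eigenPoly, wilsonPoly, Polynomial.eval_finsetSum, Polynomial.eval_mul,
      Polynomial.eval_C, Polynomial.eval_prod, Polynomial.eval_add, Polynomial.eval_X, poch]
    fun_prop
  | askeyWilson q h₀ h₁ =>
    have h0 : ∀ lam : Fin 4 → ℂ, param (.askeyWilson q h₀ h₁) lam 0 ^ n ≠ 0 := fun lam =>
      pow_ne_zero _ (by simp only [param, cpow_eq_exp h₀]; exact Complex.exp_ne_zero _)
    have h1 := ((h 0).pow n).inv₀ h0
    simp only [PCheck, eigenPoly, askeyWilsonPoly, Polynomial.eval_finsetSum, Polynomial.eval_mul,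
      Polynomial.eval_C, Polynomial.eval_prod, Polynomial.eval_add, Polynomial.eval_sub,
      Polynomial.eval_one, Polynomial.eval_X, qpoch, div_eq_mul_inv]
    fun_prop

theorem continuous_shift (s : ℕ) : Continuous fun lam : Fin 4 → ℂ => shift lam s := by
  unfold shift
  fun_prop

theorem continuous_twist : Continuous twist := by
  unfold twist
  fun_prop

theorem continuous_rFactor (M s : ℕ) (x : ℂ) : Continuous fun lam => rFactor F M s lam x := by
  have h : ∀ k, Continuous fun lam : Fin 4 → ℂ => param F (shift lam M) k := fun k =>
    (continuous_param F k).comp (continuous_shift M)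
  cases F with
  | wilson => simp only [rFactor, poch]; fun_prop
  | askeyWilson q h₀ h₁ => simp only [rFactor, qpoch]; fun_prop

theorem continuous_casP {m : ℕ} (f : Fin m → ℕ) (x : ℂ) : Continuous fun lam => casP F lam f x :=
  Continuous.matrix_det (continuous_matrix fun _ k => continuous_PCheck F (f k) _)

theorem continuous_multiDet {M : ℕ} (d : Fin M → ℕ) (n : ℕ) (x : ℂ) :
    Continuous fun lam => multiDet F lam d n x := by
  refine Continuous.matrix_det (continuous_matrix fun j k => ?_)
  refine Fin.lastCases ?_ (fun k => ?_) k
  · simp only [multiMatrix_last]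
    exact (continuous_rFactor F M j x).mul (continuous_PCheck F n _)
  · simp only [multiMatrix_castSucc]
    exact (continuous_PCheck F (d k) _).comp continuous_twist

/-- The parameters with `t` added to the first one. -/
noncomputable def perturb (lam : Fin 4 → ℂ) (t : ℝ) : Fin 4 → ℂ :=
  fun k => lam k + if k = 0 then (t : ℂ) else 0

theorem continuous_perturb (lam : Fin 4 → ℂ) : Continuous (perturb lam) := by
  refine continuous_pi fun k => ?_
  unfold perturb
  split_ifs <;> fun_prop

theorem perturb_zero (lam : Fin 4 → ℂ) : perturb lam 0 = lam := by
  funext k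
  simp [perturb]

theorem sum_perturb (lam : Fin 4 → ℂ) (t : ℝ) : ∑ k, perturb lam t k = (∑ k, lam k) + t := by
  simp [perturb, Finset.sum_add_distrib]

/-- In the Askey-Wilson case the absolute value of a₁a₂a₃a₄ is strictly monotone in the real number
t; hence finitely many resonances exclude finitely many t. -/
theorem resonant_perturb_unique (lam : Fin 4 → ℂ) (m : ℤ) {t t' : ℝ}
    (h : Resonant F (perturb lam t) m) (h' : Resonant F (perturb lam t') m) : t = t' := by
  cases F with
  | wilson =>
    simp only [Resonant, param, sum_perturb] at h h'
    exact_mod_cast add_left_cancel (h.trans h'.symm)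
  | askeyWilson q h₀ h₁ =>
    simp only [Resonant] at h h'
    rw [prod_param_shift, sum_perturb] at h h'
    have := congrArg norm (h.trans h'.symm)
    rw [Complex.norm_exp, Complex.norm_exp] at this
    have := Real.exp_injective this
    simp only [Complex.mul_re, Complex.ofReal_re, Complex.ofReal_im, zero_mul, sub_zero,
      Complex.add_re] at this
    exact add_left_cancel (mul_left_cancel₀ (Real.log_neg h₀ h₁).ne this)

theorem eventually_not_resonant (lam : Fin 4 → ℂ) (lo hi : ℤ) :
    ∀ᶠ t in 𝓝[≠] (0 : ℝ), ∀ m, lo ≤ m → m ≤ hi → ¬ Resonant F (perturb lam t) m := by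
  have h : ∀ m ∈ Finset.Icc lo hi, ∀ᶠ t in 𝓝[≠] (0 : ℝ), ¬ Resonant F (perturb lam t) m := by
    intro m _
    by_cases hm : ∃ t, Resonant F (perturb lam t) m
    · obtain ⟨t₀, ht₀⟩ := hm
      have : ∀ᶠ t in 𝓝[≠] (0 : ℝ), t ≠ t₀ := by
        rcases eq_or_ne t₀ 0 with rfl | h0
        · exact eventually_mem_nhdsWithin
        · exact (eventually_ne_nhds h0.symm).filter_mono nhdsWithin_le_nhds
      filter_upwards [this] with t ht h
      exact ht (resonant_perturb_unique F lam m h ht₀)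
    · exact Eventually.of_forall fun t ht => hm ⟨t, ht⟩
  filter_upwards [(eventually_all_finset _).2 h] with t ht m h1 h2
  exact ht m (Finset.mem_Icc.2 ⟨h1, h2⟩)

theorem tendsto_perturb {g : (Fin 4 → ℂ) → ℂ} (hg : Continuous g) (lam : Fin 4 → ℂ) :
    Tendsto (fun t => g (perturb lam t)) (𝓝[≠] 0) (𝓝 (g lam)) := by
  have := (hg.comp (continuous_perturb lam)).tendsto 0
  simp only [Function.comp_apply, perturb_zero] at this
  exact this.mono_left nhdsWithin_le_nhds

end Perturbation

/-! ### Passage from generic to arbitrary parameters. -/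

section Closure

open Filter Topology

variable (F : Family)

theorem eq_of_eval_eta_eq {p r : Polynomial ℂ} (h : ∀ x, p.eval (eta F x) = r.eval (eta F x)) :
    p = r :=
  isPolyPart_unique F 0 (fun x => p.eval (eta F x)) p r (fun x => by simp)
    (fun x => by simp [h x])

/-- The cross-multiplied equation contains no proportionality constant, so it survives a limit even
if that constant does not converge to a nonzero number. -/
theorem linearlyDependent_of_cross {p r : Polynomial ℂ}
    (h : ∀ x y, p.eval (eta F x) * r.eval (eta F y) = p.eval (eta F y) * r.eval (eta F x)) :
    LinearlyDependent p r := by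
  by_cases hr : ∃ y, r.eval (eta F y) ≠ 0
  · obtain ⟨y, hy⟩ := hr
    refine ⟨r.eval (eta F y), p.eval (eta F y), Or.inl hy, eq_of_eval_eta_eq F fun x => ?_⟩
    simp only [Polynomial.eval_mul, Polynomial.eval_C]
    rw [mul_comm, h]
  · push Not at hr
    have : r = 0 := eq_of_eval_eta_eq F fun x => by simp [hr x]
    exact ⟨0, 1, Or.inr one_ne_zero, by simp [this]⟩

/-- Two families of determinants, continuous in the parameters and proportional for generic
parameters. -/
structure GenericallyProportional (g h : (Fin 4 → ℂ) → ℂ → ℂ) (M₁ M₂ : ℕ) (lo hi : ℤ) : Prop where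
  continuous_left : ∀ x, Continuous fun lam => g lam x
  continuous_right : ∀ x, Continuous fun lam => h lam x
  proportional : ∀ lam, (∀ m, lo ≤ m → m ≤ hi → ¬ Resonant F lam m) →
    ∃ C : ℂ, C ≠ 0 ∧ ∀ x, g lam x * phiM F M₂ x = C * (h lam x * phiM F M₁ x)

variable {F} in
theorem GenericallyProportional.const_mul {g h : (Fin 4 → ℂ) → ℂ → ℂ} {M₁ M₂ : ℕ} {lo hi : ℤ}
    (H : GenericallyProportional F g h M₁ M₂ lo hi) {a b : ℂ} (ha : a ≠ 0) (hb : b ≠ 0) :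
    GenericallyProportional F (fun lam x => a * g lam x) (fun lam x => b * h lam x) M₁ M₂ lo hi where
  continuous_left x := continuous_const.mul (H.continuous_left x)
  continuous_right x := continuous_const.mul (H.continuous_right x)
  proportional lam hlam := by
    obtain ⟨C, hC, hgh⟩ := H.proportional lam hlam
    refine ⟨a * C / b, div_ne_zero (mul_ne_zero ha hC) hb, fun x => ?_⟩
    field_simp
    linear_combination hgh x

variable {F} in
theorem GenericallyProportional.linearlyDependent {g h : (Fin 4 → ℂ) → ℂ → ℂ} {M₁ M₂ : ℕ}
    {lo hi : ℤ} (H : GenericallyProportional F g h M₁ M₂ lo hi) {lam : Fin 4 → ℂ}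
    {p r : Polynomial ℂ} (hp : IsPolyPart F M₁ (g lam) p) (hr : IsPolyPart F M₂ (h lam) r) :
    LinearlyDependent p r ∧ (Generic F lam lo hi → ∃ c : ℂ, c ≠ 0 ∧ p = Polynomial.C c * r) := by
  have hΦ := (entireNonzero_phiM F M₁).mul (entireNonzero_phiM F M₂)
  have hdp := differentiable_eval_eta F p
  have hdr := differentiable_eval_eta F r
  constructor
  · refine linearlyDependent_of_cross F ?_
    have key : ∀ x y, g lam x * phiM F M₂ x * (h lam y * phiM F M₁ y)
        = g lam y * phiM F M₂ y * (h lam x * phiM F M₁ x) := by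
      intro x y
      refine tendsto_nhds_unique_of_eventuallyEq
        (tendsto_perturb (g := fun lam => g lam x * phiM F M₂ x * (h lam y * phiM F M₁ y))
          (((H.continuous_left x).mul continuous_const).mul
            ((H.continuous_right y).mul continuous_const)) lam)
        (tendsto_perturb (g := fun lam => g lam y * phiM F M₂ y * (h lam x * phiM F M₁ x))
          (((H.continuous_left y).mul continuous_const).mul
            ((H.continuous_right x).mul continuous_const)) lam) ?_
      filter_upwards [eventually_not_resonant F lam lo hi] with t ht
      obtain ⟨C, -, hC⟩ := H.proportional _ ht
      rw [hC, hC]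
      ring
    have step : ∀ x y, (p.eval (eta F x) * r.eval (eta F y) - p.eval (eta F y) * r.eval (eta F x))
        * (phiM F M₁ y * phiM F M₂ y) = 0 := by
      intro x y
      refine hΦ.cancel (f := fun x => (p.eval (eta F x) * r.eval (eta F y)
        - p.eval (eta F y) * r.eval (eta F x)) * (phiM F M₁ y * phiM F M₂ y)) (by fun_prop)
        (fun x => ?_) x
      have := key x y
      rw [← hp x, ← hp y, ← hr x, ← hr y] at this
      linear_combination this
    intro x y
    exact sub_eq_zero.1 (hΦ.cancel (f := fun y => p.eval (eta F x) * r.eval (eta F y)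
      - p.eval (eta F y) * r.eval (eta F x)) (by fun_prop) (step x) y)
  · intro hgen
    obtain ⟨C, hC, hgh⟩ := H.proportional lam ((generic_iff F lam lo hi).1 hgen)
    refine ⟨C, hC, eq_of_eval_eta_eq F fun x => ?_⟩
    simp only [Polynomial.eval_mul, Polynomial.eval_C]
    refine sub_eq_zero.1 (hΦ.cancel (f := fun x => p.eval (eta F x) - C * r.eval (eta F x))
      (by fun_prop) (fun x => ?_) x)
    have := hgh x
    rw [← hp x, ← hr x] at this
    linear_combination this

variable {F} in
-- For generic parameters near λ, proportionality puts the left-hand function into the span of the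
-- φ_{M₁} Q_i(η). The Q_i do not depend on the parameters, so this is one finite-dimensional space,
-- closed under pointwise limits, and the function at λ lies in it too.
theorem GenericallyProportional.exists_left {g h : (Fin 4 → ℂ) → ℂ → ℂ} {M₁ M₂ : ℕ}
    {lo hi : ℤ} (H : GenericallyProportional F g h M₁ M₂ lo hi)
    (hg : ∀ lam, Differentiable ℂ (g lam)) {ι : Type*} [Fintype ι] (Q : ι → Polynomial ℂ)
    (hh : ∀ lam, ∃ a : ι → ℂ, ∀ x, h lam x = ∑ i, a i * (phiM F M₂ x * (Q i).eval (eta F x)))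
    (lam : Fin 4 → ℂ) : ∃ p, IsPolyPart F M₁ (g lam) p := by
  let b : ι → ℂ → ℂ := fun i x => phiM F M₁ x * (Q i).eval (eta F x)
  have hmem : g lam ∈ Submodule.span ℂ (Set.range b) := by
    have : FiniteDimensional ℂ (Submodule.span ℂ (Set.range b)) :=
      FiniteDimensional.span_of_finite ℂ (Set.finite_range b)
    refine (Submodule.closed_of_finiteDimensional (Submodule.span ℂ (Set.range b))).mem_of_tendsto
      (b := 𝓝[≠] (0 : ℝ)) (f := fun t => g (perturb lam t))
      (tendsto_pi_nhds.2 fun x => tendsto_perturb (H.continuous_left x) lam) ?_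
    filter_upwards [eventually_not_resonant F lam lo hi] with t ht
    obtain ⟨C, -, hC⟩ := H.proportional _ ht
    obtain ⟨a, ha⟩ := hh (perturb lam t)
    have : g (perturb lam t) = ∑ i, (C * a i) • b i := by
      funext x
      have hd := hg (perturb lam t)
      have hd1 := differentiable_phiM F M₁
      have hd2 : ∀ i, Differentiable ℂ fun x => (Q i).eval (eta F x) := fun i =>
        differentiable_eval_eta F _
      refine sub_eq_zero.1 ((entireNonzero_phiM F M₂).cancel (f := fun x => g (perturb lam t) x
        - (∑ i, (C * a i) • b i) x) ?_ (fun x => ?_) x)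
      · simp only [Finset.sum_apply, Pi.smul_apply, smul_eq_mul, b]
        fun_prop
      · rw [sub_mul, hC, ha, sub_eq_zero, Finset.sum_apply, Finset.sum_mul, Finset.sum_mul,
          Finset.mul_sum]
        refine Finset.sum_congr rfl fun i _ => ?_
        simp only [Pi.smul_apply, smul_eq_mul, b]
        ring
    change g (perturb lam t) ∈ Submodule.span ℂ (Set.range b)
    rw [this]
    exact Submodule.sum_mem _ fun i _ => Submodule.smul_mem _ _ (Submodule.subset_span ⟨i, rfl⟩)
  obtain ⟨c, hc⟩ := (Submodule.mem_span_range_iff_exists_fun ℂ).1 hmem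
  refine ⟨∑ i, Polynomial.C (c i) * Q i, fun x => ?_⟩
  rw [← hc, Polynomial.eval_finsetSum, Finset.mul_sum, Finset.sum_apply]
  refine Finset.sum_congr rfl fun i _ => ?_
  simp only [Pi.smul_apply, smul_eq_mul, b, Polynomial.eval_mul, Polynomial.eval_C]
  ring

theorem natDegree_eigenPoly_le (n : ℕ) (lam : Fin 4 → ℂ) : (eigenPoly F n lam).natDegree ≤ n := by
  have h : ∀ (k : ℕ) (f : ℕ → Polynomial ℂ), k ∈ Finset.range (n + 1) →
      (∀ i, (f i).natDegree ≤ 1) → (∏ i ∈ Finset.range k, f i).natDegree ≤ n := by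
    intro k f hk hf
    refine (Polynomial.natDegree_prod_le _ _).trans ((Finset.sum_le_sum fun i _ => hf i).trans ?_)
    simpa [Nat.lt_succ_iff] using hk
  cases F with
  | wilson =>
    refine Polynomial.natDegree_sum_le_of_forall_le _ _ fun k hk =>
      (Polynomial.natDegree_C_mul_le _ _).trans (h k _ hk fun i => ?_)
    compute_degree
  | askeyWilson q h₀ h₁ =>
    refine Polynomial.natDegree_sum_le_of_forall_le _ _ fun k hk =>
      (Polynomial.natDegree_C_mul_le _ _).trans (h k _ hk fun i => ?_)
    compute_degree

/-- Multilinearity in the columns reduces the determinant to monomials in η. Only the coefficients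
depend on λ, which provides the fixed family needed in `GenericallyProportional.exists_left`. -/
theorem casP_expansion {m : ℕ} (f : Fin m → ℕ) : ∃ (B : ℕ) (Q : (Fin m → Fin B) → Polynomial ℂ),
    ∀ lam, ∃ a : (Fin m → Fin B) → ℂ, ∀ x,
      casP F lam f x = ∑ i, a i * (phiM F m x * (Q i).eval (eta F x)) := by
  choose Q hQ using fun r : Fin m → Fin (∑ k, f k + 1) =>
    exists_polyPart F fun k => (Polynomial.X ^ (r k : ℕ) : Polynomial ℂ)
  refine ⟨∑ k, f k + 1, Q, fun lam =>
    ⟨fun r => ∏ k, (eigenPoly F (f k) lam).coeff (r k), fun x => ?_⟩⟩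
  have hP : ∀ k y, PCheck F (f k) lam y
      = ∑ i : Fin (∑ k, f k + 1), (eigenPoly F (f k) lam).coeff i * eta F y ^ (i : ℕ) := by
    intro k y
    rw [PCheck, Polynomial.eval_eq_sum_range' (n := ∑ k, f k + 1)
      (Nat.lt_succ_of_le ((natDegree_eigenPoly_le F (f k) lam).trans
        (Finset.single_le_sum (fun _ _ => Nat.zero_le _) (Finset.mem_univ k)))), Finset.sum_range]
  have h1 : casP F lam f x = Matrix.detRowAlternating (fun k : Fin m =>
      ∑ i : Fin (∑ k, f k + 1), (eigenPoly F (f k) lam).coeff i •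
        fun j : Fin m => eta F (pt F x (m - 1 - 2 * (j : ℤ))) ^ (i : ℕ)) := by
    unfold casP cas
    rw [← Matrix.det_transpose]
    change Matrix.det _ = Matrix.det _
    congr 1; ext k j
    simp only [Matrix.transpose_apply, Matrix.of_apply, hP, Finset.sum_apply, Pi.smul_apply,
      smul_eq_mul]
  rw [h1, ← AlternatingMap.coe_multilinearMap, MultilinearMap.map_sum]
  refine Finset.sum_congr rfl fun r _ => ?_
  rw [MultilinearMap.map_smul_univ, smul_eq_mul, ← hQ]
  congr 1
  simp only [Polynomial.eval_pow, Polynomial.eval_X]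
  exact Matrix.det_transpose _

end Closure

/-! ### From lists of indices to splittings of {0, …, N}. -/

section IndexLists

variable (F : Family)

theorem exists_complement_equiv {N : ℕ} {S T : List ℕ} (hS : S.Nodup) (hT : T.Nodup)
    (hTN : ∀ t ∈ T, t ≤ N) (h : ∀ i, i ∈ S ↔ i ≤ N ∧ ∀ t ∈ T, i ≠ N - t) :
    ∃ e : Fin S.length ⊕ Fin T.length ≃ Fin (N + 1),
      (fun k => (e (Sum.inl k) : ℕ)) = S.get ∧ (fun l => N - (e (Sum.inr l) : ℕ)) = T.get := by
  let u : Fin S.length ⊕ Fin T.length → Fin (N + 1) := Sum.elim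
    (fun k => ⟨S.get k, Nat.lt_succ_of_le ((h _).1 (S.get_mem k)).1⟩)
    (fun l => ⟨N - T.get l, Nat.lt_succ_of_le (Nat.sub_le _ _)⟩)
  have hu : Function.Bijective u := by
    constructor
    · rintro (k | k) (l | l) hkl
      · exact congrArg _ (hS.injective_get (Fin.mk.inj hkl))
      · exact absurd (Fin.mk.inj hkl) (((h _).1 (S.get_mem k)).2 _ (T.get_mem l))
      · exact absurd (Fin.mk.inj hkl).symm (((h _).1 (S.get_mem l)).2 _ (T.get_mem k))
      · have h1 := Fin.mk.inj hkl
        have h2 := hTN _ (T.get_mem k)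
        have h3 := hTN _ (T.get_mem l)
        exact congrArg _ (hT.injective_get (by omega))
    · rintro ⟨i, hi⟩
      by_cases hiS : i ∈ S
      · obtain ⟨k, hk⟩ := List.get_of_mem hiS
        exact ⟨Sum.inl k, Fin.ext hk⟩
      · rw [h] at hiS
        push Not at hiS
        obtain ⟨t, ht, rfl⟩ := hiS (Nat.lt_succ_iff.1 hi)
        obtain ⟨l, rfl⟩ := List.get_of_mem ht
        exact ⟨Sum.inr l, rfl⟩
  refine ⟨Equiv.ofBijective u hu, rfl, funext fun l => ?_⟩
  exact Nat.sub_sub_self (hTN _ (T.get_mem l))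

theorem mem_dualIndex (D : List ℕ) (N i : ℕ) :
    i ∈ dualIndex D N ↔ i ≤ N ∧ ∀ d ∈ D, i ≠ N - d := by
  simp [dualIndex, eq_comm]

theorem nodup_dualIndex (D : List ℕ) (N : ℕ) : (dualIndex D N).Nodup :=
  List.nodup_range.filter _

theorem casP_cast (lam : Fin 4 → ℂ) {m m' : ℕ} (h : m' = m) (f : Fin m → ℕ) (x : ℂ) :
    casP F lam (fun k : Fin m' => f (k.cast h)) x = casP F lam f x := by
  subst h
  rfl

theorem casP_get_append_singleton (lam : Fin 4 → ℂ) (S : List ℕ) (a : ℕ) (x : ℂ) :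
    casP F lam (S ++ [a]).get x = casP F lam (Fin.snoc (α := fun _ => ℕ) S.get a) x := by
  rw [← casP_cast F lam (by simp : S.length + 1 = (S ++ [a]).length)]
  congr 1
  funext k
  refine Fin.lastCases ?_ (fun k => ?_) k <;> simp

theorem isXiBar_iff (L : List ℕ) (lam : Fin 4 → ℂ) (p : Polynomial ℂ) : IsXiBar F L lam p ↔
    IsPolyPart F L.length (fun x => Complex.I ^ (L.length * (L.length - 1) / 2)
      * casP F lam L.get x) p := by
  simp only [IsXiBar, IsPolyPart, casoratian, node_eq_pt, casP, cas]

theorem isXi_iff (L : List ℕ) (lam : Fin 4 → ℂ) (p : Polynomial ℂ) : IsXi F L lam p ↔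
    IsPolyPart F L.length (fun x => Complex.I ^ (L.length * (L.length - 1) / 2)
      * casP F (twist lam) L.get x) p := by
  simp only [IsXi, IsPolyPart, casoratian, xiCheck, node_eq_pt, casP, cas]

theorem isMultiIndexed_iff (D : List ℕ) (n : ℕ) (lam : Fin 4 → ℂ) (p : Polynomial ℂ) :
    IsMultiIndexed F D n lam p ↔ IsPolyPart F (D.length + 1)
      (fun x => Complex.I ^ (D.length * (D.length + 1) / 2) * multiDet F lam D.get n x) p := by
  have h : ∀ j : ℕ, ((D.length + 1 : ℕ) : ℤ) - 1 - 2 * (j : ℤ) = D.length - 2 * (j : ℤ) := by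
    intro j; push_cast; ring
  simp only [IsMultiIndexed, IsPolyPart, xiCheck, node_eq_pt, multiDet, multiMatrix, h]

theorem exists_isPolyPart_casP (lam : Fin 4 → ℂ) {m : ℕ} (f : Fin m → ℕ) (c : ℂ) :
    ∃ p, IsPolyPart F m (fun x => c * casP F lam f x) p := by
  obtain ⟨p, hp⟩ := exists_polyPart F fun k => eigenPoly F (f k) lam
  refine ⟨Polynomial.C c * p, fun x => ?_⟩
  rw [Polynomial.eval_mul, Polynomial.eval_C, mul_left_comm, ← hp]
  rfl

theorem genericallyProportional_multiDet {D : List ℕ} (hD : D.Nodup) {N : ℕ}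
    (hN : ∀ d ∈ D, d ≤ N) (n : ℕ) :
    GenericallyProportional F (fun lam x => multiDet F lam D.get n x)
      (fun lam x => casP F (shift lam (N + 1)) (dualIndex D N ++ [N + 1 + n]).get x)
      (D.length + 1) (dualIndex D N ++ [N + 1 + n]).length (2 - 2 * n) (2 * N + 2) where
  continuous_left x := continuous_multiDet F D.get n x
  continuous_right x := (continuous_casP F _ x).comp (continuous_shift (N + 1))
  proportional lam hlam := by
    obtain ⟨e, he1, he2⟩ := exists_complement_equiv (nodup_dualIndex D N) hD hN (mem_dualIndex D N)
    obtain ⟨C, hC, h⟩ := multiDet_duality F lam N n hlam _ _ e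
    rw [he1, he2] at h
    refine ⟨C, hC, fun x => ?_⟩
    rw [casP_get_append_singleton, List.length_append, List.length_singleton, h]

theorem genericallyProportional_casP {S T : List ℕ} {N : ℕ} (hS : S.Nodup) (hT : T.Nodup)
    (hTN : ∀ t ∈ T, t ≤ N) (h : ∀ i, i ∈ S ↔ i ≤ N ∧ ∀ t ∈ T, i ≠ N - t) :
    GenericallyProportional F (fun lam x => casP F (twist lam) T.get x)
      (fun lam x => casP F (shift lam (N + 1)) S.get x) T.length S.length 4 (2 * N + 2) where
  continuous_left x := (continuous_casP F _ x).comp continuous_twist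
  continuous_right x := (continuous_casP F _ x).comp (continuous_shift (N + 1))
  proportional lam hlam := by
    obtain ⟨e, he1, he2⟩ := exists_complement_equiv hS hT hTN h
    obtain ⟨C, hC, h⟩ := casP_complement F lam N _ _ e hlam
    rw [he1, he2] at h
    refine ⟨C⁻¹, inv_ne_zero hC, fun x => ?_⟩
    rw [h, inv_mul_cancel_left₀ hC]

theorem mem_dualIndex_append_iff {D : List ℕ} (hD : D.Nodup) {N : ℕ} (hN : ∀ d ∈ D, d ≤ N)
    {j : ℕ} (hj : j < D.length) (i : ℕ) :
    i ∈ dualIndex D N ++ [N - D[j]] ↔ i ≤ N ∧ ∀ t ∈ D.eraseIdx j, i ≠ N - t := by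
  have hmem : ∀ t, t ∈ D.eraseIdx j ↔ t ≠ D[j] ∧ t ∈ D := fun t => by
    rw [← hD.erase_getElem j hj, hD.mem_erase_iff]
  rw [List.mem_append, List.mem_singleton, mem_dualIndex]
  constructor
  · rintro (⟨h1, h2⟩ | rfl)
    · exact ⟨h1, fun t ht => h2 t ((hmem t).1 ht).2⟩
    · refine ⟨Nat.sub_le _ _, fun t ht h => ((hmem t).1 ht).1 ?_⟩
      have h1 := hN t ((hmem t).1 ht).2
      have h2 := hN D[j] (List.getElem_mem hj)
      omega
  · rintro ⟨h1, h2⟩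
    by_cases h : i = N - D[j]
    · exact Or.inr h
    · refine Or.inl ⟨h1, fun d hd => ?_⟩
      by_cases hdj : d = D[j]
      · rwa [hdj]
      · exact h2 d ((hmem d).2 ⟨hdj, hd⟩)

end IndexLists

end CasoratianDuality

/-! ### The duality theorem. -/

theorem mainTheorem3 (F : CasoratianDuality.Family) (lam : Fin 4 → ℂ)
    (D : List ℕ) (hD : D.Nodup) (N : ℕ) (hN : ∀ d ∈ D, d ≤ N) :
    (∀ n : ℕ, ∃ p r : Polynomial ℂ,
      CasoratianDuality.IsMultiIndexed F D n lam p ∧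
      CasoratianDuality.IsXiBar F (CasoratianDuality.dualIndex D N ++ [N + 1 + n])
        (CasoratianDuality.shift lam (N + 1)) r ∧
      CasoratianDuality.LinearlyDependent p r ∧
      (CasoratianDuality.Generic F lam (2 - 2 * n) (2 * N + 2) →
        ∃ c : ℂ, c ≠ 0 ∧ p = Polynomial.C c * r)) ∧
    (∀ (j : ℕ) (hj : j < D.length), ∃ p r : Polynomial ℂ,
      CasoratianDuality.IsXi F (D.eraseIdx j) lam p ∧
      CasoratianDuality.IsXiBar F (CasoratianDuality.dualIndex D N ++ [N - D[j]])
        (CasoratianDuality.shift lam (N + 1)) r ∧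
      CasoratianDuality.LinearlyDependent p r ∧
      (CasoratianDuality.Generic F lam 4 (2 * N + 2) →
        ∃ c : ℂ, c ≠ 0 ∧ p = Polynomial.C c * r)) := by
  open CasoratianDuality in
  have hI : ∀ k : ℕ, Complex.I ^ k ≠ 0 := fun k => pow_ne_zero k Complex.I_ne_zero
  simp only [isXi_iff, isXiBar_iff, isMultiIndexed_iff]
  refine ⟨fun n => ?_, fun j hj => ?_⟩
  · have H := genericallyProportional_multiDet F hD hN n
    obtain ⟨B, Q, hQ⟩ := casP_expansion F (dualIndex D N ++ [N + 1 + n]).get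
    -- Existence of P_{D,n} is inherited from the Casorati determinant to which it is generically
    -- proportional.
    obtain ⟨p, hp⟩ := (H.const_mul (hI (D.length * (D.length + 1) / 2)) one_ne_zero).exists_left
      (fun lam => (differentiable_multiDet F lam D.get n).const_mul _) Q
      (fun lam => by simpa only [one_mul] using hQ (shift lam (N + 1))) lam
    obtain ⟨r, hr⟩ := exists_isPolyPart_casP F (shift lam (N + 1)) (dualIndex D N ++ [N + 1 + n]).get
      (Complex.I ^ ((dualIndex D N ++ [N + 1 + n]).length
        * ((dualIndex D N ++ [N + 1 + n]).length - 1) / 2))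
    exact ⟨p, r, hp, hr, (H.const_mul (hI _) (hI _)).linearlyDependent hp hr⟩
  -- Adding N - d_j to D̄ gives the index set dual to D without d_j, so (2) is an instance of
  -- `casP_complement`.
  · have hmem := mem_dualIndex_append_iff hD hN hj
    have hnodup : (dualIndex D N ++ [N - D[j]]).Nodup := by
      rw [← List.concat_eq_append]
      refine (nodup_dualIndex D N).concat fun h => ?_
      exact ((mem_dualIndex D N _).1 h).2 _ (List.getElem_mem hj) rfl
    have H := genericallyProportional_casP F hnodup (hD.eraseIdx j)
      (fun t ht => hN t (List.mem_of_mem_eraseIdx ht)) hmem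
    obtain ⟨p, hp⟩ := exists_isPolyPart_casP F (twist lam) (D.eraseIdx j).get
      (Complex.I ^ ((D.eraseIdx j).length * ((D.eraseIdx j).length - 1) / 2))
    obtain ⟨r, hr⟩ := exists_isPolyPart_casP F (shift lam (N + 1)) (dualIndex D N ++ [N - D[j]]).get
      (Complex.I ^ ((dualIndex D N ++ [N - D[j]]).length
        * ((dualIndex D N ++ [N - D[j]]).length - 1) / 2))
    exact ⟨p, r, hp, hr, (H.const_mul (hI _) (hI _)).linearlyDependent hp hr⟩
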